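/- Let $G$ be a real or complex semisimple Lie group (regarded as a real Lie group) and $P\subset G$ a parabolic subgroup, i.e. a closed subgroup whose Lie algebra $\mathfrak p$ is a parabolic subalgebra of $\mathfrak g$ (its complexification contains a Borel subalgebra of $\mathfrak g\otimes\mathbb C$). Let $\mathfrak g=\mathfrak g_{-k}\oplus\dots\oplus\mathfrak g_k$ be a $|k|$-grading of $\mathfrak g$ inducing $\mathfrak p$: $[\mathfrak g_i,\mathfrak g_j]\subseteq\mathfrak g_{i+j}$, the subalgebra $\mathfrak g_-=\bigoplus_{i<0}\mathfrak g_i$ is generated by $\mathfrak g_{-1}$, and $\mathfrak p=\bigoplus_{i\ge0}\mathfrak g_i$. Put $\mathfrak p_+=\bigoplus_{i>0}\mathfrak g_i$, $P_+=\exp(\mathfrak p_+)$ and $G_0=\{p\in P:\mathrm{Ad}(p)\mathfrak g_i=\mathfrak g_i\ \text{for all } i\}$. Let $(\pi:\mathcal G\to M,\omega)$ be a parabolic geometry of type $(G,P)$: $\pi$ is a smooth principal $P$-bundle over a smooth manifold and $\omega\in\Omega^1(\mathcal G,\mathfrak g)$ is a Cartan connection. Let $\mathcal G_0=\mathcal G/P_+$,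 with projections $\pi_+:\mathcal G\to\mathcal G_0$ and $\pi_0:\mathcal G_0\to M$. A local Weyl structure around $x\in M$ is a smooth $G_0$-equivariant section $\sigma:\pi_0^{-1}(U)\to\pi^{-1}(U)$ of $\pi_+$ over an open neighbourhood $U$ of $x$. An infinitesimal automorphism is a smooth vector field $\mathbf X$ on $\mathcal G$ with $(R_p)_*\mathbf X=\mathbf X$ for all $p\in P$ and $\mathcal L_{\mathbf X}\omega=0$; let $\mathbf X_0$ and $X$ be the vector fields it induces on $\mathcal G_0$ and $M$, and let $\Phi_{\mathbf X,t}$ and $\Phi_{\mathbf X_0,t}$ be the local flows. It is an infinitesimal automorphism of $\sigma$ if $\mathcal L_{\mathbf X}\sigma:=\frac{d}{dt}\big|_{t=0}\,\Phi_{\mathbf X,t}^{-1}\circ\sigma\circ\Phi_{\mathbf X_0,t}=0$. Let $x$ be a singularity of $X$, i.e. $X(x)=0$, and let $u\in\pi^{-1}(x)$. Then there is a unique one-parameter group $h_u^t$ in $P$, the holonomy of $X$ at $x$ with respect to $u$, with $\Phi_{\mathbf X,t}(u)=u.h_u^t$ for all sufficiently small $t$. For every $p\in P$, $\omega(\mathbf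 X(u.p))=\mathrm{Ad}(p^{-1})(\omega(\mathbf X(u)))$, and the following two conditions are equivalent: (a) $p^{-1}h_u^tp\in G_0$ for all $t\in\mathbb R$; (b) $\omega(\mathbf X(u.p))\in\mathfrak g_0$. If the holonomy is conjugate under $P$ to a one-parameter subgroup of $G_0$, i.e. if (a) holds for some $p\in P$, then $X$ is an infinitesimal automorphism of some local Weyl structure $\sigma$ around $x$. More precisely, for every such $p$ the structure $\sigma$ can be built from Cartan exponential coordinates at $u.p$. For $Y\in\mathfrak g$ let $\hat Y$ be the vector field on $\mathcal G$ with $\omega(\hat Y)=Y$, and let $\exp^\omega(v,Y)$ be the time-one flow of $\hat Y$ from $v\in\mathcal G$, where it exists. There are an open neighbourhood $V$ of $0$ in $\mathfrak g_-$ and an open neighbourhood $U$ of $x$ such that $Y\mapsto\pi(\exp^\omega(u.p,Y))$ is defined on $V$ and is a diffeomorphism $V\to U$, and $\sigma$ over $U$ satisfies $$\sigma\big(\pi_+(\exp^\omega(u.p,Y)).g\big)=\exp^\omega(u.p,Y).g\qquad(Y\in V,\ g\in G_0).$$ -/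

import Mathlib

open scoped Manifold ContDiff Topology TensorProduct

noncomputable section

namespace ParabolicGeometry

/-! ### Flows of vector fields -/

section Flow

variable {E : Type*} [NormedAddCommGroup E] [NormedSpace ℝ E]
  {N : Type*} [TopologicalSpace N] [ChartedSpace E N]

/-- The integral curve of `X` starting at `a` is defined up to (and including) the time `t`,
which may be negative. -/
def FlowDefined (X : ∀ a : N, TangentSpace 𝓘(ℝ, E) a) (t : ℝ) (a : N) : Prop :=
  ∃ γ : ℝ → N, γ 0 = a ∧ IsMIntegralCurveOn γ X (Set.uIcc 0 t)

open Classical in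
/-- The flow of `X`: the value at time `t` of the integral curve of `X` through `a`
(with the junk value `a` if that curve does not exist up to time `t`). For a `C^1` vector field on a
Hausdorff manifold without boundary the integral curve is unique. -/
def flow (X : ∀ a : N, TangentSpace 𝓘(ℝ, E) a) (t : ℝ) (a : N) : N :=
  if h : FlowDefined X t a then h.choose t else a

end Flow

/-! ### Gradings of Lie algebras and parabolic subalgebras -/

section Algebra

variable (𝔤 : Type*) [LieRing 𝔤] [LieAlgebra ℝ 𝔤]

/-- A `|k|`-grading `𝔤 = 𝔤_{-k} ⊕ ⋯ ⊕ 𝔤_k` (with `k = depth`): `[𝔤_i, 𝔤_j] ⊆ 𝔤_{i+j}`, and the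
subalgebra `𝔤_- = 𝔤_{-k} ⊕ ⋯ ⊕ 𝔤_{-1}` is generated by `𝔤_{-1}`. -/
structure Grading where
  depth : ℕ
  comp : ℤ → Submodule ℝ 𝔤
  isInternal : DirectSum.IsInternal comp
  comp_eq_bot : ∀ i : ℤ, (depth : ℤ) < |i| → comp i = ⊥
  lie_mem : ∀ i j : ℤ, ∀ x ∈ comp i, ∀ y ∈ comp j, ⁅x, y⁆ ∈ comp (i + j)
  neg_generated : (LieSubalgebra.lieSpan ℝ 𝔤 (comp (-1) : Set 𝔤)).toSubmodule
    = ⨆ i : ℤ, ⨆ _ : i < 0, comp i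

variable {𝔤}

/-- `𝔤_- = ⊕_{i < 0} 𝔤_i`. -/
def Grading.neg (gr : Grading 𝔤) : Submodule ℝ 𝔤 := ⨆ i : ℤ, ⨆ _ : i < 0, gr.comp i

/-- `⊕_{i ≥ 0} 𝔤_i`. -/
def Grading.nonneg (gr : Grading 𝔤) : Submodule ℝ 𝔤 := ⨆ i : ℤ, ⨆ _ : 0 ≤ i, gr.comp i

/-- `𝔭_+ = ⊕_{i > 0} 𝔤_i`. -/
def Grading.pos (gr : Grading 𝔤) : Submodule ℝ 𝔤 := ⨆ i : ℤ, ⨆ _ : 0 < i, gr.comp i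

/-- A subspace `𝔭` of the real Lie algebra `𝔤` whose complexification contains a Borel (i.e. maximal
solvable) subalgebra of the complexification of `𝔤`. For a complex Lie algebra `𝔤` and a
complex subalgebra `𝔭`, this (for the underlying real Lie algebras) says that `𝔭` itself contains a
Borel subalgebra of `𝔤`, since then `𝔤 ⊗ ℂ` is `𝔤` plus its complex conjugate. -/
def ContainsBorel (𝔭 : Submodule ℝ 𝔤) : Prop :=
  ∃ 𝔟 : LieSubalgebra ℂ (ℂ ⊗[ℝ] 𝔤),
    Maximal (fun 𝔠 : LieSubalgebra ℂ (ℂ ⊗[ℝ] 𝔤) ↦ LieAlgebra.IsSolvable 𝔠) 𝔟 ∧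
    𝔟.toSubmodule ≤ 𝔭.baseChange ℂ

end Algebra

/-! ### Lie groups, closed subgroups, parabolic pairs -/

/-- A finite-dimensional real normed space is complete. -/
instance completeSpace_of_finiteDimensional {E : Type*} [NormedAddCommGroup E] [NormedSpace ℝ E]
    [FiniteDimensional ℝ E] : CompleteSpace E := FiniteDimensional.complete ℝ E

instance leInfty_minSmoothness : ENat.LEInfty (minSmoothness ℝ 3) := by
  constructor
  rw [minSmoothness_of_isRCLikeNormedField]
  exact ENat.LEInfty.out

section Group

variable {EG : Type*} [NormedAddCommGroup EG] [NormedSpace ℝ EG]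
  {G : Type*} [TopologicalSpace G] [ChartedSpace EG G] [Group G]

/-- The adjoint action `Ad(g) : 𝔤 → 𝔤`, the derivative at `1` of the conjugation by `g`. -/
def Ad (g : G) : GroupLieAlgebra 𝓘(ℝ, EG) G →L[ℝ] GroupLieAlgebra 𝓘(ℝ, EG) G :=
  (mfderiv 𝓘(ℝ, EG) 𝓘(ℝ, EG) (fun a : G ↦ g * a * g⁻¹) 1 : EG →L[ℝ] EG)

theorem Ad_one (Y : GroupLieAlgebra 𝓘(ℝ, EG) G) : Ad (1 : G) Y = Y := by
  have h : (fun a : G ↦ (1 : G) * a * (1 : G)⁻¹) = id := by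
    funext a
    simp
  unfold Ad
  rw [h, mfderiv_id]
  rfl

theorem Ad_mul [LieGroup 𝓘(ℝ, EG) ∞ G] (g g' : G) (Y : GroupLieAlgebra 𝓘(ℝ, EG) G) :
    Ad (g * g') Y = Ad g (Ad g' Y) := by
  have hd : ∀ (b c : G), MDifferentiableAt 𝓘(ℝ, EG) 𝓘(ℝ, EG) (fun a : G ↦ b * a * b⁻¹) c := by
    intro b c
    have h : ContMDiff 𝓘(ℝ, EG) 𝓘(ℝ, EG) ∞ (fun a : G ↦ b * a * b⁻¹) :=
      (contMDiff_const.mul contMDiff_id).mul contMDiff_const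
    exact (h c).mdifferentiableAt (by simp)
  have h : (fun a : G ↦ g * g' * a * (g * g')⁻¹)
      = (fun a : G ↦ g * a * g⁻¹) ∘ (fun a : G ↦ g' * a * g'⁻¹) := by
    funext a
    simp [mul_assoc]
  have h1 : g' * 1 * g'⁻¹ = 1 := by simp
  unfold Ad
  rw [h, mfderiv_comp 1 (hd g _) (hd g' 1)]
  change (mfderiv 𝓘(ℝ, EG) 𝓘(ℝ, EG) (fun a : G ↦ g * a * g⁻¹) (g' * 1 * g'⁻¹) : EG →L[ℝ] EG)
    ((mfderiv 𝓘(ℝ, EG) 𝓘(ℝ, EG) (fun a : G ↦ g' * a * g'⁻¹) 1 : EG →L[ℝ] EG) Y) = _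
  have key : ∀ c : G, c = 1 →
      (mfderiv 𝓘(ℝ, EG) 𝓘(ℝ, EG) (fun a : G ↦ g * a * g⁻¹) c : EG →L[ℝ] EG)
        = (mfderiv 𝓘(ℝ, EG) 𝓘(ℝ, EG) (fun a : G ↦ g * a * g⁻¹) 1 : EG →L[ℝ] EG) := by
    rintro c rfl
    rfl
  rw [key _ h1]
  rfl

variable {EP : Type*} [NormedAddCommGroup EP] [NormedSpace ℝ EP]
  (P : Subgroup G) [ChartedSpace EP P]

/-- The derivative at `1` of the inclusion `P → G`, as a map from the Lie algebra of `P` to that of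
`G`. -/
def lieIncl : GroupLieAlgebra 𝓘(ℝ, EP) P →L[ℝ] GroupLieAlgebra 𝓘(ℝ, EG) G :=
  (mfderiv 𝓘(ℝ, EP) 𝓘(ℝ, EG) (fun p : P ↦ (p : G)) 1 : EP →L[ℝ] EG)

/-- The manifold structure on the closed subgroup `P` (which carries the subspace topology) is the
one that makes it an embedded Lie subgroup of `G`. -/
structure IsClosedLieSubgroup : Prop where
  isClosed : IsClosed (P : Set G)
  contMDiff_coe : ContMDiff 𝓘(ℝ, EP) 𝓘(ℝ, EG) ∞ (fun p : P ↦ (p : G))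
  injective_lieIncl : Function.Injective (lieIncl (EG := EG) (EP := EP) P)

/-- The exponential map of the Lie group `P`. -/
def lieExp {P : Subgroup G} [ChartedSpace EP P] (Z : GroupLieAlgebra 𝓘(ℝ, EP) P) : P :=
  flow (mulInvariantVectorField Z) 1 (1 : P)

variable [FiniteDimensional ℝ EG] [LieGroup 𝓘(ℝ, EG) ∞ G] (gr : Grading (GroupLieAlgebra 𝓘(ℝ, EG) G))

/-- `G` is semisimple, `P` is a closed subgroup whose Lie algebra `𝔭` is a parabolic subalgebra of
`𝔤`, and `gr` is a `|k|`-grading of `𝔤` inducing `𝔭`, that is `𝔭 = 𝔤_0 ⊕ ⋯ ⊕ 𝔤_k`. -/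
structure IsParabolicPair : Prop where
  isClosedLieSubgroup : IsClosedLieSubgroup (EG := EG) (EP := EP) P
  isSemisimple : LieAlgebra.IsSemisimple ℝ (GroupLieAlgebra 𝓘(ℝ, EG) G)
  containsBorel : ContainsBorel
    (LinearMap.range (lieIncl (EG := EG) (EP := EP) P).toLinearMap)
  lieAlgebra_eq : LinearMap.range (lieIncl (EG := EG) (EP := EP) P).toLinearMap = gr.nonneg

/-- The Levi subgroup `G_0 ⊆ P` with Lie algebra `𝔤_0`: the elements `p` of `P` whose adjoint action
preserves the grading, `Ad(p) 𝔤_i = 𝔤_i` for all `i`. -/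
def G₀ : Subgroup P where
  carrier := {p | ∀ (i : ℤ) (Y : GroupLieAlgebra 𝓘(ℝ, EG) G),
    Ad (p : G) Y ∈ gr.comp i ↔ Y ∈ gr.comp i}
  one_mem' i Y := by simp [Ad_one]
  mul_mem' {p q} hp hq i Y := by
    rw [Subgroup.coe_mul, Ad_mul, hp, hq]
  inv_mem' {p} hp i Y := by
    rw [← hp i, ← Ad_mul, ← Subgroup.coe_mul, mul_inv_cancel, Subgroup.coe_one, Ad_one]

variable (EP) in
/-- The subgroup `P_+ = exp(𝔭_+)` of `P`. (The set `exp(𝔭_+)` is in fact a subgroup already.) -/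
def Pplus : Subgroup P :=
  Subgroup.closure {q | ∃ Z : GroupLieAlgebra 𝓘(ℝ, EP) P, lieIncl P Z ∈ gr.pos ∧ q = lieExp Z}

/-- `𝔤_-`, as a subspace of the normed space on which the manifold `G` is modelled
(which is the tangent space of `G` at `1`). -/
def negSpace : Submodule ℝ EG := gr.neg

end Group

/-! ### Principal bundles, Cartan connections, Weyl structures, infinitesimal automorphisms -/

section Bundle

variable {EG : Type*} [NormedAddCommGroup EG] [NormedSpace ℝ EG]
  {EP : Type*} [NormedAddCommGroup EP] [NormedSpace ℝ EP]
  {EB : Type*} [NormedAddCommGroup EB] [NormedSpace ℝ EB]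
  {EM : Type*} [NormedAddCommGroup EM] [NormedSpace ℝ EM]
  {G : Type*} [TopologicalSpace G] [ChartedSpace EG G] [Group G]
  (P : Subgroup G) [ChartedSpace EP P]
  {B : Type*} [TopologicalSpace B] [ChartedSpace EB B] [MulAction Pᵐᵒᵖ B]
  {M : Type*} [TopologicalSpace M] [ChartedSpace EM M]

/-- The right action of `P` on `B`, written `u.p` in the comments below. -/
def rmul {P : Subgroup G} [MulAction Pᵐᵒᵖ B] (u : B) (p : P) : B := MulOpposite.op p • u

/-- `π : B → M` is a smooth principal `P`-bundle for the given right action of `P` on `B`. -/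
structure IsPrincipalBundle (π : B → M) : Prop where
  contMDiff_proj : ContMDiff 𝓘(ℝ, EB) 𝓘(ℝ, EM) ∞ π
  contMDiff_rmul : ContMDiff (𝓘(ℝ, EB).prod 𝓘(ℝ, EP)) 𝓘(ℝ, EB) ∞
    (fun z : B × P ↦ rmul z.1 z.2)
  proj_rmul : ∀ (u : B) (p : P), π (rmul u p) = π u
  /-- Local triviality: around each point there is an equivariant diffeomorphism
  `π⁻¹(U) ≅ U × P` over `U`. -/
  locallyTrivial : ∀ x : M, ∃ U : Set M, IsOpen U ∧ x ∈ U ∧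
    ∃ e : PartialDiffeomorph 𝓘(ℝ, EB) (𝓘(ℝ, EM).prod 𝓘(ℝ, EP)) B (M × P) ∞,
      e.source = π ⁻¹' U ∧ e.target = U ×ˢ Set.univ ∧
      ∀ u ∈ e.source, (e u).1 = π u ∧ ∀ p : P, e (rmul u p) = (π u, (e u).2 * p)

/-- The fundamental vector field on `B` of `A ∈ 𝔭`: `u ↦ d/dt u.exp(tA)` at `t = 0`. -/
def fundamentalField {P : Subgroup G} [ChartedSpace EP P] [MulAction Pᵐᵒᵖ B]
    (A : GroupLieAlgebra 𝓘(ℝ, EP) P) (u : B) : TangentSpace 𝓘(ℝ, EB) u :=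
  (mfderiv 𝓘(ℝ, EP) 𝓘(ℝ, EB) (fun p : P ↦ rmul u p) 1 A : EB)

/-- A `𝔤`-valued one-form as a function on the tangent bundle. (As a normed space, `𝔤` is the
space `EG` on which `G` is modelled.) -/
def formOnTangentBundle (θ : ∀ u : B, TangentSpace 𝓘(ℝ, EB) u →L[ℝ] GroupLieAlgebra 𝓘(ℝ, EG) G) :
    TangentBundle 𝓘(ℝ, EB) B → EG :=
  fun v ↦ θ v.1 v.2

/-- The function `θ(Y)` on `B`, for a `𝔤`-valued one-form `θ` and a vector field `Y`. -/
def formApply (θ : ∀ u : B, TangentSpace 𝓘(ℝ, EB) u →L[ℝ] GroupLieAlgebra 𝓘(ℝ, EG) G)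
    (Y : ∀ u : B, TangentSpace 𝓘(ℝ, EB) u) : B → EG :=
  fun u ↦ θ u (Y u)

/-- `θ` is a Cartan connection on the principal `P`-bundle `B`. -/
structure IsCartanConnection [IsManifold 𝓘(ℝ, EB) ∞ B]
    (θ : ∀ u : B, TangentSpace 𝓘(ℝ, EB) u →L[ℝ] GroupLieAlgebra 𝓘(ℝ, EG) G) : Prop where
  /-- `θ` is a smooth one-form with values in (the vector space) `𝔤`. -/
  contMDiff : ContMDiff 𝓘(ℝ, EB).tangent 𝓘(ℝ, EG) ∞
    (formOnTangentBundle θ)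
  equivariant : ∀ (p : P) (u : B) (v : TangentSpace 𝓘(ℝ, EB) u),
    θ (rmul u p) (mfderiv 𝓘(ℝ, EB) 𝓘(ℝ, EB) (fun w : B ↦ rmul w p) u v)
      = Ad ((p : G)⁻¹) (θ u v)
  fundamental : ∀ (A : GroupLieAlgebra 𝓘(ℝ, EP) P) (u : B),
    θ u (fundamentalField A u) = lieIncl P A
  bijective : ∀ u : B, Function.Bijective (θ u)

/-- The derivative `X(f)` of the function `f : B → 𝔤` along the vector field `X`. -/
def fieldDeriv (X : ∀ u : B, TangentSpace 𝓘(ℝ, EB) u) (f : B → EG) : B → EG :=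
  fun u ↦ mfderiv 𝓘(ℝ, EB) 𝓘(ℝ, EG) f u (X u)

/-- The Lie derivative `(𝓛_X θ)(Y) = X(θ(Y)) - θ([X, Y])` of a `𝔤`-valued one-form. -/
def lieDerivForm (θ : ∀ u : B, TangentSpace 𝓘(ℝ, EB) u →L[ℝ] GroupLieAlgebra 𝓘(ℝ, EG) G)
    (X Y : ∀ u : B, TangentSpace 𝓘(ℝ, EB) u) : B → EG :=
  fieldDeriv X (formApply θ Y) - formApply θ (VectorField.mlieBracket 𝓘(ℝ, EB) X Y)

/-- `X` is a smooth vector field on `B`. -/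
def IsSmoothField [IsManifold 𝓘(ℝ, EB) ∞ B] (X : ∀ u : B, TangentSpace 𝓘(ℝ, EB) u) : Prop :=
  ContMDiff 𝓘(ℝ, EB) 𝓘(ℝ, EB).tangent ∞ (fun u : B ↦ (⟨u, X u⟩ : TangentBundle 𝓘(ℝ, EB) B))

/-- `X` is an infinitesimal automorphism of the Cartan geometry `(B, θ)`: a smooth vector field on
`B` with `(R_p)_* X = X` for all `p ∈ P` and `𝓛_X θ = 0`. -/
structure IsInfinitesimalAutomorphism [IsManifold 𝓘(ℝ, EB) ∞ B]
    (θ : ∀ u : B, TangentSpace 𝓘(ℝ, EB) u →L[ℝ] GroupLieAlgebra 𝓘(ℝ, EG) G)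
    (X : ∀ u : B, TangentSpace 𝓘(ℝ, EB) u) : Prop where
  smooth : IsSmoothField X
  rightInvariant : ∀ (p : P) (u : B),
    mfderiv 𝓘(ℝ, EB) 𝓘(ℝ, EB) (fun w : B ↦ rmul w p) u (X u) = X (rmul u p)
  lieDeriv_eq_zero : ∀ Y : (∀ u : B, TangentSpace 𝓘(ℝ, EB) u), IsSmoothField Y →
    lieDerivForm θ X Y = 0

/-- `h` is the holonomy of `X` with respect to the point `u`: the one-parameter group in `P` with
`Φ_{X,t}(u) = u.h(t)` for all sufficiently small `t`. -/
structure IsHolonomy (X : ∀ u : B, TangentSpace 𝓘(ℝ, EB) u) (u : B) (h : ℝ → P) : Prop where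
  map_add : ∀ s t : ℝ, h (s + t) = h s * h t
  flow_eq : ∃ ε > 0, ∀ t : ℝ, |t| < ε → FlowDefined X t u ∧ flow X t u = rmul u (h t)

/-- The vector field `Ŷ` on `B` with `θ(Ŷ) = Y`, for `Y ∈ 𝔤`. -/
def constField (θ : ∀ u : B, TangentSpace 𝓘(ℝ, EB) u →L[ℝ] GroupLieAlgebra 𝓘(ℝ, EG) G)
    (Y : GroupLieAlgebra 𝓘(ℝ, EG) G) (u : B) : TangentSpace 𝓘(ℝ, EB) u :=
  Function.invFun (θ u) Y

/-- The exponential map `exp^θ(u, Y) = Φ_{Ŷ,1}(u)` of the Cartan connection `θ`. -/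
def cartanExp (θ : ∀ u : B, TangentSpace 𝓘(ℝ, EB) u →L[ℝ] GroupLieAlgebra 𝓘(ℝ, EG) G)
    (u : B) (Y : GroupLieAlgebra 𝓘(ℝ, EG) G) : B :=
  flow (constField θ Y) 1 u

variable [FiniteDimensional ℝ EG] [LieGroup 𝓘(ℝ, EG) ∞ G] (gr : Grading (GroupLieAlgebra 𝓘(ℝ, EG) G))

variable (EP B) in
/-- The orbit space `B_0 = B / P_+`. -/
abbrev OrbitSpace : Type _ := MulAction.orbitRel.Quotient (Pplus EP P gr).op B

variable (EP) in
/-- The projection `π_+ : B → B_0`. -/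
def projPlus (w : B) : OrbitSpace EP P B gr := Quotient.mk'' w

/-- `σ` is a local Weyl structure over the open set `U ⊆ M`: a smooth, `G_0`-equivariant section over
`π_0⁻¹(U) = π_+(π⁻¹(U)) ⊆ B_0` of `π_+ : B → B_0`; its values elsewhere are irrelevant.
As `π_+` is a surjective submersion onto the quotient manifold `B_0`, smoothness of `σ` is
smoothness of `σ ∘ π_+`. The right action of `G_0` on `B_0` is `π_+(w).g = π_+(w.g)`. -/
structure IsLocalWeylStructure (π : B → M) (U : Set M) (σ : OrbitSpace EP P B gr → B) : Prop where
  isOpen : IsOpen U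
  contMDiffOn : ContMDiffOn 𝓘(ℝ, EB) 𝓘(ℝ, EB) ∞ (fun w : B ↦ σ (projPlus EP P gr w)) (π ⁻¹' U)
  isSection : ∀ w : B, π w ∈ U → projPlus EP P gr (σ (projPlus EP P gr w)) = projPlus EP P gr w
  equivariant : ∀ w : B, π w ∈ U → ∀ g ∈ G₀ P gr,
    σ (projPlus EP P gr (rmul w g)) = rmul (σ (projPlus EP P gr w)) g

/-- `X` is an infinitesimal automorphism of the local Weyl structure `σ` over `U`: `𝓛_X σ = 0`, where
`𝓛_X σ` is the derivative at `t = 0` of `Φ_{X,t}⁻¹ ∘ σ ∘ Φ_{X_0,t}`. Here `X_0` is the vector field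
on `B_0` induced by `X`; its flow is given by `Φ_{X_0,t}(π_+(w)) = π_+(Φ_{X,t}(w))`. -/
def LieDerivWeylEqZero (π : B → M) (X : ∀ u : B, TangentSpace 𝓘(ℝ, EB) u) (U : Set M)
    (σ : OrbitSpace EP P B gr → B) : Prop :=
  ∀ w : B, π w ∈ U → HasMFDerivAt 𝓘(ℝ, ℝ) 𝓘(ℝ, EB)
    (fun t : ℝ ↦ flow X (-t) (σ (projPlus EP P gr (flow X t w)))) 0 0

/-- The local Weyl structure `σ` over `U` is the one built from the exponential coordinates of `θ`
at `u`: the map `Y ↦ π(exp^θ(u, Y))` is a diffeomorphism from an open neighbourhood of `0` in `𝔤_-`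
onto `U`, and `σ(π_+(exp^θ(u, Y)).g) = exp^θ(u, Y).g` for all such `Y` and all `g ∈ G_0`. -/
def IsExponentialWeyl
    (θ : ∀ u : B, TangentSpace 𝓘(ℝ, EB) u →L[ℝ] GroupLieAlgebra 𝓘(ℝ, EG) G)
    (π : B → M) (u : B) (U : Set M) (σ : OrbitSpace EP P B gr → B) : Prop :=
  ∃ Ψ : PartialDiffeomorph 𝓘(ℝ, negSpace gr) 𝓘(ℝ, EM) (negSpace gr) M ∞,
    (0 : negSpace gr) ∈ Ψ.source ∧ Ψ.target = U ∧
    ∀ Y ∈ Ψ.source,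
      FlowDefined (constField θ (Y : EG)) 1 u ∧
      Ψ Y = π (cartanExp θ u (Y : EG)) ∧
      ∀ g ∈ G₀ P gr, σ (projPlus EP P gr (rmul (cartanExp θ u (Y : EG)) g))
        = rmul (cartanExp θ u (Y : EG)) g

end Bundle

end ParabolicGeometry

end

/-! Since `X` vanishes at `x`, the lift `XB` is vertical at `u`: `XB u` is the value at `u` of the
fundamental field of some `A ∈ 𝔭` (`IsPrincipalBundle.exists_fund_eq`). By right invariance, `XB` at
`u.p` is the fundamental field of `Ad(p⁻¹)A`. As `Ad(exp(tA))` fixes `A`, the curve `u.exp(tA)` is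
an integral curve, and the holonomy is `exp(tA)`; uniqueness follows from the freeness of the action
for small `t` and from taking powers for all `t`. Semisimplicity makes the derivation that
multiplies `𝔤_i` by `i` inner, equal to `ad E`, and `G₀` is the stabilizer in `P` of the grading
element `E` (`mem_G₀_iff`). So (a) says that `Ad(p⁻¹)A = θ(XB(u.p))` commutes with `E`, which means
that it has degree zero (`gexp_smul_mem_G₀_iff`).

For the Weyl structure, put `v = u.p`, write `A` for `Ad(p⁻¹)A`, and let `F(Y) = exp^θ(v, Y)`. From
`𝓛_X θ = 0` it follows that `XB` commutes with all constant fields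
(`IsInfinitesimalAutomorphism.bracketField_frame`). Together with the equivariance of `θ` this gives
`Φ_t(F(Y).q) = F(Ad(exp(tA))Y).exp(tA)q` as long as the coordinates stay in the domain of `F`
(`IsNormalMap.flow_rmul`). If `exp(tA) ∈ G₀`, then `Ad(exp(tA))` preserves `𝔤_-`, so the flow moves
the section `F(𝔤_-)` only by elements of `G₀`. Let `σ` send the `P_+`-class of `F(Y).q` to
`F(Y).r(q)`, where `r(q)` is the only element of `G₀` in `q P_+`. Because `r(gq) = g r(q)` for `g ∈
G₀`, the curve `Φ_{-t} ∘ σ ∘ Φ_{0,t}` is constant near `t = 0`.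

The algebraic ingredient is the existence and smoothness of `r` (`exists_retraction`), that is, `P =
G₀ P_+` with `G₀ ∩ P_+ = 1`. Existence: an automorphism preserving `𝔭` preserves its Killing
orthogonal `𝔭_+`, and `Ad(q)E` lies in `E + 𝔭_+` (`Ad_gradingElement_sub_mem`), all of whose
elements are carried to `E` by elements of `P_+` depending smoothly on them
(`exists_contMDiff_conj`). Uniqueness: elements of `G₀ ∩ P_+` act trivially on `𝔤`, and a smooth
curve in the kernel of `Ad` is constant since `𝔤` has no center.

The analytic ingredients are the smooth dependence of time-one maps on the field
(`exists_contMDiffOn_timeOne`), from the inverse function theorem on a space of curves, and the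
invariance of a field along variations by integral curves of a commuting field
(`hasVelocityAt_of_bracketField_eq_zero`). -/

noncomputable section
namespace ParabolicGeometry

/-! ### Smooth dependence of solutions of differential equations on parameters -/

section SmoothDependence

universe u v

open Set Metric

/-- The pointwise application of a curve of operators to a curve of vectors. -/
def curveApply (K : Type*) [TopologicalSpace K] [CompactSpace K] (E F : Type*)
    [NormedAddCommGroup E] [NormedSpace ℝ E] [NormedAddCommGroup F] [NormedSpace ℝ F] :
    C(K, E →L[ℝ] F) →L[ℝ] C(K, E) →L[ℝ] C(K, F) :=
  LinearMap.mkContinuous₂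
    (LinearMap.mk₂ ℝ (fun (A : C(K, E →L[ℝ] F)) (h : C(K, E)) ↦
        (⟨fun x ↦ A x (h x), by fun_prop⟩ : C(K, F)))
      (fun A A' h ↦ by ext; simp) (fun c A h ↦ by ext; simp)
      (fun A h h' ↦ by ext; simp) (fun c A h ↦ by ext; simp)) 1 (by
    intro A h
    rw [ContinuousMap.norm_le _ (by positivity)]
    intro x
    simp only [LinearMap.mk₂_apply, ContinuousMap.coe_mk, one_mul]
    exact ((A x).le_opNorm _).trans
      (mul_le_mul (A.norm_coe_le_norm x) (h.norm_coe_le_norm x) (norm_nonneg (h x)) (norm_nonneg A)))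

@[simp]
theorem curveApply_apply {K : Type*} [TopologicalSpace K] [CompactSpace K] {E F : Type*}
    [NormedAddCommGroup E] [NormedSpace ℝ E] [NormedAddCommGroup F] [NormedSpace ℝ F]
    (A : C(K, E →L[ℝ] F)) (h : C(K, E)) (x : K) : curveApply K E F A h x = A x (h x) := rfl

/-- The mean value inequality on the segment from `γ x` to `γ x + h x` bounds the remainder. The
bound is uniform in `x` because `γ ↦ f' ∘ γ` is continuous for the sup norm. -/
theorem hasFDerivAt_curve_comp {K : Type*} [TopologicalSpace K] [CompactSpace K] {E F : Type*}
    [NormedAddCommGroup E] [NormedSpace ℝ E] [NormedAddCommGroup F] [NormedSpace ℝ F]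
    (f : C(E, F)) (f' : C(E, E →L[ℝ] F)) (hf : ∀ x, HasFDerivAt f (f' x) x) (γ : C(K, E)) :
    HasFDerivAt (fun γ : C(K, E) ↦ f.comp γ) (curveApply K E F (f'.comp γ)) γ := by
  rw [hasFDerivAt_iff_isLittleO_nhds_zero, Asymptotics.isLittleO_iff]
  intro c hc
  have hcont : Continuous (fun γ : C(K, E) ↦ f'.comp γ) := f'.continuous_postcomp
  obtain ⟨δ, hδ, hδ'⟩ := (Metric.continuousAt_iff
    (f := fun γ : C(K, E) ↦ f'.comp γ) (a := γ)).1 hcont.continuousAt c hc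
  filter_upwards [ball_mem_nhds (0 : C(K, E)) hδ] with h hh
  rw [mem_ball_zero_iff] at hh
  rw [ContinuousMap.norm_le _ (by positivity)]
  intro x
  have hseg : ∀ z ∈ segment ℝ (γ x) (γ x + h x), ‖f' z - f' (γ x)‖ ≤ c := by
    rw [segment_eq_image']
    rintro _ ⟨s, ⟨hs0, hs1⟩, rfl⟩
    have h1 : dist (γ + s • h) γ < δ := by
      rw [dist_eq_norm, add_sub_cancel_left, norm_smul, Real.norm_of_nonneg hs0]
      calc s * ‖h‖ ≤ 1 * ‖h‖ := by gcongr
        _ < δ := by rwa [one_mul]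
    have h2 := (ContinuousMap.dist_apply_le_dist x).trans (hδ' h1).le
    simpa [dist_eq_norm] using h2
  have := (convex_segment (γ x) (γ x + h x)).norm_image_sub_le_of_norm_hasFDerivWithin_le'
    (f := f) (f' := f') (φ := f' (γ x)) (fun z _ ↦ (hf z).hasFDerivWithinAt) hseg
    (left_mem_segment ℝ _ _) (right_mem_segment ℝ _ _)
  rw [add_sub_cancel_left] at this
  refine le_trans ?_ (this.trans (by gcongr; exact h.norm_coe_le_norm x))
  simp

/-- Induction on `n`: the derivative is composition with `f'`, followed by the continuous linear map
`curveApply`. The induction replaces `F` by `E →L[ℝ] F`, so `F` has to live in a universe that is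
stable under this operation. -/
theorem contDiff_nat_curve_comp {K : Type*} [TopologicalSpace K] [CompactSpace K] {E : Type u}
    [NormedAddCommGroup E] [NormedSpace ℝ E] (n : ℕ) :
    ∀ {F : Type (max u v)} [NormedAddCommGroup F] [NormedSpace ℝ F] (f : C(E, F)),
      ContDiff ℝ n f → ContDiff ℝ n (fun γ : C(K, E) ↦ f.comp γ) := by
  induction n with
  | zero =>
    intro F _ _ f _
    exact contDiff_zero.2 f.continuous_postcomp
  | succ n ih =>
    intro F _ _ f hf
    push_cast at hf ⊢
    rw [contDiff_succ_iff_hasFDerivAt] at hf ⊢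
    obtain ⟨f', hf', hd⟩ := hf
    let f'' : C(E, E →L[ℝ] F) := ⟨f', hf'.continuous⟩
    exact ⟨fun γ ↦ curveApply K E F (f''.comp γ),
      ContDiff.comp (g := curveApply K E F) (ContinuousLinearMap.contDiff _) (ih f'' hf'),
      hasFDerivAt_curve_comp f f'' hd⟩

/-- Composition with a smooth map is a smooth map between spaces of continuous curves. -/
theorem contDiff_curve_comp {K : Type*} [TopologicalSpace K] [CompactSpace K] {E : Type u}
    [NormedAddCommGroup E] [NormedSpace ℝ E] {F : Type (max u v)} [NormedAddCommGroup F]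
    [NormedSpace ℝ F] (f : C(E, F)) (hf : ContDiff ℝ ∞ f) :
    ContDiff ℝ ∞ (fun γ : C(K, E) ↦ f.comp γ) :=
  contDiff_infty.2 fun n ↦ contDiff_nat_curve_comp.{u, v} n f (contDiff_infty.1 hf n)

/-- The inverse function theorem, with a smooth inverse on an open set. -/
theorem exists_openPartialHomeomorph_contDiffOn_symm {E F : Type*} [NormedAddCommGroup E]
    [NormedSpace ℝ E] [CompleteSpace E] [NormedAddCommGroup F] [NormedSpace ℝ F]
    {f : E → F} {D : Set E} (hD : IsOpen D) {a : E} (ha : a ∈ D) (hf : ContDiffOn ℝ ∞ f D)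
    (f' : E ≃L[ℝ] F) (hf' : HasFDerivAt f (f' : E →L[ℝ] F) a) :
    ∃ h : OpenPartialHomeomorph E F, a ∈ h.source ∧ h.source ⊆ D ∧ (h : E → F) = f ∧
      ContDiffOn ℝ ∞ h.symm h.target := by
  have hfa : ContDiffAt ℝ ∞ f a := hf.contDiffAt (hD.mem_nhds ha)
  let h₀ := hfa.toOpenPartialHomeomorph f hf' (by simp)
  have hh₀ : (h₀ : E → F) = f := rfl
  -- The derivative has to be invertible at every point of the source, not only at `a`, for the
  -- inverse to be smooth on its whole domain. This is an open condition.
  let O : Set E := D ∩ fderiv ℝ f ⁻¹' range ((↑) : (E ≃L[ℝ] F) → E →L[ℝ] F)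
  have hO : IsOpen O :=
    (hf.continuousOn_fderiv_of_isOpen hD (by simp)).isOpen_inter_preimage hD
      ContinuousLinearEquiv.isOpen
  have haO : a ∈ O := ⟨ha, f', hf'.fderiv.symm⟩
  refine ⟨h₀.restr O, ⟨hfa.mem_toOpenPartialHomeomorph_source hf' (by simp), ?_⟩, ?_, rfl, ?_⟩
  · rwa [hO.interior_eq]
  · intro x hx
    have : x ∈ O := by simpa [hO.interior_eq] using hx.2
    exact this.1
  · intro y hy
    have hy' := (h₀.restr O).map_target hy
    have : (h₀.restr O).symm y ∈ O := by simpa [hO.interior_eq] using hy'.2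
    obtain ⟨hxD, e, he⟩ := this
    have hc : ContDiffAt ℝ ∞ f ((h₀.restr O).symm y) := hf.contDiffAt (hD.mem_nhds hxD)
    refine ((h₀.restr O).contDiffAt_symm (f₀' := e) hy ?_ hc).contDiffWithinAt
    rw [he]
    exact (hc.differentiableAt (by simp)).hasFDerivAt

/-- Integration of curves on `[-1, 1]`, from `0`. -/
def curveIntegral (E : Type*) [NormedAddCommGroup E] [NormedSpace ℝ E] [CompleteSpace E] :
    C(Icc (-1 : ℝ) 1, E) →L[ℝ] C(Icc (-1 : ℝ) 1, E) :=
  LinearMap.mkContinuous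
    { toFun := fun γ ↦ ⟨fun s ↦ ∫ r in (0 : ℝ)..s, IccExtend (by norm_num) γ r,
        (intervalIntegral.continuous_primitive
          (fun a b ↦ (γ.continuous.Icc_extend' (h := by norm_num)).intervalIntegrable a b) 0).comp
          continuous_subtype_val⟩
      map_add' := fun γ γ' ↦ by
        ext s
        exact intervalIntegral.integral_add
          ((γ.continuous.Icc_extend' (h := by norm_num)).intervalIntegrable _ _)
          ((γ'.continuous.Icc_extend' (h := by norm_num)).intervalIntegrable _ _)
      map_smul' := fun c γ ↦ by
        ext s
        exact intervalIntegral.integral_smul c _ } 1 (by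
    intro γ
    rw [ContinuousMap.norm_le _ (by positivity), one_mul]
    intro s
    refine (intervalIntegral.norm_integral_le_of_norm_le_const (C := ‖γ‖) fun r _ ↦
      γ.norm_coe_le_norm _).trans ?_
    rw [sub_zero]
    exact mul_le_of_le_one_right (norm_nonneg _) (abs_le.2 s.2))

/-- The map whose zeros are the solutions of `γ(s) = x₀ + ∫₀ˢ f(γ(r)) Y dr`. -/
def picardMap {E F : Type*} [NormedAddCommGroup E] [NormedSpace ℝ E] [CompleteSpace E]
    [NormedAddCommGroup F] [NormedSpace ℝ F] (f : C(E, F →L[ℝ] E)) (x₀ : E)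
    (z : F × C(Icc (-1 : ℝ) 1, E)) : F × C(Icc (-1 : ℝ) 1, E) :=
  (z.1, z.2 - ContinuousMap.const _ x₀ - curveIntegral E
    (curveApply (Icc (-1 : ℝ) 1) F E (f.comp z.2) (ContinuousLinearMap.const ℝ _ z.1)))

/-- The linearization of `picardMap` at the constant curve for `Y = 0`. -/
def picardLinear {E F : Type*} [NormedAddCommGroup E] [NormedSpace ℝ E] [CompleteSpace E]
    [NormedAddCommGroup F] [NormedSpace ℝ F] (f : C(E, F →L[ℝ] E)) (x₀ : E) :
    F →L[ℝ] C(Icc (-1 : ℝ) 1, E) :=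
  (curveIntegral E).comp ((curveApply (Icc (-1 : ℝ) 1) F E (f.comp (ContinuousMap.const _ x₀))).comp
    (ContinuousLinearMap.const ℝ _))

/-- The shear `(Y, γ) ↦ (Y, γ - L Y)`. -/
def shearEquiv {E F : Type*} [NormedAddCommGroup E] [NormedSpace ℝ E]
    [NormedAddCommGroup F] [NormedSpace ℝ F] (L : F →L[ℝ] E) : (F × E) ≃L[ℝ] (F × E) :=
  ContinuousLinearEquiv.equivOfInverse
    ((ContinuousLinearMap.fst ℝ F E).prod
      (ContinuousLinearMap.snd ℝ F E - L.comp (ContinuousLinearMap.fst ℝ F E)))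
    ((ContinuousLinearMap.fst ℝ F E).prod
      (ContinuousLinearMap.snd ℝ F E + L.comp (ContinuousLinearMap.fst ℝ F E)))
    (fun z ↦ by simp) (fun z ↦ by simp)

theorem contDiff_picardMap {E : Type u} {F : Type v} [NormedAddCommGroup E] [NormedSpace ℝ E]
    [CompleteSpace E] [NormedAddCommGroup F] [NormedSpace ℝ F] (f : C(E, F →L[ℝ] E))
    (hf : ContDiff ℝ ∞ f) (x₀ : E) : ContDiff ℝ ∞ (picardMap f x₀) := by
  have h1 : ContDiff ℝ ∞ (fun z : F × C(Icc (-1 : ℝ) 1, E) ↦ f.comp z.2) :=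
    (contDiff_curve_comp.{u, v} f hf).comp contDiff_snd
  have h2 : ContDiff ℝ ∞ (fun z : F × C(Icc (-1 : ℝ) 1, E) ↦
      (ContinuousLinearMap.const ℝ (Icc (-1 : ℝ) 1) z.1 : C(Icc (-1 : ℝ) 1, F))) :=
    ContDiff.comp (g := ContinuousLinearMap.const ℝ (Icc (-1 : ℝ) 1))
      (ContinuousLinearMap.contDiff _) contDiff_fst
  have h3 : ContDiff ℝ ∞ (fun z : F × C(Icc (-1 : ℝ) 1, E) ↦
      curveApply (Icc (-1 : ℝ) 1) F E (f.comp z.2)) :=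
    ContDiff.comp (g := curveApply (Icc (-1 : ℝ) 1) F E) (ContinuousLinearMap.contDiff _) h1
  have h4 := ContDiff.comp (g := curveIntegral E) (n := ∞) (ContinuousLinearMap.contDiff _)
    (h3.clm_apply h2)
  exact contDiff_fst.prodMk ((contDiff_snd.sub contDiff_const).sub h4)

/-- The integrand is linear in `Y`, so its derivative in the curve vanishes at `Y = 0`. Only a shear
remains, and a shear is invertible; this is why the inverse function theorem applies. -/
theorem hasFDerivAt_picardMap {E : Type u} {F : Type v} [NormedAddCommGroup E] [NormedSpace ℝ E]
    [CompleteSpace E] [NormedAddCommGroup F] [NormedSpace ℝ F] (f : C(E, F →L[ℝ] E))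
    (hf : ContDiff ℝ ∞ f) (x₀ : E) :
    HasFDerivAt (picardMap f x₀)
      (shearEquiv (picardLinear f x₀) : F × C(Icc (-1 : ℝ) 1, E) →L[ℝ] F × C(Icc (-1 : ℝ) 1, E))
      (0, ContinuousMap.const _ x₀) := by
  have h1 : HasFDerivAt (fun z : F × C(Icc (-1 : ℝ) 1, E) ↦
      curveApply (Icc (-1 : ℝ) 1) F E (f.comp z.2)) _ (0, ContinuousMap.const _ x₀) :=
    DifferentiableAt.hasFDerivAt (ContDiff.differentiable (n := ∞) (ContDiff.comp
      (g := curveApply (Icc (-1 : ℝ) 1) F E) (ContinuousLinearMap.contDiff _)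
      ((contDiff_curve_comp.{u, v} f hf).comp contDiff_snd)) (by simp) _)
  have h2 : HasFDerivAt (fun z : F × C(Icc (-1 : ℝ) 1, E) ↦
      (ContinuousLinearMap.const ℝ (Icc (-1 : ℝ) 1) z.1 : C(Icc (-1 : ℝ) 1, F)))
      ((ContinuousLinearMap.const ℝ (Icc (-1 : ℝ) 1)).comp (ContinuousLinearMap.fst ℝ F _))
      (0, ContinuousMap.const _ x₀) :=
    ((ContinuousLinearMap.const ℝ (Icc (-1 : ℝ) 1)).comp
      (ContinuousLinearMap.fst ℝ F C(Icc (-1 : ℝ) 1, E))).hasFDerivAt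
  have h4 := ((curveIntegral E).hasFDerivAt).comp _ (h1.clm_apply h2)
  refine (hasFDerivAt_fst.prodMk ((hasFDerivAt_snd.sub_const _).sub h4)).congr_fderiv ?_
  ext z <;> simp [shearEquiv, picardLinear]

/-- Smooth dependence on parameters: the solutions of `γ' = f(γ) Y`, `γ(0) = x₀` at time `1`
depend smoothly on `Y` near `0`. -/
theorem exists_contDiffOn_timeOne_of_contDiff {E : Type u} {F : Type v} [NormedAddCommGroup E]
    [NormedSpace ℝ E] [CompleteSpace E] [NormedAddCommGroup F] [NormedSpace ℝ F] [CompleteSpace F]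
    (f : E → F →L[ℝ] E) (hf : ContDiff ℝ ∞ f) (x₀ : E) :
    ∃ ρ > 0, ∃ g : F → E, ContDiffOn ℝ ∞ g (ball 0 ρ) ∧ g 0 = x₀ ∧
      ∀ (Y : F) (s : ℝ), s • Y ∈ ball (0 : F) ρ →
        HasDerivAt (fun s : ℝ ↦ g (s • Y)) (f (g (s • Y)) Y) s := by
  let fc : C(E, F →L[ℝ] E) := ⟨f, hf.continuous⟩
  let one : Icc (-1 : ℝ) 1 := ⟨1, by norm_num⟩
  have hle : (-1 : ℝ) ≤ 1 := by norm_num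
  let c₀ : C(Icc (-1 : ℝ) 1, E) := ContinuousMap.const _ x₀
  obtain ⟨h, hmem, -, hcoe, hsymm⟩ := exists_openPartialHomeomorph_contDiffOn_symm isOpen_univ
    (mem_univ _) (contDiff_picardMap fc hf x₀).contDiffOn (shearEquiv (picardLinear fc x₀))
    (hasFDerivAt_picardMap fc hf x₀)
  have hΦ : ∀ z, h z = picardMap fc x₀ z := fun z ↦ by rw [hcoe]
  have hint : ∀ (Y : F) (γ : C(Icc (-1 : ℝ) 1, E)) (s : Icc (-1 : ℝ) 1),
      curveIntegral E (curveApply (Icc (-1 : ℝ) 1) F E (fc.comp γ)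
        (ContinuousLinearMap.const ℝ _ Y)) s = ∫ r in (0 : ℝ)..s, f (IccExtend hle γ r) Y := by
    intro Y γ s
    rfl
  have h00 : h (0, c₀) = (0, 0) := by
    rw [hΦ]
    refine Prod.ext rfl ?_
    ext s
    change c₀ s - x₀ - curveIntegral E _ s = 0
    rw [hint]
    simp [c₀]
  have h0t : ((0 : F), (0 : C(Icc (-1 : ℝ) 1, E))) ∈ h.target := h00 ▸ h.map_source hmem
  have h0s : h.symm (0, 0) = (0, c₀) := by rw [← h00, h.left_inv hmem]
  obtain ⟨δ, hδ, hδs⟩ := Metric.isOpen_iff.1 h.open_source _ hmem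
  let S : F → F × C(Icc (-1 : ℝ) 1, E) := fun Y ↦ h.symm (Y, 0)
  have hS : ∀ᶠ Y in 𝓝 (0 : F), (Y, (0 : C(Icc (-1 : ℝ) 1, E))) ∈ h.target ∧
      S Y ∈ ball ((0 : F), c₀) δ := by
    have hc : ContinuousAt (fun Y : F ↦ (Y, (0 : C(Icc (-1 : ℝ) 1, E)))) 0 := by fun_prop
    have h1 : ∀ᶠ Y in 𝓝 (0 : F), (Y, (0 : C(Icc (-1 : ℝ) 1, E))) ∈ h.target :=
      hc.eventually (h.open_target.mem_nhds h0t)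
    have h2 : ContinuousAt S 0 :=
      ContinuousAt.comp (f := fun Y : F ↦ (Y, (0 : C(Icc (-1 : ℝ) 1, E)))) (g := h.symm) (x := 0)
        (h.continuousAt_symm h0t) hc
    have h3 : S 0 = (0, c₀) := h0s
    exact h1.and (h2.eventually (by rw [h3]; exact ball_mem_nhds _ hδ))
  obtain ⟨ρ', hρ', hball⟩ := Metric.eventually_nhds_iff_ball.1 hS
  -- Below `ρ'` the local inverse is defined and its values are `δ`-close to the constant curve.
  -- Below `δ`, a pair of `Y` and a `δ`-close curve lies in the source, where `h` is injective.
  set ρ := min ρ' δ with hρdef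
  have hρ : 0 < ρ := lt_min hρ' hδ
  have hSt : ∀ Y ∈ ball (0 : F) ρ, (Y, (0 : C(Icc (-1 : ℝ) 1, E))) ∈ h.target :=
    fun Y hY ↦ (hball Y (ball_subset_ball (min_le_left _ _) hY)).1
  have hSb : ∀ Y ∈ ball (0 : F) ρ, (S Y).2 ∈ ball c₀ δ := fun Y hY ↦ by
    have := (hball Y (ball_subset_ball (min_le_left _ _) hY)).2
    rw [← ball_prod_same] at this
    exact this.2
  have hSeq : ∀ Y ∈ ball (0 : F) ρ, picardMap fc x₀ (S Y) = (Y, 0) := fun Y hY ↦ by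
    rw [← hΦ]
    exact h.right_inv (hSt Y hY)
  have hS1 : ∀ Y ∈ ball (0 : F) ρ, (S Y).1 = Y := fun Y hY ↦ congrArg Prod.fst (hSeq Y hY)
  have hS2 : ∀ Y ∈ ball (0 : F) ρ, ∀ s : Icc (-1 : ℝ) 1,
      (S Y).2 s = x₀ + ∫ r in (0 : ℝ)..s, f (IccExtend hle (S Y).2 r) Y := by
    intro Y hY s
    have h1 := DFunLike.congr_fun (congrArg Prod.snd (hSeq Y hY)) s
    change (S Y).2 s - x₀ - curveIntegral E _ s = 0 at h1
    rw [hint, hS1 Y hY] at h1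
    rw [← sub_eq_zero, ← h1]
    abel
  -- Injectivity of `h` is uniqueness for the integral equation among curves close to the constant
  -- one.
  have huniq : ∀ Y ∈ ball (0 : F) ρ, ∀ γ ∈ ball c₀ δ,
      (∀ s : Icc (-1 : ℝ) 1, γ s = x₀ + ∫ r in (0 : ℝ)..s, f (IccExtend hle γ r) Y) →
      (S Y).2 = γ := by
    intro Y hY γ hγ heq
    have h1 : h (Y, γ) = (Y, 0) := by
      rw [hΦ]
      refine Prod.ext rfl ?_
      ext s
      change γ s - x₀ - curveIntegral E _ s = 0
      rw [hint, heq s]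
      abel
    have h2 : (Y, γ) ∈ h.source := by
      apply hδs
      rw [← ball_prod_same]
      exact ⟨ball_subset_ball (min_le_right _ _) hY, hγ⟩
    have h3 : S Y = (Y, γ) := by
      change h.symm (Y, 0) = _
      rw [← h1, h.left_inv h2]
    rw [h3]
  let g : F → E := fun Y ↦ (S Y).2 one
  -- Slowing the solution for `Y` down by the factor `s` gives a solution for `s • Y`, so the
  -- time-one value for `s • Y` is the value of the original solution at time `s`.
  have hscale : ∀ Y ∈ ball (0 : F) ρ, ∀ s : Icc (-1 : ℝ) 1, g ((s : ℝ) • Y) = (S Y).2 s := by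
    intro Y hY s
    have hs : |(s : ℝ)| ≤ 1 := abs_le.2 s.2
    have hsY : (s : ℝ) • Y ∈ ball (0 : F) ρ := by
      rw [mem_ball_zero_iff] at hY ⊢
      rw [norm_smul, Real.norm_eq_abs]
      exact (mul_le_of_le_one_left (norm_nonneg _) hs).trans_lt hY
    have hmul : ∀ r : Icc (-1 : ℝ) 1, (s : ℝ) * r ∈ Icc (-1 : ℝ) 1 := fun r ↦ by
      rw [mem_Icc, ← abs_le, abs_mul]
      exact mul_le_one₀ hs (abs_nonneg _) (abs_le.2 r.2)
    let γ : C(Icc (-1 : ℝ) 1, E) :=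
      ⟨fun r ↦ (S Y).2 ⟨s * r, hmul r⟩, by fun_prop⟩
    have hγ : γ ∈ ball c₀ δ := by
      have := hSb Y hY
      rw [mem_ball] at this ⊢
      refine lt_of_le_of_lt ((ContinuousMap.dist_le dist_nonneg).2 fun r ↦ ?_) this
      exact ContinuousMap.dist_apply_le_dist (f := (S Y).2) (g := c₀) ⟨s * r, hmul r⟩
    have heq : ∀ r : Icc (-1 : ℝ) 1,
        γ r = x₀ + ∫ q in (0 : ℝ)..r, f (IccExtend hle γ q) ((s : ℝ) • Y) := by
      intro r
      change (S Y).2 ⟨s * r, hmul r⟩ = _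
      rw [hS2 Y hY]
      congr 1
      have h1 := intervalIntegral.smul_integral_comp_mul_left (a := 0) (b := r)
        (fun q ↦ f (IccExtend hle (S Y).2 q) Y) (s : ℝ)
      rw [mul_zero] at h1
      change ∫ q in (0 : ℝ)..(s : ℝ) * r, _ = _
      rw [← h1, ← intervalIntegral.integral_smul]
      refine intervalIntegral.integral_congr fun q hq ↦ ?_
      have hq' : q ∈ Icc (-1 : ℝ) 1 := by
        refine (uIcc_subset_Icc (by norm_num) r.2) hq
      simp only [map_smul]
      rw [IccExtend_of_mem hle _ hq', IccExtend_of_mem hle _ (hmul ⟨q, hq'⟩)]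
      rfl
    have := huniq _ hsY γ hγ heq
    change (S ((s : ℝ) • Y)).2 one = _
    rw [this]
    change (S Y).2 ⟨s * 1, _⟩ = _
    congr 1
    exact Subtype.ext (mul_one _)
  refine ⟨ρ, hρ, g, ?_, ?_, ?_⟩
  · have h1 : ContDiffOn ℝ ∞ S (ball 0 ρ) :=
      hsymm.comp (contDiff_id.prodMk contDiff_const).contDiffOn (fun Y hY ↦ hSt Y hY)
    have h2 : ContDiffOn ℝ ∞ (fun Y ↦ (S Y).2) (ball 0 ρ) := contDiff_snd.comp_contDiffOn h1
    exact (ContDiff.comp_contDiffOn (g := ContinuousMap.evalCLM ℝ one)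
      (ContinuousLinearMap.contDiff _) h2)
  · change (S 0).2 one = x₀
    have h3 : S 0 = (0, c₀) := h0s
    rw [h3]
    rfl
  · intro Y s hs
    -- The solution for `c • Y` is taken with `c > |s|`, so that `s / c` is interior to `[-1, 1]`
    -- and a two-sided derivative is available.
    obtain ⟨c, hcs, hc⟩ : ∃ c : ℝ, |s| < c ∧ c • Y ∈ ball (0 : F) ρ := by
      have h1 : ContinuousAt (fun c : ℝ ↦ c • Y) |s| := by fun_prop
      have h2 : |s| • Y ∈ ball (0 : F) ρ := by
        rw [mem_ball_zero_iff] at hs ⊢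
        rwa [norm_smul, Real.norm_eq_abs, abs_abs, ← Real.norm_eq_abs, ← norm_smul]
      have h3 := h1.eventually (isOpen_ball.mem_nhds h2)
      have h4 : ∀ᶠ c in 𝓝[>] |s|, c • Y ∈ ball (0 : F) ρ := h3.filter_mono nhdsWithin_le_nhds
      obtain ⟨c, hc1, hc2⟩ := (h4.and self_mem_nhdsWithin).exists
      exact ⟨c, hc2, hc1⟩
    have hc0 : 0 < c := (abs_nonneg s).trans_lt hcs
    have hnear : ∀ᶠ r in 𝓝 s, |r| < c := continuous_abs.continuousAt.eventually_lt_const hcs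
    have hdiv : ∀ r : ℝ, |r| < c → r / c ∈ Icc (-1 : ℝ) 1 := fun r hr ↦ by
      rw [mem_Icc, ← abs_le, abs_div, abs_of_pos hc0]
      exact (div_le_one hc0).2 hr.le
    have hval : ∀ r : ℝ, |r| < c →
        g (r • Y) = x₀ + ∫ q in (0 : ℝ)..(r / c), f (IccExtend hle (S (c • Y)).2 q) (c • Y) := by
      intro r hr
      rw [← hS2 _ hc ⟨r / c, hdiv r hr⟩, ← hscale _ hc, smul_smul, div_mul_cancel₀ _ hc0.ne']
    have hcont : Continuous (fun q ↦ f (IccExtend hle (S (c • Y)).2 q) (c • Y)) :=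
      (hf.continuous.comp ((S (c • Y)).2.continuous.Icc_extend' (h := hle))).clm_apply
        continuous_const
    have hder := (intervalIntegral.integral_hasDerivAt_right (hcont.intervalIntegrable 0 (s / c))
      (hcont.stronglyMeasurableAtFilter _ _) hcont.continuousAt)
    have hder2 := (hder.scomp s ((hasDerivAt_id s).div_const c)).const_add x₀
    refine (hder2.congr_deriv ?_).congr_of_eventuallyEq ?_
    · rw [IccExtend_of_mem hle _ (hdiv s hcs), ← hscale _ hc, smul_smul,
        div_mul_cancel₀ _ hc0.ne', map_smul, smul_smul, one_div_mul_cancel hc0.ne', one_smul]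
    · filter_upwards [hnear] with r hr
      exact hval r hr

/-- Local version of `exists_contDiffOn_timeOne_of_contDiff`. -/
theorem exists_contDiffOn_timeOne {E : Type u} {F : Type v} [NormedAddCommGroup E]
    [NormedSpace ℝ E] [FiniteDimensional ℝ E] [NormedAddCommGroup F] [NormedSpace ℝ F]
    [CompleteSpace F] {Ω : Set E} (hΩ : IsOpen Ω) (f : E → F →L[ℝ] E) (hf : ContDiffOn ℝ ∞ f Ω)
    {x₀ : E} (hx₀ : x₀ ∈ Ω) :
    ∃ ρ > 0, ∃ g : F → E, ContDiffOn ℝ ∞ g (ball 0 ρ) ∧ g 0 = x₀ ∧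
      (∀ Y ∈ ball (0 : F) ρ, g Y ∈ Ω) ∧ ∀ (Y : F) (s : ℝ), s • Y ∈ ball (0 : F) ρ →
        HasDerivAt (fun s : ℝ ↦ g (s • Y)) (f (g (s • Y)) Y) s := by
  obtain ⟨δ, hδ, hδΩ⟩ := Metric.isOpen_iff.1 hΩ x₀ hx₀
  -- The cut-off is `1` within `δ / 3` and `0` beyond `δ / 2`, so `χ • f` is globally smooth. The
  -- parameter ball is shrunk below until the solutions remain where `χ = 1`.
  let χ : ContDiffBump x₀ := ⟨δ / 3, δ / 2, by positivity, by linarith⟩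
  have hχ : ContDiff ℝ ∞ (fun x ↦ χ x • f x) := by
    rw [contDiff_iff_contDiffAt]
    intro x
    by_cases hx : x ∈ ball x₀ δ
    · exact χ.contDiffAt.smul (hf.contDiffAt (hΩ.mem_nhds (hδΩ hx)))
    · have hx' : x ∈ (closedBall x₀ (δ / 2))ᶜ := by
        simp only [mem_compl_iff, mem_closedBall, mem_ball, not_lt, not_le] at hx ⊢
        linarith
      refine (contDiffAt_const (c := (0 : F →L[ℝ] E))).congr_of_eventuallyEq ?_
      filter_upwards [isClosed_closedBall.isOpen_compl.mem_nhds hx'] with y hy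
      rw [χ.zero_of_le_dist, zero_smul]
      exact (not_le.1 (mem_closedBall.not.1 hy)).le
  obtain ⟨ρ, hρ, g, hg, hg0, hd⟩ := exists_contDiffOn_timeOne_of_contDiff _ hχ x₀
  have hc : ContinuousAt g 0 := hg.continuousOn.continuousAt (ball_mem_nhds _ hρ)
  obtain ⟨ε, hε, hεg⟩ := Metric.eventually_nhds_iff_ball.1
    (hc.eventually (by rw [hg0]; exact ball_mem_nhds x₀ (show 0 < δ / 3 by positivity)))
  refine ⟨min ρ ε, lt_min hρ hε, g, hg.mono (ball_subset_ball (min_le_left _ _)), hg0,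
    fun Y hY ↦ hδΩ (ball_subset_ball (by linarith)
      (hεg Y (ball_subset_ball (min_le_right _ _) hY))), fun Y s hs ↦ ?_⟩
  have h1 := hd Y s (ball_subset_ball (min_le_left _ _) hs)
  rwa [χ.one_of_mem_closedBall (ball_subset_closedBall
    (hεg _ (ball_subset_ball (min_le_right _ _) hs))), one_smul] at h1

end SmoothDependence
/-! ### Derivatives of maps between manifolds, as maps between the model spaces -/

section TangentMaps

open Set

variable {E E' E'' : Type*} [NormedAddCommGroup E] [NormedSpace ℝ E]
  [NormedAddCommGroup E'] [NormedSpace ℝ E'] [NormedAddCommGroup E''] [NormedSpace ℝ E'']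
  {N N' N'' : Type*} [TopologicalSpace N] [ChartedSpace E N]
  [TopologicalSpace N'] [ChartedSpace E' N'] [TopologicalSpace N''] [ChartedSpace E'' N'']

/-- The derivative of `f` at `a` as a map between the model spaces (which are the
tangent spaces). -/
def tderiv (f : N → N') (a : N) : E →L[ℝ] E' := mfderiv 𝓘(ℝ, E) 𝓘(ℝ, E') f a

/-- `HasMFDerivAt` for a derivative given as a map between the model spaces. -/
def HasTDerivAt (f : N → N') (a : N) (L : E →L[ℝ] E') : Prop :=
  HasMFDerivAt 𝓘(ℝ, E) 𝓘(ℝ, E') f a L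

/-- The velocity of a curve. -/
def HasVelocityAt (γ : ℝ → N) (t : ℝ) (v : E) : Prop :=
  HasTDerivAt (E := ℝ) γ t ((1 : ℝ →L[ℝ] ℝ).smulRight v)

theorem HasTDerivAt.tderiv_eq {f : N → N'} {a : N} {L : E →L[ℝ] E'} (h : HasTDerivAt f a L) :
    tderiv f a = L := HasMFDerivAt.mfderiv h

theorem HasTDerivAt.comp {f : N → N'} {g : N' → N''} {a : N} {L : E →L[ℝ] E'}
    {L' : E' →L[ℝ] E''} (hg : HasTDerivAt g (f a) L') (hf : HasTDerivAt f a L) :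
    HasTDerivAt (g ∘ f) a (L'.comp L) := HasMFDerivAt.comp a hg hf

theorem HasTDerivAt.continuousAt {f : N → N'} {a : N} {L : E →L[ℝ] E'} (h : HasTDerivAt f a L) :
    ContinuousAt f a := HasMFDerivAt.continuousAt h

theorem HasTDerivAt.congr_of_eventuallyEq {f f' : N → N'} {a : N} {L : E →L[ℝ] E'}
    (h : HasTDerivAt f a L) (h' : f' =ᶠ[𝓝 a] f) : HasTDerivAt f' a L :=
  HasMFDerivAt.congr_of_eventuallyEq h h'

theorem HasTDerivAt.unique {f : N → N'} {a : N} {L L' : E →L[ℝ] E'} (h : HasTDerivAt f a L)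
    (h' : HasTDerivAt f a L') : L = L' := h.tderiv_eq.symm.trans h'.tderiv_eq

theorem hasTDerivAt_of_mdifferentiableAt {f : N → N'} {a : N}
    (h : MDifferentiableAt 𝓘(ℝ, E) 𝓘(ℝ, E') f a) : HasTDerivAt f a (tderiv f a : E →L[ℝ] E') :=
  h.hasMFDerivAt

theorem hasTDerivAt_of_contMDiffAt {f : N → N'} {a : N}
    (h : ContMDiffAt 𝓘(ℝ, E) 𝓘(ℝ, E') ∞ f a) : HasTDerivAt f a (tderiv f a : E →L[ℝ] E') :=
  hasTDerivAt_of_mdifferentiableAt (h.mdifferentiableAt (by simp))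

theorem hasTDerivAt_of_contMDiff {f : N → N'} {a : N}
    (h : ContMDiff 𝓘(ℝ, E) 𝓘(ℝ, E') ∞ f) : HasTDerivAt f a (tderiv f a : E →L[ℝ] E') :=
  hasTDerivAt_of_contMDiffAt (h a)

theorem hasTDerivAt_id (a : N) : HasTDerivAt (id : N → N) a (ContinuousLinearMap.id ℝ E) :=
  hasMFDerivAt_id a

theorem hasTDerivAt_const (a : N) (c : N') :
    HasTDerivAt (fun _ : N ↦ c) a (0 : E →L[ℝ] E') := hasMFDerivAt_const c a

theorem hasTDerivAt_iff_hasFDerivAt {f : E → E'} {a : E} {L : E →L[ℝ] E'} :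
    HasTDerivAt f a L ↔ HasFDerivAt f L a := hasMFDerivAt_iff_hasFDerivAt

theorem hasVelocityAt_iff_hasDerivAt {f : ℝ → E} {t : ℝ} {v : E} :
    HasVelocityAt f t v ↔ HasDerivAt f v t := by
  rw [hasDerivAt_iff_hasFDerivAt]
  exact hasTDerivAt_iff_hasFDerivAt

theorem HasTDerivAt.hasVelocityAt_comp {f : N → N'} {γ : ℝ → N} {t : ℝ} {v : E}
    {L : E →L[ℝ] E'} (hf : HasTDerivAt f (γ t) L) (hγ : HasVelocityAt γ t v) :
    HasVelocityAt (fun s ↦ f (γ s)) t (L v) := by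
  have h := HasTDerivAt.comp hf hγ
  have h' : L.comp ((1 : ℝ →L[ℝ] ℝ).smulRight v) = (1 : ℝ →L[ℝ] ℝ).smulRight (L v) := by
    ext
    simp
  rw [h'] at h
  exact h

theorem HasVelocityAt.unique {γ : ℝ → N} {t : ℝ} {v v' : E} (h : HasVelocityAt γ t v)
    (h' : HasVelocityAt γ t v') : v = v' := by
  have h1 := HasTDerivAt.unique (E := ℝ) h h'
  have h2 := DFunLike.congr_fun h1 (1 : ℝ)
  simpa using h2

theorem HasVelocityAt.continuousAt {γ : ℝ → N} {t : ℝ} {v : E} (h : HasVelocityAt γ t v) :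
    ContinuousAt γ t := HasTDerivAt.continuousAt (E := ℝ) h

theorem HasVelocityAt.congr_of_eventuallyEq {γ γ' : ℝ → N} {t : ℝ} {v : E}
    (h : HasVelocityAt γ t v) (h' : γ' =ᶠ[𝓝 t] γ) : HasVelocityAt γ' t v :=
  HasTDerivAt.congr_of_eventuallyEq (E := ℝ) h h'

theorem HasVelocityAt.scomp {γ : ℝ → N} {c : ℝ → ℝ} {t c' : ℝ} {v : E}
    (h : HasVelocityAt γ (c t) v) (hc : HasDerivAt c c' t) :
    HasVelocityAt (fun s ↦ γ (c s)) t (c' • v) := by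
  have h1 := HasTDerivAt.hasVelocityAt_comp (E := ℝ) h (hasVelocityAt_iff_hasDerivAt.2 hc)
  simpa using h1

theorem HasVelocityAt.hasMFDerivAt {γ : ℝ → N} {t : ℝ} {v : E} (h : HasVelocityAt γ t v) :
    HasMFDerivAt 𝓘(ℝ, ℝ) 𝓘(ℝ, E) γ t
      ((1 : ℝ →L[ℝ] ℝ).smulRight (show TangentSpace 𝓘(ℝ, E) (γ t) from v)) := h

theorem hasVelocityAt_of_contMDiffAt {γ : ℝ → N} {t : ℝ}
    (h : ContMDiffAt 𝓘(ℝ, ℝ) 𝓘(ℝ, E) ∞ γ t) : HasVelocityAt γ t (tderiv γ t (1 : ℝ) : E) := by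
  have h1 := hasTDerivAt_of_contMDiffAt h
  have h2 : (1 : ℝ →L[ℝ] ℝ).smulRight (tderiv γ t (1 : ℝ) : E) = tderiv γ t := by
    ext
    simp
  rw [HasVelocityAt, h2]
  exact h1

end TangentMaps

/-! ### Vector fields in charts -/

section Charts

open Set

variable {E : Type*} [NormedAddCommGroup E] [NormedSpace ℝ E]
  {N : Type*} [TopologicalSpace N] [ChartedSpace E N]

/-- The representative of the vector field `X` in the chart at `a`. -/
def chartField (a : N) (X : N → E) (x : E) : E :=
  tderiv (E := E) (E' := E) (extChartAt 𝓘(ℝ, E) a) ((extChartAt 𝓘(ℝ, E) a).symm x)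
    (X ((extChartAt 𝓘(ℝ, E) a).symm x))

variable [IsManifold 𝓘(ℝ, E) ∞ N]

instance isManifold_one_of_infty : IsManifold 𝓘(ℝ, E) 1 N :=
  IsManifold.of_le (m := 1) (n := ∞) (by simp)

theorem hasTDerivAt_extChartAt {a b : N} (hb : b ∈ (extChartAt 𝓘(ℝ, E) a).source) :
    HasTDerivAt (E := E) (E' := E) (extChartAt 𝓘(ℝ, E) a) b
      (tderiv (extChartAt 𝓘(ℝ, E) a) b) := by
  rw [extChartAt_source] at hb
  exact hasTDerivAt_of_mdifferentiableAt (mdifferentiableAt_extChartAt hb)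

theorem hasTDerivAt_extChartAt_symm {a : N} {x : E} (hx : x ∈ (extChartAt 𝓘(ℝ, E) a).target) :
    HasTDerivAt (E := E) (E' := E) (extChartAt 𝓘(ℝ, E) a).symm x
      (tderiv (extChartAt 𝓘(ℝ, E) a).symm x) := by
  have h := mdifferentiableWithinAt_extChartAt_symm hx
  rw [modelWithCornersSelf_coe, range_id, mdifferentiableWithinAt_univ] at h
  exact hasTDerivAt_of_mdifferentiableAt h

theorem tderiv_extChartAt_comp_symm {a : N} {x : E} (hx : x ∈ (extChartAt 𝓘(ℝ, E) a).target)
    (v : E) : tderiv (E := E) (E' := E) (extChartAt 𝓘(ℝ, E) a) ((extChartAt 𝓘(ℝ, E) a).symm x)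
      (tderiv (E := E) (E' := E) (extChartAt 𝓘(ℝ, E) a).symm x v) = v := by
  have h := (hasTDerivAt_extChartAt ((extChartAt 𝓘(ℝ, E) a).map_target hx)).comp
    (hasTDerivAt_extChartAt_symm hx)
  have h' : HasTDerivAt (E := E) (E' := E)
      ((extChartAt 𝓘(ℝ, E) a) ∘ (extChartAt 𝓘(ℝ, E) a).symm) x (ContinuousLinearMap.id ℝ E) := by
    refine (hasTDerivAt_id x).congr_of_eventuallyEq ?_
    filter_upwards [(isOpen_extChartAt_target a).mem_nhds hx] with y hy
    exact (extChartAt 𝓘(ℝ, E) a).right_inv hy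
  exact DFunLike.congr_fun (h.unique h') v

theorem tderiv_extChartAt_symm_comp {a b : N} (hb : b ∈ (extChartAt 𝓘(ℝ, E) a).source)
    (v : E) : tderiv (E := E) (E' := E) (extChartAt 𝓘(ℝ, E) a).symm (extChartAt 𝓘(ℝ, E) a b)
      (tderiv (E := E) (E' := E) (extChartAt 𝓘(ℝ, E) a) b v) = v := by
  have h := (hasTDerivAt_extChartAt_symm ((extChartAt 𝓘(ℝ, E) a).map_source hb)).comp
    (hasTDerivAt_extChartAt hb)
  have h' : HasTDerivAt (E := E) (E' := E)
      ((extChartAt 𝓘(ℝ, E) a).symm ∘ (extChartAt 𝓘(ℝ, E) a)) b (ContinuousLinearMap.id ℝ E) := by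
    refine (hasTDerivAt_id b).congr_of_eventuallyEq ?_
    filter_upwards [(isOpen_extChartAt_source a).mem_nhds hb] with y hy
    exact (extChartAt 𝓘(ℝ, E) a).left_inv hy
  exact DFunLike.congr_fun (h.unique h') v

theorem tderiv_symm_chartField {a : N} (X : N → E) {x : E}
    (hx : x ∈ (extChartAt 𝓘(ℝ, E) a).target) :
    tderiv (E := E) (E' := E) (extChartAt 𝓘(ℝ, E) a).symm x (chartField a X x)
      = X ((extChartAt 𝓘(ℝ, E) a).symm x) := by
  have h := tderiv_extChartAt_symm_comp ((extChartAt 𝓘(ℝ, E) a).map_target hx)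
    (X ((extChartAt 𝓘(ℝ, E) a).symm x))
  rwa [(extChartAt 𝓘(ℝ, E) a).right_inv hx] at h

/-- The tangent bundle trivialization at `a` is fibrewise the derivative of the chart, so the second
component of the section in the trivialization is the chart representative. -/
theorem contDiffOn_chartField (a : N) {X : N → E} (hX : IsSmoothField X) :
    ContDiffOn ℝ ∞ (chartField a X) (extChartAt 𝓘(ℝ, E) a).target := by
  have h1 : ContMDiffOn 𝓘(ℝ, E) 𝓘(ℝ, E).tangent ∞
      (fun x ↦ (⟨(extChartAt 𝓘(ℝ, E) a).symm x, X ((extChartAt 𝓘(ℝ, E) a).symm x)⟩ :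
        TangentBundle 𝓘(ℝ, E) N)) (extChartAt 𝓘(ℝ, E) a).target :=
    hX.comp_contMDiffOn (contMDiffOn_extChartAt_symm a)
  have hsrc : MapsTo (fun x ↦ (⟨(extChartAt 𝓘(ℝ, E) a).symm x,
      X ((extChartAt 𝓘(ℝ, E) a).symm x)⟩ : TangentBundle 𝓘(ℝ, E) N))
      (extChartAt 𝓘(ℝ, E) a).target (trivializationAt E (TangentSpace 𝓘(ℝ, E)) a).source := by
    intro x hx
    have := (extChartAt 𝓘(ℝ, E) a).map_target hx
    rw [extChartAt_source] at this
    rw [Bundle.Trivialization.mem_source]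
    exact this
  have h2 := ((trivializationAt E (TangentSpace 𝓘(ℝ, E)) a).contMDiffOn_iff
    (IB := 𝓘(ℝ, E)) (n := ∞) hsrc).1 h1
  rw [← contMDiffOn_iff_contDiffOn]
  refine h2.2.congr fun x hx ↦ ?_
  have hx' := (extChartAt 𝓘(ℝ, E) a).map_target hx
  rw [extChartAt_source] at hx'
  have h3 := TangentBundle.continuousLinearMapAt_trivializationAt (I := 𝓘(ℝ, E)) hx'
  have h4 := DFunLike.congr_fun h3 (X ((extChartAt 𝓘(ℝ, E) a).symm x))
  refine h4.symm.trans ?_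
  exact Bundle.Trivialization.continuousLinearMapAt_apply_of_mem (R := ℝ)
    (trivializationAt E (TangentSpace 𝓘(ℝ, E)) a) (by exact hx') _

/-- A curve in the chart which solves the differential equation of the representative of `X` is an
integral curve of `X`. -/
theorem hasVelocityAt_symm_of_hasDerivAt {a : N} {X : N → E} {c : ℝ → E} {s : ℝ}
    (hx : c s ∈ (extChartAt 𝓘(ℝ, E) a).target) (hc : HasDerivAt c (chartField a X (c s)) s) :
    HasVelocityAt (fun t ↦ (extChartAt 𝓘(ℝ, E) a).symm (c t)) s
      (X ((extChartAt 𝓘(ℝ, E) a).symm (c s))) := by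
  have h := (hasTDerivAt_extChartAt_symm hx).hasVelocityAt_comp
    (hasVelocityAt_iff_hasDerivAt.2 hc)
  rwa [tderiv_symm_chartField X hx] at h

theorem hasDerivAt_extChartAt_comp {a : N} {γ : ℝ → N} {s : ℝ} {v : E}
    (hx : γ s ∈ (extChartAt 𝓘(ℝ, E) a).source) (hγ : HasVelocityAt γ s v) :
    HasDerivAt (fun t ↦ extChartAt 𝓘(ℝ, E) a (γ t))
      (tderiv (E := E) (E' := E) (extChartAt 𝓘(ℝ, E) a) (γ s) v) s :=
  hasVelocityAt_iff_hasDerivAt.1 ((hasTDerivAt_extChartAt hx).hasVelocityAt_comp hγ)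

end Charts
/-! ### Integral curves and flows -/

section Flows

open Set Metric

universe u v

variable {E : Type*} [NormedAddCommGroup E] [NormedSpace ℝ E]
  {N : Type*} [TopologicalSpace N] [ChartedSpace E N]

theorem HasVelocityAt.isMIntegralCurveOn {X : N → E} {γ : ℝ → N} {s : Set ℝ}
    (h : ∀ t ∈ s, HasVelocityAt γ t (X (γ t))) : IsMIntegralCurveOn (I := 𝓘(ℝ, E)) γ X s :=
  fun t ht ↦ (h t ht).hasMFDerivAt.hasMFDerivWithinAt

/-- Used to prolong an integral curve beyond an endpoint at `0`: equal one-sided derivatives glue to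
a derivative. -/
theorem hasMFDerivAt_ite_le {f g : ℝ → N} {L : ℝ →L[ℝ] E}
    (hf : HasMFDerivWithinAt 𝓘(ℝ, ℝ) 𝓘(ℝ, E) f (Iic 0) 0 L)
    (hg : HasMFDerivWithinAt 𝓘(ℝ, ℝ) 𝓘(ℝ, E) g (Ici 0) 0 L) (h : f 0 = g 0) :
    HasMFDerivAt 𝓘(ℝ, ℝ) 𝓘(ℝ, E) (fun s ↦ if s ≤ 0 then f s else g s) 0 L := by
  have h1 : HasMFDerivWithinAt 𝓘(ℝ, ℝ) 𝓘(ℝ, E) (fun s ↦ if s ≤ 0 then f s else g s) (Iic 0) 0 L :=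
    HasMFDerivWithinAt.congr_mono (f₁ := fun s ↦ if s ≤ 0 then f s else g s) hf
      (fun s hs ↦ if_pos hs) (if_pos le_rfl) Subset.rfl
  have h2 : HasMFDerivWithinAt 𝓘(ℝ, ℝ) 𝓘(ℝ, E) (fun s ↦ if s ≤ 0 then f s else g s) (Ici 0) 0 L := by
    refine HasMFDerivWithinAt.congr_mono (f₁ := fun s ↦ if s ≤ 0 then f s else g s) hg
      (fun s hs ↦ ?_) ((if_pos le_rfl).trans h) Subset.rfl
    rcases eq_or_lt_of_le (mem_Ici.1 hs) with rfl | hs'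
    · exact (if_pos le_rfl).trans h
    · exact if_neg (not_le.2 hs')
  have h3 := h1.union h2
  rw [Iic_union_Ici] at h3
  exact hasMFDerivWithinAt_univ.1 h3

variable [IsManifold 𝓘(ℝ, E) ∞ N] [T2Space N]

theorem eqOn_Ioo_of_isMIntegralCurveOn {X : N → E} (hX : IsSmoothField X) {γ η : ℝ → N}
    {a b t₀ : ℝ} (ht₀ : t₀ ∈ Ioo a b) (hγ : IsMIntegralCurveOn (I := 𝓘(ℝ, E)) γ X (Ioo a b))
    (hη : IsMIntegralCurveOn (I := 𝓘(ℝ, E)) η X (Ioo a b)) (h : γ t₀ = η t₀) : EqOn γ η (Ioo a b) :=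
  isMIntegralCurveOn_Ioo_eqOn_of_contMDiff_boundaryless ht₀
    (hX.of_le (by exact_mod_cast le_top)) hγ hη h

theorem eq_of_hasVelocityAt {X : N → E} (hX : IsSmoothField X) {γ η : ℝ → N}
    (hγ : ∀ t, HasVelocityAt γ t (X (γ t))) (hη : ∀ t, HasVelocityAt η t (X (η t)))
    {t₀ : ℝ} (h : γ t₀ = η t₀) : γ = η := by
  funext t
  have h1 : t₀ ∈ Ioo (min t t₀ - 1) (max t t₀ + 1) :=
    ⟨by linarith [min_le_right t t₀], by linarith [le_max_right t t₀]⟩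
  have h2 : t ∈ Ioo (min t t₀ - 1) (max t t₀ + 1) :=
    ⟨by linarith [min_le_left t t₀], by linarith [le_max_left t t₀]⟩
  exact eqOn_Ioo_of_isMIntegralCurveOn hX h1 (HasVelocityAt.isMIntegralCurveOn fun t _ ↦ hγ t)
    (HasVelocityAt.isMIntegralCurveOn fun t _ ↦ hη t) h h2

/-- An integral curve on a closed interval agrees with an integral curve on a larger open
interval. -/
theorem eq_of_isMIntegralCurveOn_uIcc {X : N → E} (hX : IsSmoothField X) {γ η : ℝ → N}
    {a b t : ℝ} (h0 : (0 : ℝ) ∈ Ioo a b) (ht : t ∈ Ioo a b)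
    (hη : ∀ s ∈ Ioo a b, HasVelocityAt η s (X (η s)))
    (hγ : IsMIntegralCurveOn (I := 𝓘(ℝ, E)) γ X (uIcc 0 t)) (h : γ 0 = η 0) : γ t = η t := by
  have hη0 : HasMFDerivAt 𝓘(ℝ, ℝ) 𝓘(ℝ, E) η 0
      ((1 : ℝ →L[ℝ] ℝ).smulRight (X (η 0)) : ℝ →L[ℝ] E) := hη 0 h0
  rcases lt_trichotomy t 0 with hneg | rfl | hpos
  · have huIcc : uIcc 0 t = Icc t 0 := uIcc_of_ge hneg.le
    rw [huIcc] at hγ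
    have hγ0 : HasMFDerivWithinAt 𝓘(ℝ, ℝ) 𝓘(ℝ, E) γ (Icc t 0) 0
        ((1 : ℝ →L[ℝ] ℝ).smulRight (X (η 0)) : ℝ →L[ℝ] E) := by
      rw [← h]
      exact hγ 0 (right_mem_Icc.2 hneg.le)
    -- Uniqueness of integral curves requires an open interval around the base time. So `γ` is
    -- continued by `η` across `0`; the other endpoint `t` is reached at the end by continuity.
    have hglue := hasMFDerivAt_ite_le (hγ0.mono_of_mem_nhdsWithin (Icc_mem_nhdsLE hneg))
      hη0.hasMFDerivWithinAt h
    have hcurve : IsMIntegralCurveOn (I := 𝓘(ℝ, E)) (fun s ↦ if s ≤ 0 then γ s else η s) X (Ioo t b) := by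
      intro s hs
      refine HasMFDerivAt.hasMFDerivWithinAt ?_
      rcases lt_trichotomy s 0 with h1 | rfl | h1
      · simp only [if_pos h1.le]
        refine ((hγ s ⟨hs.1.le, h1.le⟩).hasMFDerivAt (Icc_mem_nhds hs.1 h1)).congr_of_eventuallyEq ?_
        filter_upwards [Iio_mem_nhds h1] with r hr
        exact if_pos (le_of_lt hr)
      · simp only [le_refl, if_true, h]
        exact hglue
      · simp only [if_neg (not_le.2 h1)]
        refine (hη s ⟨h0.1.trans h1, hs.2⟩).hasMFDerivAt.congr_of_eventuallyEq ?_
        filter_upwards [Ioi_mem_nhds h1] with r hr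
        exact if_neg (not_le.2 hr)
    have heq := eqOn_Ioo_of_isMIntegralCurveOn hX (t₀ := 0) ⟨hneg, h0.2⟩ hcurve
      (HasVelocityAt.isMIntegralCurveOn fun s hs ↦ hη s ⟨ht.1.trans hs.1, hs.2⟩)
      ((if_pos le_rfl).trans h)
    have hlim1 : Filter.Tendsto γ (𝓝[Ioo t 0] t) (𝓝 (γ t)) :=
      (hγ.continuousOn t (left_mem_Icc.2 hneg.le)).mono Ioo_subset_Icc_self
    have hlim2 : Filter.Tendsto η (𝓝[Ioo t 0] t) (𝓝 (η t)) :=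
      (hη t ht).continuousAt.continuousWithinAt
    have : (𝓝[Ioo t 0] t).NeBot := left_nhdsWithin_Ioo_neBot hneg
    refine tendsto_nhds_unique hlim1 (hlim2.congr' ?_)
    filter_upwards [self_mem_nhdsWithin] with s hs
    have h2 := heq ⟨hs.1, hs.2.trans h0.2⟩
    simp only [if_pos hs.2.le] at h2
    exact h2.symm
  · exact h
  · have huIcc : uIcc 0 t = Icc 0 t := uIcc_of_le hpos.le
    rw [huIcc] at hγ
    have hγ0 : HasMFDerivWithinAt 𝓘(ℝ, ℝ) 𝓘(ℝ, E) γ (Icc 0 t) 0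
        ((1 : ℝ →L[ℝ] ℝ).smulRight (X (η 0)) : ℝ →L[ℝ] E) := by
      rw [← h]
      exact hγ 0 (left_mem_Icc.2 hpos.le)
    have hglue := hasMFDerivAt_ite_le hη0.hasMFDerivWithinAt
      (hγ0.mono_of_mem_nhdsWithin (Icc_mem_nhdsGE hpos)) h.symm
    have hcurve : IsMIntegralCurveOn (I := 𝓘(ℝ, E)) (fun s ↦ if s ≤ 0 then η s else γ s) X (Ioo a t) := by
      intro s hs
      refine HasMFDerivAt.hasMFDerivWithinAt ?_
      rcases lt_trichotomy s 0 with h1 | rfl | h1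
      · simp only [if_pos h1.le]
        refine (hη s ⟨hs.1, h1.trans h0.2⟩).hasMFDerivAt.congr_of_eventuallyEq ?_
        filter_upwards [Iio_mem_nhds h1] with r hr
        exact if_pos (le_of_lt hr)
      · simp only [le_refl, if_true]
        exact hglue
      · simp only [if_neg (not_le.2 h1)]
        refine ((hγ s ⟨h1.le, hs.2.le⟩).hasMFDerivAt (Icc_mem_nhds h1 hs.2)).congr_of_eventuallyEq ?_
        filter_upwards [Ioi_mem_nhds h1] with r hr
        exact if_neg (not_le.2 hr)
    have heq := eqOn_Ioo_of_isMIntegralCurveOn hX (t₀ := 0) ⟨h0.1, hpos⟩ hcurve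
      (HasVelocityAt.isMIntegralCurveOn fun s hs ↦ hη s ⟨hs.1, hs.2.trans ht.2⟩)
      (if_pos le_rfl)
    have hlim1 : Filter.Tendsto γ (𝓝[Ioo 0 t] t) (𝓝 (γ t)) :=
      (hγ.continuousOn t (right_mem_Icc.2 hpos.le)).mono Ioo_subset_Icc_self
    have hlim2 : Filter.Tendsto η (𝓝[Ioo 0 t] t) (𝓝 (η t)) :=
      (hη t ht).continuousAt.continuousWithinAt
    have : (𝓝[Ioo 0 t] t).NeBot := right_nhdsWithin_Ioo_neBot hpos
    refine tendsto_nhds_unique hlim1 (hlim2.congr' ?_)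
    filter_upwards [self_mem_nhdsWithin] with s hs
    have h2 := heq ⟨h0.1.trans hs.1, hs.2⟩
    simp only [if_neg (not_le.2 hs.1)] at h2
    exact h2.symm

/-- The flow is given by any integral curve. -/
theorem flow_eq_of_hasVelocityAt {X : N → E} (hX : IsSmoothField X) {η : ℝ → N}
    {a b t : ℝ} (h0 : (0 : ℝ) ∈ Ioo a b) (ht : t ∈ Ioo a b)
    (hη : ∀ s ∈ Ioo a b, HasVelocityAt η s (X (η s))) :
    FlowDefined (E := E) X t (η 0) ∧ flow (E := E) X t (η 0) = η t := by
  have hd : FlowDefined (E := E) X t (η 0) :=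
    ⟨η, rfl, HasVelocityAt.isMIntegralCurveOn fun s hs ↦
      hη s (ordConnected_Ioo.uIcc_subset h0 ht hs)⟩
  refine ⟨hd, ?_⟩
  have hflow : flow (E := E) X t (η 0) = hd.choose t := dif_pos hd
  rw [hflow]
  exact eq_of_isMIntegralCurveOn_uIcc hX h0 ht hη hd.choose_spec.2 hd.choose_spec.1

theorem flow_eq_of_forall_hasVelocityAt {X : N → E} (hX : IsSmoothField X) {η : ℝ → N}
    (hη : ∀ s, HasVelocityAt η s (X (η s))) (t : ℝ) :
    FlowDefined (E := E) X t (η 0) ∧ flow (E := E) X t (η 0) = η t :=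
  flow_eq_of_hasVelocityAt hX (a := -|t| - 1) (b := |t| + 1)
    ⟨by linarith [abs_nonneg t], by linarith [abs_nonneg t]⟩
    ⟨by linarith [neg_abs_le t], by linarith [le_abs_self t]⟩ fun s _ ↦ hη s

open Metric in
theorem flow_one_eq_of_hasVelocityAt {F : Type*} [NormedAddCommGroup F] [NormedSpace ℝ F]
    {X : N → E} (hX : IsSmoothField X) {g : F → N} {Y : F} {ρ : ℝ} (hY : Y ∈ ball (0 : F) ρ)
    (hg : ∀ s : ℝ, s • Y ∈ ball (0 : F) ρ →
      HasVelocityAt (fun s : ℝ ↦ g (s • Y)) s (X (g (s • Y)))) :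
    FlowDefined (E := E) X 1 (g 0) ∧ flow (E := E) X 1 (g 0) = g Y := by
  rw [mem_ball_zero_iff] at hY
  -- The curve must solve the equation on an open interval that contains both `0` and `1`.
  obtain ⟨r, hr1, hr⟩ : ∃ r : ℝ, 1 < r ∧ r * ‖Y‖ < ρ := by
    have hc : ContinuousAt (fun r : ℝ ↦ r * ‖Y‖) 1 := by fun_prop
    have h1 := hc.eventually (isOpen_Iio.mem_nhds (show 1 * ‖Y‖ < ρ by rwa [one_mul]))
    obtain ⟨δ, hδ, h2⟩ := Metric.eventually_nhds_iff.1 h1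
    refine ⟨1 + δ / 2, by linarith, h2 ?_⟩
    rw [Real.dist_eq, add_sub_cancel_left, abs_of_pos (by linarith)]
    linarith
  have h3 := flow_eq_of_hasVelocityAt hX (η := fun s ↦ g (s • Y))
    (a := -r) (b := r) (t := 1) ⟨by linarith, by linarith⟩ ⟨by linarith, hr1⟩ (fun s hs ↦ by
      refine hg s ?_
      rw [mem_ball_zero_iff, norm_smul, Real.norm_eq_abs]
      exact (mul_le_mul_of_nonneg_right (abs_lt.2 hs).le (norm_nonneg _)).trans_lt hr)
  simpa only [zero_smul, one_smul] using h3

end Flows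

/-! ### Time-one maps of linear families of vector fields -/

section TimeOne

open Set Metric

universe u v

variable {E : Type u} [NormedAddCommGroup E] [NormedSpace ℝ E] [FiniteDimensional ℝ E]
  {F : Type v} [NormedAddCommGroup F] [NormedSpace ℝ F] [FiniteDimensional ℝ F]
  {N : Type*} [TopologicalSpace N] [ChartedSpace E N] [IsManifold 𝓘(ℝ, E) ∞ N]

/-- For a linear family `X` of smooth vector fields, the flow of `X Y` up to time one starting
at `a` depends smoothly on `Y` near `0`. -/
theorem exists_contMDiffOn_timeOne (X : N → F →ₗ[ℝ] E) (hX : ∀ Y, IsSmoothField (fun b ↦ X b Y))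
    (a : N) :
    ∃ ρ > 0, ∃ g : F → N, ContMDiffOn 𝓘(ℝ, F) 𝓘(ℝ, E) ∞ g (ball 0 ρ) ∧ g 0 = a ∧
      (∀ Y ∈ ball (0 : F) ρ, g Y ∈ (extChartAt 𝓘(ℝ, E) a).source) ∧
      ∀ (Y : F) (s : ℝ), s • Y ∈ ball (0 : F) ρ →
        HasVelocityAt (fun s : ℝ ↦ g (s • Y)) s (X (g (s • Y)) Y) := by
  let f : E → F →L[ℝ] E := fun x ↦ LinearMap.toContinuousLinearMap
    ((tderiv (E := E) (E' := E) (extChartAt 𝓘(ℝ, E) a)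
      ((extChartAt 𝓘(ℝ, E) a).symm x)).toLinearMap ∘ₗ X ((extChartAt 𝓘(ℝ, E) a).symm x))
  have hf : ContDiffOn ℝ ∞ f (extChartAt 𝓘(ℝ, E) a).target :=
    contDiffOn_clm_apply.2 fun Y ↦ contDiffOn_chartField a (hX Y)
  obtain ⟨ρ, hρ, g, hg, hg0, hgt, hd⟩ := exists_contDiffOn_timeOne (isOpen_extChartAt_target a) f hf
    (mem_extChartAt_target a)
  refine ⟨ρ, hρ, fun Y ↦ (extChartAt 𝓘(ℝ, E) a).symm (g Y), ?_, ?_,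
    fun Y hY ↦ (extChartAt 𝓘(ℝ, E) a).map_target (hgt Y hY), fun Y s hs ↦ ?_⟩
  · exact (contMDiffOn_extChartAt_symm a).comp (contMDiffOn_iff_contDiffOn.2 hg) hgt
  · simp only [hg0]
    exact extChartAt_to_inv a
  · exact hasVelocityAt_symm_of_hasDerivAt (X := fun b ↦ X b Y) (c := fun s ↦ g (s • Y))
      (hgt _ hs) (hd Y s hs)

end TimeOne
/-! ### Lie brackets in charts and commuting vector fields -/

section Bracket

open Set

variable {E : Type*} [NormedAddCommGroup E] [NormedSpace ℝ E]
  {N : Type*} [TopologicalSpace N] [ChartedSpace E N] [IsManifold 𝓘(ℝ, E) ∞ N]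

theorem IsSmoothField.mdifferentiableAt {X : N → E} (hX : IsSmoothField X) (b : N) :
    MDifferentiableAt 𝓘(ℝ, E) 𝓘(ℝ, E).tangent
      (fun u : N ↦ (⟨u, X u⟩ : TangentBundle 𝓘(ℝ, E) N)) b :=
  (hX b).mdifferentiableAt (by simp)

/-- The Lie bracket of two vector fields on a manifold. -/
def bracketField (X Y : N → E) : N → E := VectorField.mlieBracket 𝓘(ℝ, E) X Y

/-- The pullback is formed with the inverse of the derivative of the inverse chart, which is the
derivative of the chart. This makes the naturality of the Lie bracket under pullback applicable. -/
theorem chartField_eq_mpullback (a : N) (X : N → E) {x : E}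
    (hx : x ∈ (extChartAt 𝓘(ℝ, E) a).target) :
    VectorField.mpullback 𝓘(ℝ, E) 𝓘(ℝ, E) (extChartAt 𝓘(ℝ, E) a).symm X x = chartField a X x := by
  have h : (tderiv (E := E) (E' := E) (extChartAt 𝓘(ℝ, E) a).symm x : E →L[ℝ] E).inverse
      = tderiv (E := E) (E' := E) (extChartAt 𝓘(ℝ, E) a) ((extChartAt 𝓘(ℝ, E) a).symm x) := by
    apply ContinuousLinearMap.inverse_eq
    · ext v
      have := tderiv_extChartAt_symm_comp ((extChartAt 𝓘(ℝ, E) a).map_target hx) v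
      rwa [(extChartAt 𝓘(ℝ, E) a).right_inv hx] at this
    · ext v
      exact tderiv_extChartAt_comp_symm hx v
  exact DFunLike.congr_fun h (X ((extChartAt 𝓘(ℝ, E) a).symm x))

theorem chartField_bracketField [FiniteDimensional ℝ E] {X Y : N → E} (hX : IsSmoothField X) (hY : IsSmoothField Y)
    (a : N) {x : E} (hx : x ∈ (extChartAt 𝓘(ℝ, E) a).target) :
    chartField a (bracketField X Y) x
      = fderiv ℝ (chartField a Y) x (chartField a X x)
        - fderiv ℝ (chartField a X) x (chartField a Y x) := by
  have : IsManifold 𝓘(ℝ, E) (minSmoothness ℝ 3) N :=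
    IsManifold.of_le (m := minSmoothness ℝ 3) (n := ∞)
      (by rw [minSmoothness_of_isRCLikeNormedField]; exact ENat.LEInfty.out)
  have h := VectorField.mpullback_mlieBracket (I := 𝓘(ℝ, E)) (I' := 𝓘(ℝ, E)) (n := ∞)
    (f := (extChartAt 𝓘(ℝ, E) a).symm) (V := X) (W := Y) (x₀ := x)
    (hX.mdifferentiableAt _) (hY.mdifferentiableAt _)
    ((contMDiffOn_extChartAt_symm a).contMDiffAt ((isOpen_extChartAt_target a).mem_nhds hx))
    (by rw [minSmoothness_of_isRCLikeNormedField]; exact ENat.LEInfty.out)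
  have h1 := chartField_eq_mpullback a (bracketField X Y) hx
  refine h1.symm.trans (h.trans ?_)
  have hev : ∀ Z : N → E, VectorField.mpullback 𝓘(ℝ, E) 𝓘(ℝ, E) (extChartAt 𝓘(ℝ, E) a).symm Z
      =ᶠ[𝓝 x] chartField a Z := by
    intro Z
    filter_upwards [(isOpen_extChartAt_target a).mem_nhds hx] with y hy
    exact chartField_eq_mpullback a Z hy
  rw [← VectorField.mlieBracketWithin_univ, VectorField.mlieBracketWithin_eq_lieBracketWithin]
  refine (congr_fun VectorField.lieBracketWithin_univ x).trans ?_
  exact (hev X).lieBracket_vectorField_eq (hev Y)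

theorem differentiableAt_chartField {X : N → E} (hX : IsSmoothField X) {a : N} {x : E}
    (hx : x ∈ (extChartAt 𝓘(ℝ, E) a).target) : DifferentiableAt ℝ (chartField a X) x :=
  ((contDiffOn_chartField a hX).contDiffAt ((isOpen_extChartAt_target a).mem_nhds hx)).differentiableAt
    (by simp)

variable [FiniteDimensional ℝ E]

/-- If `X` and `Y` commute and `s ↦ K (t, s)` is an integral curve of `Y` for all `t` near `0`, then
`∂_t K (0, s) = X (K (0, s))` for all `s` as soon as this holds for `s = 0`. -/
theorem hasVelocityAt_of_bracketField_eq_zero {X Y : N → E} (hX : IsSmoothField X)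
    (hY : IsSmoothField Y) (hXY : bracketField X Y = 0) (a : N) {K : ℝ × ℝ → N}
    (hK : ∀ s ∈ Icc (0 : ℝ) 1, ContMDiffAt 𝓘(ℝ, ℝ × ℝ) 𝓘(ℝ, E) ∞ K (0, s))
    (hsrc : ∀ s ∈ Icc (0 : ℝ) 1, K (0, s) ∈ (extChartAt 𝓘(ℝ, E) a).source)
    (hint : ∀ s ∈ Icc (0 : ℝ) 1, ∀ᶠ z : ℝ × ℝ in 𝓝 (0, s),
      HasVelocityAt (fun s' ↦ K (z.1, s')) z.2 (Y (K z)))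
    (h0 : HasVelocityAt (fun t ↦ K (t, 0)) 0 (X (K (0, 0)))) :
    ∀ s ∈ Icc (0 : ℝ) 1, HasVelocityAt (fun t ↦ K (t, s)) 0 (X (K (0, s))) := by
  set φ := extChartAt 𝓘(ℝ, E) a
  let k : ℝ × ℝ → E := fun z ↦ φ (K z)
  have hk : ∀ s ∈ Icc (0 : ℝ) 1, ContDiffAt ℝ ∞ k (0, s) := by
    intro s hs
    have h1 := contMDiffAt_extChartAt' (I := 𝓘(ℝ, E)) (n := ∞) (x := a) (x' := K (0, s))
      (by have := hsrc s hs; rwa [extChartAt_source] at this)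
    exact contMDiffAt_iff_contDiffAt.1 (h1.comp (0, s) (hK s hs))
  have htar : ∀ s ∈ Icc (0 : ℝ) 1, k (0, s) ∈ φ.target := fun s hs ↦ φ.map_source (hsrc s hs)
  have hksymm : ∀ s ∈ Icc (0 : ℝ) 1, φ.symm (k (0, s)) = K (0, s) :=
    fun s hs ↦ φ.left_inv (hsrc s hs)
  -- the derivative in the second variable
  have hds : ∀ s ∈ Icc (0 : ℝ) 1, ∀ᶠ z : ℝ × ℝ in 𝓝 (0, s),
      fderiv ℝ k z (0, 1) = chartField a Y (k z) := by
    intro s hs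
    have hopen : ∀ᶠ z : ℝ × ℝ in 𝓝 (0, s), K z ∈ φ.source :=
      (hK s hs).continuousAt.preimage_mem_nhds ((isOpen_extChartAt_source a).mem_nhds (hsrc s hs))
    have hdiff : ∀ᶠ z : ℝ × ℝ in 𝓝 (0, s), DifferentiableAt ℝ k z := by
      filter_upwards [((hk s hs).of_le (m := 1) (by simp)).eventually (by simp)] with z hz
      exact hz.differentiableAt (by simp)
    filter_upwards [hopen, hdiff, hint s hs] with z hz1 hz2 hz3
    have h1 : HasDerivAt (fun s' ↦ k (z.1, s')) (chartField a Y (k z)) z.2 := by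
      have := hasDerivAt_extChartAt_comp (a := a) hz1 hz3
      have he : φ.symm (k z) = K z := φ.left_inv hz1
      rw [chartField, he]
      exact this
    have h2 : HasDerivAt (fun s' : ℝ ↦ k (z.1, s')) (fderiv ℝ k z (0, 1)) z.2 :=
      HasFDerivAt.comp_hasDerivAt z.2 (f := fun s' : ℝ ↦ (z.1, s')) hz2.hasFDerivAt
        ((hasDerivAt_const _ _).prodMk (hasDerivAt_id _))
    exact h2.unique h1
  -- `J` is the variation field along `s ↦ K (0, s)` and `Z` is `X` along the same curve. Both solve
  -- the linear equation `w' = A w`, where `A` is the derivative of `Y` in the chart.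
  let J : ℝ → E := fun s ↦ fderiv ℝ k (0, s) (1, 0)
  let Z : ℝ → E := fun s ↦ chartField a X (k (0, s))
  let A : ℝ → E →L[ℝ] E := fun s ↦ fderiv ℝ (chartField a Y) (k (0, s))
  have hkd : ∀ s ∈ Icc (0 : ℝ) 1, HasDerivAt (fun s' : ℝ ↦ k (0, s')) (chartField a Y (k (0, s))) s := by
    intro s hs
    rw [← (hds s hs).self_of_nhds]
    exact HasFDerivAt.comp_hasDerivAt s (f := fun s' : ℝ ↦ ((0 : ℝ), s'))
      ((hk s hs).differentiableAt (by simp)).hasFDerivAt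
      ((hasDerivAt_const _ _).prodMk (hasDerivAt_id _))
  have hJ : ∀ s ∈ Icc (0 : ℝ) 1, HasDerivAt J (A s (J s)) s := by
    intro s hs
    have hd1 : DifferentiableAt ℝ (fderiv ℝ k) (0, s) :=
      ((hk s hs).fderiv_right (m := ∞) (by simp)).differentiableAt (by simp)
    have h1 : HasDerivAt (fun s' : ℝ ↦ fderiv ℝ k (0, s')) (fderiv ℝ (fderiv ℝ k) (0, s) (0, 1)) s :=
      HasFDerivAt.comp_hasDerivAt s (f := fun s' : ℝ ↦ ((0 : ℝ), s')) hd1.hasFDerivAt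
        ((hasDerivAt_const _ _).prodMk (hasDerivAt_id _))
    have h2 : HasDerivAt J (fderiv ℝ (fderiv ℝ k) (0, s) (0, 1) (1, 0)) s := by
      have := h1.clm_apply (hasDerivAt_const s ((1 : ℝ), (0 : ℝ)))
      simpa using this
    have hsymm : IsSymmSndFDerivAt ℝ k (0, s) :=
      (hk s hs).isSymmSndFDerivAt
        (by rw [minSmoothness_of_isRCLikeNormedField]; exact ENat.LEInfty.out)
    -- The mixed partial derivatives are exchanged: `∂_s ∂_t k = ∂_t ∂_s k`, and `∂_s k` is `Y`
    -- along `k`, so its derivative in `t` is `A J`.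
    rw [hsymm.eq] at h2
    have h3 : HasFDerivAt (fun z ↦ fderiv ℝ k z (0, 1))
        ((fderiv ℝ (fderiv ℝ k) (0, s)).flip (0, 1)) (0, s) := by
      have := hd1.hasFDerivAt.clm_apply (hasFDerivAt_const ((0 : ℝ), (1 : ℝ)) ((0 : ℝ), s))
      simpa using this
    have h4 : HasFDerivAt (fun z ↦ chartField a Y (k z)) ((A s).comp (fderiv ℝ k (0, s))) (0, s) :=
      (differentiableAt_chartField hY (htar s hs)).hasFDerivAt.comp _
        ((hk s hs).differentiableAt (by simp)).hasFDerivAt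
    have h5 := h3.unique (h4.congr_of_eventuallyEq (hds s hs))
    have h6 := DFunLike.congr_fun h5 ((1 : ℝ), (0 : ℝ))
    have h7 : fderiv ℝ (fderiv ℝ k) (0, s) (1, 0) (0, 1) = A s (J s) := h6
    rwa [h7] at h2
  have hZ : ∀ s ∈ Icc (0 : ℝ) 1, HasDerivAt Z (A s (Z s)) s := by
    intro s hs
    have h1 : HasDerivAt Z (fderiv ℝ (chartField a X) (k (0, s)) (chartField a Y (k (0, s)))) s :=
      HasFDerivAt.comp_hasDerivAt (f := fun s' : ℝ ↦ k (0, s')) s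
        (differentiableAt_chartField hX (htar s hs)).hasFDerivAt
        (hkd s hs)
    have h2 := chartField_bracketField hX hY a (htar s hs)
    have h3 : chartField a (bracketField X Y) (k (0, s)) = 0 := by
      rw [hXY, chartField]
      exact map_zero _
    rw [h3] at h2
    -- In the chart, vanishing of the bracket says that the derivative of `X` along `Y` equals the
    -- derivative of `Y` along `X`.
    rw [← sub_eq_zero.1 h2.symm] at h1
    exact h1
  have hA : ContinuousOn A (Icc 0 1) := by
    intro s hs
    have h1 : ContinuousAt (fderiv ℝ (chartField a Y)) (k (0, s)) :=
      (((contDiffOn_chartField a hY).contDiffAt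
        ((isOpen_extChartAt_target a).mem_nhds (htar s hs))).fderiv_right (m := ∞)
          (by simp)).continuousAt
    exact (h1.comp (f := fun s' : ℝ ↦ k (0, s')) (hkd s hs).continuousAt).continuousWithinAt
  obtain ⟨C, hC⟩ := isCompact_Icc.exists_bound_of_continuousOn hA
  have hJ0 : J 0 = Z 0 := by
    have h00 : (0 : ℝ) ∈ Icc (0 : ℝ) 1 := by simp
    have h1 : HasDerivAt (fun t : ℝ ↦ k (t, 0)) (J 0) 0 :=
      HasFDerivAt.comp_hasDerivAt 0 (f := fun t : ℝ ↦ (t, (0 : ℝ)))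
        ((hk 0 h00).differentiableAt (by simp)).hasFDerivAt
        ((hasDerivAt_id _).prodMk (hasDerivAt_const _ _))
    have h2 : HasDerivAt (fun t : ℝ ↦ k (t, 0)) (Z 0) 0 := by
      have h3 := hasDerivAt_extChartAt_comp (a := a) (hsrc 0 h00) h0
      have h4 : Z 0 = tderiv (E := E) (E' := E) φ (K (0, 0)) (X (K (0, 0))) := by
        have h5 := hksymm 0 h00
        change tderiv (E := E) (E' := E) φ (φ.symm (k (0, 0))) (X (φ.symm (k (0, 0)))) = _
        rw [h5]
      rw [h4]
      exact h3
    exact h1.unique h2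
  -- Grönwall: the difference vanishes at `s = 0`, and its derivative is bounded by a constant
  -- multiple of it.
  have hJZ : ∀ s ∈ Icc (0 : ℝ) 1, J s - Z s = 0 := by
    refine eq_zero_of_abs_deriv_le_mul_abs_self_of_eq_zero_right (f := fun s ↦ J s - Z s)
      (f' := fun s ↦ A s (J s) - A s (Z s)) (K := C) ?_ ?_ (by simp [hJ0]) ?_
    · intro s hs
      exact ((hJ s hs).sub (hZ s hs)).continuousAt.continuousWithinAt
    · intro s hs
      exact ((hJ s (Ico_subset_Icc_self hs)).sub (hZ s (Ico_subset_Icc_self hs))).hasDerivWithinAt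
    · intro s hs
      rw [← map_sub]
      exact (A s).le_of_opNorm_le (hC s (Ico_subset_Icc_self hs)) _
  intro s hs
  have h1 : HasDerivAt (fun t : ℝ ↦ k (t, s)) (chartField a X (k (0, s))) 0 := by
    have hJs : J s = chartField a X (k (0, s)) := sub_eq_zero.1 (hJZ s hs)
    rw [← hJs]
    exact HasFDerivAt.comp_hasDerivAt 0 (f := fun t : ℝ ↦ (t, s))
      ((hk s hs).differentiableAt (by simp)).hasFDerivAt
      ((hasDerivAt_id _).prodMk (hasDerivAt_const _ _))
  have h2 := hasVelocityAt_symm_of_hasDerivAt (a := a) (X := X) (c := fun t ↦ k (t, s))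
    (htar s hs) h1
  change HasVelocityAt _ 0 (X (φ.symm (k (0, s)))) at h2
  rw [hksymm s hs] at h2
  refine h2.congr_of_eventuallyEq ?_
  have hcont : ContinuousAt (fun t : ℝ ↦ K (t, s)) 0 :=
    ContinuousAt.comp (f := fun t : ℝ ↦ (t, s)) (hK s hs).continuousAt (by fun_prop)
  filter_upwards [hcont.preimage_mem_nhds ((isOpen_extChartAt_source a).mem_nhds (hsrc s hs))]
    with t ht
  exact (φ.left_inv ht).symm

end Bracket
/-! ### Graded Lie algebras -/

namespace Grading

variable {𝔤 : Type*} [LieRing 𝔤] [LieAlgebra ℝ 𝔤] (gr : Grading 𝔤)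

/-- The projection to the component of degree `i`. -/
def proj (i : ℤ) : 𝔤 →ₗ[ℝ] 𝔤 :=
  (gr.comp i).subtype ∘ₗ DirectSum.component ℝ ℤ (fun i ↦ gr.comp i) i ∘ₗ
    (LinearEquiv.ofBijective (DirectSum.coeLinearMap gr.comp)
      (show Function.Bijective _ from gr.isInternal)).symm.toLinearMap

theorem proj_mem (i : ℤ) (x : 𝔤) : gr.proj i x ∈ gr.comp i := Subtype.mem _

theorem proj_of_mem_ite {i j : ℤ} {x : 𝔤} (hx : x ∈ gr.comp j) :
    gr.proj i x = if i = j then x else 0 := by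
  have h : (LinearEquiv.ofBijective (DirectSum.coeLinearMap gr.comp)
      (show Function.Bijective _ from gr.isInternal)).symm x
      = DirectSum.lof ℝ ℤ (fun i ↦ gr.comp i) j ⟨x, hx⟩ := by
    rw [LinearEquiv.symm_apply_eq, LinearEquiv.ofBijective_apply, DirectSum.coeLinearMap_lof]
  simp only [proj, LinearMap.comp_apply, LinearEquiv.coe_coe, h]
  split_ifs with hij
  · subst hij
    simp [DirectSum.component.lof_self]
  · rw [DirectSum.component.of, dif_neg (Ne.symm hij), map_zero]

theorem proj_of_mem {i : ℤ} {x : 𝔤} (hx : x ∈ gr.comp i) : gr.proj i x = x := by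
  simp [gr.proj_of_mem_ite hx]

theorem proj_of_mem_ne {i j : ℤ} {x : 𝔤} (hx : x ∈ gr.comp j) (hij : i ≠ j) :
    gr.proj i x = 0 := by
  simp [gr.proj_of_mem_ite hx, hij]

theorem proj_eq_zero_of_depth_lt {i : ℤ} (hi : (gr.depth : ℤ) < |i|) (x : 𝔤) : gr.proj i x = 0 := by
  have := gr.proj_mem i x
  rw [gr.comp_eq_bot i hi] at this
  simpa using this

/-- The degrees which occur. -/
def degrees : Finset ℤ := Finset.Icc (-(gr.depth : ℤ)) gr.depth

theorem proj_eq_zero_of_notMem {i : ℤ} (hi : i ∉ gr.degrees) (x : 𝔤) : gr.proj i x = 0 := by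
  refine gr.proj_eq_zero_of_depth_lt ?_ x
  by_contra! h
  exact hi (Finset.mem_Icc.2 (abs_le.1 h))

@[elab_as_elim]
theorem induction_comp {p : 𝔤 → Prop} (x : 𝔤) (hc : ∀ i, ∀ y ∈ gr.comp i, p y)
    (ha : ∀ y z, p y → p z → p (y + z)) : p x := by
  have hx : x ∈ ⨆ i, gr.comp i := by
    rw [gr.isInternal.submodule_iSup_eq_top]
    trivial
  exact Submodule.iSup_induction gr.comp (motive := p) hx hc (hc 0 0 (zero_mem _)) ha

theorem sum_proj (x : 𝔤) : ∑ i ∈ gr.degrees, gr.proj i x = x := by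
  refine gr.induction_comp x (fun i y hy ↦ ?_) fun y z hy hz ↦ ?_
  · simp_rw [gr.proj_of_mem_ite hy, eq_comm (b := i)]
    rw [Finset.sum_ite_eq]
    split_ifs with hi
    · rfl
    · have := gr.proj_eq_zero_of_notMem hi y
      rw [gr.proj_of_mem hy] at this
      exact this.symm
  · simp_rw [map_add, Finset.sum_add_distrib, hy, hz]

theorem ext_proj {x y : 𝔤} (h : ∀ i, gr.proj i x = gr.proj i y) : x = y := by
  rw [← gr.sum_proj x, ← gr.sum_proj y]
  exact Finset.sum_congr rfl fun i _ ↦ h i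

theorem mem_comp_iff {i : ℤ} {x : 𝔤} : x ∈ gr.comp i ↔ ∀ j, j ≠ i → gr.proj j x = 0 := by
  refine ⟨fun hx j hj ↦ gr.proj_of_mem_ne hx hj, fun h ↦ ?_⟩
  have : x = gr.proj i x := gr.ext_proj fun j ↦ by
    rw [gr.proj_of_mem_ite (gr.proj_mem i x)]
    split_ifs with hj
    · rw [hj]
    · exact h j hj
  rw [this]
  exact gr.proj_mem i x

/-- Turns membership in `𝔤_-`, `𝔭`, `𝔭_+` and the filtration into the vanishing of components. -/
theorem mem_iSup_comp_iff (q : ℤ → Prop) {x : 𝔤} :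
    x ∈ ⨆ i : ℤ, ⨆ _ : q i, gr.comp i ↔ ∀ i, ¬ q i → gr.proj i x = 0 := by
  refine ⟨fun hx i hi ↦ ?_, fun h ↦ ?_⟩
  · have hle : ⨆ i : ℤ, ⨆ _ : q i, gr.comp i ≤ LinearMap.ker (gr.proj i) :=
      iSup₂_le fun j hj y hy ↦ gr.proj_of_mem_ne hy (by rintro rfl; exact hi hj)
    exact hle hx
  · rw [← gr.sum_proj x]
    refine Submodule.sum_mem _ fun i _ ↦ ?_
    by_cases hi : q i
    · exact Submodule.mem_iSup_of_mem i (Submodule.mem_iSup_of_mem hi (gr.proj_mem i x))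
    · rw [h i hi]
      exact zero_mem _

theorem mem_neg_iff {x : 𝔤} : x ∈ gr.neg ↔ ∀ i, 0 ≤ i → gr.proj i x = 0 := by
  simp [neg, mem_iSup_comp_iff]

theorem mem_nonneg_iff {x : 𝔤} : x ∈ gr.nonneg ↔ ∀ i, i < 0 → gr.proj i x = 0 := by
  simp [nonneg, mem_iSup_comp_iff]

theorem mem_pos_iff {x : 𝔤} : x ∈ gr.pos ↔ ∀ i, i ≤ 0 → gr.proj i x = 0 := by
  simp [pos, mem_iSup_comp_iff]

/-- The filtration `⊕_{i ≥ j} 𝔤_i`. -/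
def fil (j : ℤ) : Submodule ℝ 𝔤 := ⨆ i : ℤ, ⨆ _ : j ≤ i, gr.comp i

theorem mem_fil_iff {j : ℤ} {x : 𝔤} : x ∈ gr.fil j ↔ ∀ i, i < j → gr.proj i x = 0 := by
  simp [fil, mem_iSup_comp_iff]

theorem comp_le_fil {i j : ℤ} (h : j ≤ i) : gr.comp i ≤ gr.fil j := fun _ hx ↦
  gr.mem_fil_iff.2 fun _ hl ↦ gr.proj_of_mem_ne hx (hl.trans_le h).ne

theorem fil_anti {i j : ℤ} (h : j ≤ i) : gr.fil i ≤ gr.fil j := fun _ hx ↦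
  gr.mem_fil_iff.2 fun l hl ↦ gr.mem_fil_iff.1 hx l (hl.trans_le h)

theorem fil_eq_bot {j : ℤ} (hj : (gr.depth : ℤ) < j) : gr.fil j = ⊥ := by
  rw [Submodule.eq_bot_iff]
  intro x hx
  refine gr.ext_proj fun i ↦ ?_
  rw [map_zero]
  by_cases hi : i < j
  · exact gr.mem_fil_iff.1 hx i hi
  · exact gr.proj_eq_zero_of_depth_lt (lt_of_lt_of_le (by omega) (le_abs_self i)) x

theorem sub_proj_mem_fil {j : ℤ} {x : 𝔤} (hx : x ∈ gr.fil j) : x - gr.proj j x ∈ gr.fil (j + 1) := by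
  refine gr.mem_fil_iff.2 fun i hi ↦ ?_
  rw [map_sub, sub_eq_zero]
  rcases (Int.lt_add_one_iff.1 hi).lt_or_eq with h | rfl
  · rw [gr.mem_fil_iff.1 hx i h, gr.proj_of_mem_ne (gr.proj_mem j x) h.ne]
  · rw [gr.proj_of_mem (gr.proj_mem i x)]

theorem proj_lie {i j : ℤ} {x y : 𝔤} (hx : x ∈ gr.comp j) :
    gr.proj i ⁅x, y⁆ = ⁅x, gr.proj (i - j) y⁆ := by
  refine gr.induction_comp y (fun l z hz ↦ ?_) fun y z hy hz ↦ ?_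
  · rw [gr.proj_of_mem_ite (gr.lie_mem _ _ _ hx _ hz), gr.proj_of_mem_ite hz]
    by_cases h : i = j + l
    · rw [if_pos h, if_pos (by omega)]
    · rw [if_neg h, if_neg (by omega), lie_zero]
  · rw [lie_add, map_add, hy, hz, map_add, lie_add]

theorem lie_mem_fil {i j : ℤ} {x y : 𝔤} (hx : x ∈ gr.fil i) (hy : y ∈ gr.fil j) :
    ⁅x, y⁆ ∈ gr.fil (i + j) := by
  refine gr.mem_fil_iff.2 fun l hl ↦ ?_
  rw [← gr.sum_proj x, sum_lie, map_sum]
  refine Finset.sum_eq_zero fun m _ ↦ ?_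
  rw [gr.proj_lie (gr.proj_mem m x)]
  by_cases hm : m < i
  · rw [gr.mem_fil_iff.1 hx m hm, zero_lie]
  · rw [gr.mem_fil_iff.1 hy (l - m) (by omega), lie_zero]

theorem lie_mem_pos {x y : 𝔤} (hx : x ∈ gr.nonneg) (hy : y ∈ gr.pos) : ⁅x, y⁆ ∈ gr.pos := by
  have h := gr.lie_mem_fil (i := 0) (j := 1) hx hy
  rwa [zero_add] at h

theorem comp_le_nonneg {i : ℤ} (hi : 0 ≤ i) : gr.comp i ≤ gr.nonneg := gr.comp_le_fil hi

theorem comp_le_neg {i : ℤ} (hi : i < 0) : gr.comp i ≤ gr.neg := fun _ hx ↦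
  gr.mem_neg_iff.2 fun _ hl ↦ gr.proj_of_mem_ne hx (hi.trans_le hl).ne'

theorem pos_le_nonneg : gr.pos ≤ gr.nonneg := gr.fil_anti (j := 0) (i := 1) zero_le_one

theorem proj_neg_one_lie_neg {x y : 𝔤} (hx : x ∈ gr.neg) (hy : y ∈ gr.neg) :
    gr.proj (-1) ⁅x, y⁆ = 0 := by
  rw [← gr.sum_proj x, sum_lie, map_sum]
  refine Finset.sum_eq_zero fun m _ ↦ ?_
  rw [gr.proj_lie (gr.proj_mem m x)]
  by_cases hm : 0 ≤ m
  · rw [gr.mem_neg_iff.1 hx m hm, zero_lie]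
  · rw [gr.mem_neg_iff.1 hy (-1 - m) (by omega), lie_zero]

theorem lie_mem_neg {x y : 𝔤} (hx : x ∈ gr.neg) (hy : y ∈ gr.neg) : ⁅x, y⁆ ∈ gr.neg := by
  rw [neg, ← gr.neg_generated] at *
  exact LieSubalgebra.lie_mem _ hx hy

theorem sub_proj_zero_mem_pos {x : 𝔤} (hx : x ∈ gr.nonneg) : x - gr.proj 0 x ∈ gr.pos :=
  gr.sub_proj_mem_fil (j := 0) hx

theorem eq_zero_of_mem_nonneg_of_mem_neg {x : 𝔤} (hx : x ∈ gr.nonneg) (hx' : x ∈ gr.neg) :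
    x = 0 := gr.ext_proj fun i ↦ by
  rw [map_zero]
  rcases lt_or_ge i 0 with h | h
  · exact gr.mem_nonneg_iff.1 hx i h
  · exact gr.mem_neg_iff.1 hx' i h

theorem eq_zero_of_mem_comp_of_mem_fil {i j : ℤ} {x : 𝔤} (hij : i < j) (hx : x ∈ gr.comp i)
    (hx' : x ∈ gr.fil j) : x = 0 := by
  rw [← gr.proj_of_mem hx, gr.mem_fil_iff.1 hx' i hij]

/-- If `ad x` is injective on `𝔭_+` for some `x ∈ 𝔭`, then so is `ad x₀`, for the component `x₀`
of `x` of degree zero. -/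
theorem lie_proj_zero_injective [Module.Finite ℝ 𝔤] {x : 𝔤} (hx : x ∈ gr.nonneg)
    (hinj : ∀ y ∈ gr.pos, ⁅x, y⁆ = 0 → y = 0) :
    ∀ y ∈ gr.pos, ⁅gr.proj 0 x, y⁆ = 0 → y = 0 := by
  intro y hy hxy
  refine gr.ext_proj fun i ↦ ?_
  rw [map_zero]
  rcases le_or_gt i 0 with hi | hi
  · exact gr.mem_pos_iff.1 hy i hi
  have h1 : ⁅gr.proj 0 x, gr.proj i y⁆ = 0 := by
    have := gr.proj_lie (i := i) (y := y) (gr.proj_mem 0 x)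
    rwa [hxy, map_zero, sub_zero, eq_comm] at this
  -- As `x₀` kills `y_i`, `ad x` raises its degree. On the filtration subspace of degree `i + 1`,
  -- `ad x` is injective, hence onto, so injectivity on `𝔭_+` forces `y_i` to lie in that subspace;
  -- being of degree `i`, it is zero.
  have h2 : ⁅x, gr.proj i y⁆ ∈ gr.fil (i + 1) := by
    have h3 : ⁅x, gr.proj i y⁆ = ⁅x - gr.proj 0 x, gr.proj i y⁆ := by rw [sub_lie, h1, sub_zero]
    rw [h3, add_comm]
    exact gr.lie_mem_fil (gr.sub_proj_zero_mem_pos hx) (gr.comp_le_fil le_rfl (gr.proj_mem i y))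
  let T : gr.fil (i + 1) →ₗ[ℝ] gr.fil (i + 1) := (LieAlgebra.ad ℝ 𝔤 x).restrict fun z hz ↦ by
    have := gr.lie_mem_fil (i := 0) hx hz
    rwa [zero_add] at this
  have hle : gr.fil (i + 1) ≤ gr.pos := gr.fil_anti (by omega)
  have hT : Function.Injective T := by
    rw [injective_iff_map_eq_zero]
    intro z hz
    exact Subtype.ext (hinj z (hle z.2) (congrArg Subtype.val hz))
  obtain ⟨z, hz⟩ := (LinearMap.injective_iff_surjective.1 hT) ⟨_, h2⟩
  have hz' : ⁅x, (z : 𝔤)⁆ = ⁅x, gr.proj i y⁆ := congrArg Subtype.val hz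
  have h4 : (z : 𝔤) - gr.proj i y = 0 :=
    hinj _ (sub_mem (hle z.2) (gr.fil_anti (by omega) (gr.comp_le_fil le_rfl (gr.proj_mem i y))))
      (by rw [lie_sub, hz', sub_self])
  refine gr.eq_zero_of_mem_comp_of_mem_fil (lt_add_one i) (gr.proj_mem i y) ?_
  rw [← sub_eq_zero.1 h4]
  exact z.2

/-! ### The grading element and the Killing form of a semisimple graded algebra -/

section Killing

theorem exists_apply_eq (φ : 𝔤 ≃ₗ⁅ℝ⁆ 𝔤) (y : 𝔤) : ∃ z, φ z = y :=
  ⟨φ.symm y, φ.apply_symm_apply y⟩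

variable [LieAlgebra.IsKilling ℝ 𝔤]

theorem eq_zero_of_killingForm {x : 𝔤} (h : ∀ y, killingForm ℝ 𝔤 x y = 0) : x = 0 :=
  (LieAlgebra.IsKilling.killingForm_nondegenerate ℝ 𝔤).1 x h

variable [Module.Finite ℝ 𝔤]

/-- Multiplication by `i` on `𝔤_i` is a derivation, and every derivation of a Lie algebra with
nondegenerate Killing form is inner. -/
theorem exists_gradingElement : ∃ E : 𝔤, ∀ x : 𝔤, ∀ i, gr.proj i ⁅E, x⁆ = (i : ℝ) • gr.proj i x := by
  let D : 𝔤 →ₗ[ℝ] 𝔤 := ∑ i ∈ gr.degrees, (i : ℝ) • gr.proj i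
  have hD : ∀ i, ∀ x ∈ gr.comp i, D x = (i : ℝ) • x := by
    intro i x hx
    have h1 : D x = ∑ j ∈ gr.degrees, (j : ℝ) • gr.proj j x := by simp [D]
    conv_rhs => rw [← gr.sum_proj x, Finset.smul_sum]
    rw [h1]
    refine Finset.sum_congr rfl fun j _ ↦ ?_
    rw [gr.proj_of_mem_ite hx]
    split_ifs with h
    · rw [h]
    · rw [smul_zero, smul_zero]
  have hleib : ∀ a b : 𝔤, D ⁅a, b⁆ = ⁅a, D b⁆ - ⁅b, D a⁆ := by
    intro a b
    refine gr.induction_comp a (fun i x hx ↦ ?_) fun x y hx hy ↦ by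
      rw [add_lie, map_add, hx, hy, add_lie, map_add, lie_add]; abel
    refine gr.induction_comp b (fun j y hy ↦ ?_) fun y z hy hz ↦ by
      rw [lie_add, map_add, hy, hz, map_add, add_lie, lie_add]; abel
    rw [hD _ _ (gr.lie_mem i j x hx y hy), hD _ _ hx, hD _ _ hy, lie_smul, lie_smul,
      ← lie_skew x y, Int.cast_add, add_smul]
    simp only [smul_neg]
    abel
  obtain ⟨E, hE⟩ := LieDerivation.IsKilling.exists_eq_ad (R := ℝ) (L := 𝔤) ⟨D, hleib⟩
  refine ⟨E, fun x i ↦ ?_⟩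
  have h1 : ∀ y, ⁅E, y⁆ = D y := fun y ↦ by
    have := DFunLike.congr_fun hE y
    simpa using this
  rw [h1]
  refine gr.induction_comp x (fun j y hy ↦ ?_) fun y z hy hz ↦ by
    rw [map_add, map_add, map_add, smul_add, hy, hz]
  rw [hD j y hy, map_smul, gr.proj_of_mem_ite hy]
  split_ifs with h
  · rw [h]
  · rw [smul_zero, smul_zero]

/-- The grading element `E`, with `[E, x] = i x` for `x ∈ 𝔤_i`. -/
def gradingElement : 𝔤 := gr.exists_gradingElement.choose

theorem proj_gradingElement_lie (x : 𝔤) (i : ℤ) :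
    gr.proj i ⁅gr.gradingElement, x⁆ = (i : ℝ) • gr.proj i x :=
  gr.exists_gradingElement.choose_spec x i

theorem gradingElement_lie {i : ℤ} {x : 𝔤} (hx : x ∈ gr.comp i) :
    ⁅gr.gradingElement, x⁆ = (i : ℝ) • x := gr.ext_proj fun j ↦ by
  rw [proj_gradingElement_lie, map_smul, gr.proj_of_mem_ite hx]
  split_ifs with h
  · rw [h]
  · rw [smul_zero, smul_zero]

theorem mem_comp_of_gradingElement_lie {i : ℤ} {x : 𝔤}
    (hx : ⁅gr.gradingElement, x⁆ = (i : ℝ) • x) : x ∈ gr.comp i := by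
  refine gr.mem_comp_iff.2 fun j hj ↦ ?_
  have h := gr.proj_gradingElement_lie x j
  rw [hx, map_smul, ← sub_eq_zero, ← sub_smul, smul_eq_zero, sub_eq_zero, Int.cast_inj] at h
  exact h.resolve_left hj.symm

theorem gradingElement_mem : gr.gradingElement ∈ gr.comp 0 :=
  gr.mem_comp_of_gradingElement_lie (by simp)

theorem gradingElement_mem_nonneg : gr.gradingElement ∈ gr.nonneg :=
  gr.comp_le_nonneg le_rfl gr.gradingElement_mem

theorem gradingElement_lie_mem_pos {x : 𝔤} (hx : x ∈ gr.nonneg) :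
    ⁅gr.gradingElement, x⁆ ∈ gr.pos := by
  refine gr.mem_pos_iff.2 fun i hi ↦ ?_
  rw [proj_gradingElement_lie]
  rcases hi.lt_or_eq with h | rfl
  · rw [gr.mem_nonneg_iff.1 hx i h, smul_zero]
  · simp

theorem eq_zero_of_gradingElement_lie {x : 𝔤} (hx : x ∈ gr.pos)
    (h : ⁅gr.gradingElement, x⁆ = 0) : x = 0 := gr.ext_proj fun i ↦ by
  rw [map_zero]
  rcases le_or_gt i 0 with hi | hi
  · exact gr.mem_pos_iff.1 hx i hi
  · have h1 := gr.proj_gradingElement_lie x i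
    rw [h, map_zero, eq_comm, smul_eq_zero] at h1
    exact h1.resolve_left (by exact_mod_cast hi.ne')

/-- Invariance of the Killing form under `ad E` gives `(i + j) K(x, y) = 0`. -/
theorem killingForm_eq_zero {i j : ℤ} {x y : 𝔤} (hx : x ∈ gr.comp i) (hy : y ∈ gr.comp j)
    (hij : i + j ≠ 0) : killingForm ℝ 𝔤 x y = 0 := by
  have h := LieModule.traceForm_apply_lie_apply ℝ 𝔤 𝔤 x gr.gradingElement y
  rw [← lie_skew, gr.gradingElement_lie hx, gr.gradingElement_lie hy, map_neg, map_smul, map_smul,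
    LinearMap.neg_apply, LinearMap.smul_apply, smul_eq_mul, smul_eq_mul] at h
  have h1 : ((i + j : ℤ) : ℝ) * killingForm ℝ 𝔤 x y = 0 := by
    push_cast
    change ((i : ℝ) + j) * LieModule.traceForm ℝ 𝔤 𝔤 x y = 0
    linear_combination -h
  exact (mul_eq_zero.1 h1).resolve_left (by exact_mod_cast hij)

theorem killingForm_eq_proj (x : 𝔤) {j : ℤ} {y : 𝔤} (hy : y ∈ gr.comp j) :
    killingForm ℝ 𝔤 x y = killingForm ℝ 𝔤 (gr.proj (-j) x) y := by
  refine gr.induction_comp x (fun i z hz ↦ ?_) fun z w hz hw ↦ by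
    rw [map_add, map_add, map_add, LinearMap.add_apply, LinearMap.add_apply, hz, hw]
  rw [gr.proj_of_mem_ite hz]
  split_ifs with h
  · rfl
  · rw [map_zero, LinearMap.zero_apply]
    exact gr.killingForm_eq_zero hz hy (by omega)

/-- The form pairs `𝔤_i` only with `𝔤_{-i}`, without degeneracy. This describes `𝔭_+` in terms of
`𝔭` alone, so an automorphism that preserves `𝔭` also preserves `𝔭_+`. -/
theorem mem_pos_iff_killingForm {x : 𝔤} :
    x ∈ gr.pos ↔ ∀ y ∈ gr.nonneg, killingForm ℝ 𝔤 x y = 0 := by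
  constructor
  · intro hx y hy
    rw [← gr.sum_proj y, map_sum]
    refine Finset.sum_eq_zero fun j _ ↦ ?_
    rcases lt_or_ge j 0 with hj | hj
    · rw [gr.mem_nonneg_iff.1 hy j hj, map_zero]
    · rw [gr.killingForm_eq_proj x (gr.proj_mem j y), gr.mem_pos_iff.1 hx _ (by omega), map_zero,
        LinearMap.zero_apply]
  · intro h
    refine gr.mem_pos_iff.2 fun i hi ↦ eq_zero_of_killingForm fun y ↦ ?_
    rw [LieModule.traceForm_comm, gr.killingForm_eq_proj y (gr.proj_mem i x),
      LieModule.traceForm_comm]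
    have h1 := gr.killingForm_eq_proj x (gr.proj_mem (-i) y)
    rw [neg_neg] at h1
    exact h1.symm.trans (h _ (gr.comp_le_nonneg (by omega) (gr.proj_mem (-i) y)))

theorem map_mem_pos (φ : 𝔤 ≃ₗ⁅ℝ⁆ 𝔤) (hφ : ∀ x, φ x ∈ gr.nonneg ↔ x ∈ gr.nonneg) {x : 𝔤}
    (hx : x ∈ gr.pos) : φ x ∈ gr.pos := by
  refine gr.mem_pos_iff_killingForm.2 fun y hy ↦ ?_
  obtain ⟨z, rfl⟩ := exists_apply_eq φ y
  rw [LieAlgebra.killingForm_of_equiv_apply]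
  exact gr.mem_pos_iff_killingForm.1 hx z ((hφ z).1 hy)

theorem map_mem_pos_iff (φ : 𝔤 ≃ₗ⁅ℝ⁆ 𝔤) (hφ : ∀ x, φ x ∈ gr.nonneg ↔ x ∈ gr.nonneg) {x : 𝔤} :
    φ x ∈ gr.pos ↔ x ∈ gr.pos := by
  refine ⟨fun h ↦ ?_, gr.map_mem_pos φ hφ⟩
  have := gr.map_mem_pos φ.symm (fun y ↦ by rw [← hφ, φ.apply_symm_apply]) h
  rwa [φ.symm_apply_apply] at this

/-- The image of the grading element under an automorphism preserving `𝔭` acts injectively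
on `𝔭_+`. -/
theorem lie_map_gradingElement_injective (φ : 𝔤 ≃ₗ⁅ℝ⁆ 𝔤)
    (hφ : ∀ x, φ x ∈ gr.nonneg ↔ x ∈ gr.nonneg) :
    ∀ y ∈ gr.pos, ⁅φ gr.gradingElement, y⁆ = 0 → y = 0 := by
  intro y hy h
  obtain ⟨z, rfl⟩ := exists_apply_eq φ y
  rw [← LieEquiv.map_lie] at h
  have h1 : ⁅gr.gradingElement, z⁆ = 0 := φ.injective (h.trans (map_zero _).symm)
  rw [gr.eq_zero_of_gradingElement_lie ((gr.map_mem_pos_iff φ hφ).1 hy) h1, map_zero]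

/-- An element which acts trivially on a semisimple Lie algebra vanishes. -/
theorem eq_zero_of_lie_eq_zero {x : 𝔤} (h : ∀ y : 𝔤, ⁅x, y⁆ = 0) : x = 0 := by
  have h1 : x ∈ LieAlgebra.center ℝ 𝔤 := (LieModule.mem_maxTrivSubmodule ℝ 𝔤 𝔤 x).2 fun y ↦ by
    rw [← lie_skew, h, neg_zero]
  rwa [LieAlgebra.center_eq_bot, LieSubmodule.mem_bot] at h1

/-- An automorphism which preserves `𝔭` and maps the grading element into `𝔤_0` fixes
the grading element. -/
theorem map_gradingElement_eq (φ : 𝔤 ≃ₗ⁅ℝ⁆ 𝔤) (hφ : ∀ x, φ x ∈ gr.nonneg ↔ x ∈ gr.nonneg)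
    (h0 : φ gr.gradingElement ∈ gr.comp 0) : φ gr.gradingElement = gr.gradingElement := by
  set E := gr.gradingElement
  -- `φ E` acts trivially on `𝔤_0`
  have hzero : ∀ y ∈ gr.comp 0, ⁅φ E, y⁆ = 0 := by
    intro y hy
    obtain ⟨z, rfl⟩ := exists_apply_eq φ y
    have hz : z ∈ gr.nonneg := (hφ z).1 (gr.comp_le_nonneg le_rfl hy)
    have h1 : ⁅φ E, φ z⁆ ∈ gr.pos := by
      rw [← LieEquiv.map_lie]
      exact gr.map_mem_pos φ hφ (gr.gradingElement_lie_mem_pos hz)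
    refine gr.eq_zero_of_mem_comp_of_mem_fil (i := 0) (j := 1) one_pos ?_ h1
    have := gr.lie_mem 0 0 _ h0 _ hy
    rwa [zero_add] at this
  -- `φ` preserves `𝔤_-`
  have hcomp : ∀ j < 0, ∀ y ∈ gr.comp j, φ y ∈ gr.neg := by
    intro j hj y hy
    refine gr.mem_neg_iff.2 fun i hi ↦ ?_
    -- `ad (φ E)` preserves degrees, so each component of `φ y` has eigenvalue `j`. A component of
    -- degree `i ≥ 0` lies in `𝔭`, so its preimage lies in `𝔭` and in `𝔤_j` with `j < 0`: it is
    -- zero.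
    have h1 : ⁅φ E, gr.proj i (φ y)⁆ = (j : ℝ) • gr.proj i (φ y) := by
      have := gr.proj_lie (i := i) (y := φ y) h0
      rw [← LieEquiv.map_lie, gr.gradingElement_lie hy, map_smul, map_smul, sub_zero] at this
      exact this.symm
    obtain ⟨z, hz⟩ := exists_apply_eq φ (gr.proj i (φ y))
    have h2 : z ∈ gr.comp j := by
      refine gr.mem_comp_of_gradingElement_lie (φ.injective ?_)
      change φ ⁅E, z⁆ = φ ((j : ℝ) • z)
      rw [LieEquiv.map_lie, map_smul, hz, h1]
    have h3 : z ∈ gr.nonneg := (hφ z).1 (by rw [hz]; exact gr.comp_le_nonneg hi (gr.proj_mem i _))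
    rw [← hz, gr.eq_zero_of_mem_nonneg_of_mem_neg h3 (gr.comp_le_neg hj h2), map_zero]
  have hneg : ∀ y ∈ gr.neg, φ y ∈ gr.neg := by
    intro y hy
    rw [← gr.sum_proj y, map_sum]
    refine Submodule.sum_mem _ fun j _ ↦ ?_
    rcases lt_or_ge j 0 with hj | hj
    · exact hcomp j hj _ (gr.proj_mem j y)
    · rw [gr.mem_neg_iff.1 hy j hj, map_zero]
      exact zero_mem _
  have hneg' : ∀ y, φ y ∈ gr.neg → y ∈ gr.neg := by
    intro y hy
    let p : 𝔤 := ∑ j ∈ gr.degrees.filter (fun j ↦ 0 ≤ j), gr.proj j y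
    let n : 𝔤 := ∑ j ∈ gr.degrees.filter (fun j ↦ ¬ 0 ≤ j), gr.proj j y
    have hpn : p + n = y := by
      rw [← gr.sum_proj y]
      exact Finset.sum_filter_add_sum_filter_not _ _ _
    have hp : p ∈ gr.nonneg := Submodule.sum_mem _ fun j hj ↦
      gr.comp_le_nonneg (Finset.mem_filter.1 hj).2 (gr.proj_mem j y)
    have hn : n ∈ gr.neg := Submodule.sum_mem _ fun j hj ↦
      gr.comp_le_neg (not_le.1 (Finset.mem_filter.1 hj).2) (gr.proj_mem j y)
    have h1 : φ p = φ y - φ n := by rw [← hpn, map_add, add_sub_cancel_right]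
    have h2 : φ p = 0 := gr.eq_zero_of_mem_nonneg_of_mem_neg ((hφ p).2 hp)
      (h1 ▸ sub_mem hy (hneg n hn))
    have h3 : p = 0 := φ.injective (h2.trans (map_zero _).symm)
    rw [← hpn, h3, zero_add]
    exact hn
  -- on `𝔤_-`, the component of degree `-1` of `φ y` is determined by that of `y`
  let T : LieSubalgebra ℝ 𝔤 :=
    { carrier := {y | y ∈ gr.neg ∧ gr.proj (-1) (φ y) = gr.proj (-1) (φ (gr.proj (-1) y))}
      zero_mem' := by simp
      add_mem' := by
        rintro y z ⟨hy, hy'⟩ ⟨hz, hz'⟩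
        exact ⟨add_mem hy hz, by simp only [map_add, hy', hz']⟩
      smul_mem' := by
        rintro c y ⟨hy, hy'⟩
        exact ⟨Submodule.smul_mem _ c hy, by simp only [map_smul, hy']⟩
      lie_mem' := by
        rintro y z ⟨hy, hy'⟩ ⟨hz, hz'⟩
        refine ⟨gr.lie_mem_neg hy hz, ?_⟩
        -- Brackets of elements of `𝔤_-` have degree at most `-2`, so both sides vanish.
        rw [LieEquiv.map_lie, gr.proj_neg_one_lie_neg (hneg y hy) (hneg z hz),
          gr.proj_neg_one_lie_neg hy hz, map_zero, map_zero] }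
  have hT : ∀ y ∈ gr.neg, gr.proj (-1) (φ y) = gr.proj (-1) (φ (gr.proj (-1) y)) := by
    intro y hy
    have hle : LieSubalgebra.lieSpan ℝ 𝔤 (gr.comp (-1) : Set 𝔤) ≤ T :=
      LieSubalgebra.lieSpan_le.2 fun z hz ↦
        ⟨gr.comp_le_neg (by norm_num) hz, by rw [gr.proj_of_mem hz]⟩
    rw [neg, ← gr.neg_generated] at hy
    exact (hle hy).2
  -- `φ E - E` acts trivially on `𝔤_-`
  have hone : ∀ x ∈ gr.comp (-1), ⁅φ E - E, x⁆ = 0 := by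
    intro x hx
    obtain ⟨y, rfl⟩ := exists_apply_eq φ x
    have hy : y ∈ gr.neg := hneg' y (gr.comp_le_neg (by norm_num) hx)
    have h1 : φ y = gr.proj (-1) (φ (gr.proj (-1) y)) := by
      rw [← hT y hy, gr.proj_of_mem hx]
    -- `φ y` is the component of degree `-1` of the image of a vector of degree `-1`. That image has
    -- eigenvalue `-1` for `ad (φ E)`, and so do its components.
    have h2 : ⁅φ E, φ y⁆ = ((-1 : ℤ) : ℝ) • φ y := by
      have h3 := gr.proj_lie (i := -1) (y := φ (gr.proj (-1) y)) h0
      rw [← LieEquiv.map_lie, gr.gradingElement_lie (gr.proj_mem (-1) y), map_smul, map_smul,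
        sub_zero, ← h1] at h3
      exact h3.symm
    rw [sub_lie, h2, gr.gradingElement_lie hx, sub_self]
  have hHneg : ∀ x ∈ gr.neg, ⁅φ E - E, x⁆ = 0 := by
    intro x hx
    let C : LieSubalgebra ℝ 𝔤 :=
      { LinearMap.ker (LieAlgebra.ad ℝ 𝔤 (φ E - E)) with
        lie_mem' := by
          intro y z hy hz
          simp only [AddSubsemigroup.mem_carrier, AddSubmonoid.mem_toSubsemigroup,
            Submodule.mem_toAddSubmonoid, LinearMap.mem_ker, LieAlgebra.ad_apply] at hy hz ⊢
          rw [leibniz_lie, hy, hz, zero_lie, lie_zero, add_zero] }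
    have hle : LieSubalgebra.lieSpan ℝ 𝔤 (gr.comp (-1) : Set 𝔤) ≤ C :=
      LieSubalgebra.lieSpan_le.2 fun z hz ↦ hone z hz
    rw [neg, ← gr.neg_generated] at hx
    exact hle hx
  have hH0 : ∀ x ∈ gr.comp 0, ⁅φ E - E, x⁆ = 0 := by
    intro x hx
    rw [sub_lie, hzero x hx, gr.gradingElement_lie hx]
    simp
  have hHE : φ E - E ∈ gr.nonneg := gr.comp_le_nonneg le_rfl (sub_mem h0 gr.gradingElement_mem)
  have hHpos : ∀ x ∈ gr.pos, ⁅φ E - E, x⁆ = 0 := by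
    intro x hx
    have hxp := gr.lie_mem_pos hHE hx
    -- `[φ E - E, x]` lies in `𝔭_+`, hence is orthogonal to `𝔭`. Against `𝔤_-` it is tested by
    -- invariance, moving `φ E - E` onto the argument, which it kills.
    refine eq_zero_of_killingForm fun y ↦ ?_
    refine gr.induction_comp y (fun j z hz ↦ ?_) fun z w hz hw ↦ by rw [map_add, hz, hw, add_zero]
    rcases lt_or_ge j 0 with hj | hj
    · have h := LieModule.traceForm_apply_lie_apply ℝ 𝔤 𝔤 x (φ E - E) z
      rw [hHneg z (gr.comp_le_neg hj hz), map_zero, ← lie_skew, map_neg, LinearMap.neg_apply,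
        neg_eq_zero] at h
      exact h
    · exact gr.mem_pos_iff_killingForm.1 hxp z (gr.comp_le_nonneg hj hz)
  have hH : φ E - E = 0 := by
    refine eq_zero_of_lie_eq_zero fun y ↦ ?_
    refine gr.induction_comp y (fun j z hz ↦ ?_) fun z w hz hw ↦ by rw [lie_add, hz, hw, add_zero]
    rcases lt_trichotomy j 0 with hj | rfl | hj
    · exact hHneg z (gr.comp_le_neg hj hz)
    · exact hH0 z hz
    · exact hHpos z (gr.comp_le_fil (j := 1) hj hz)
  exact sub_eq_zero.1 hH

end Killing

end Grading
/-! ### Partial derivatives in charts -/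

section Partial

open Set

variable {E E' F : Type*} [NormedAddCommGroup E] [NormedSpace ℝ E]
  [NormedAddCommGroup E'] [NormedSpace ℝ E'] [NormedAddCommGroup F] [NormedSpace ℝ F]
  {N N' H : Type*} [TopologicalSpace N] [ChartedSpace E N]
  [TopologicalSpace N'] [ChartedSpace E' N'] [TopologicalSpace H] [ChartedSpace F H]
  [IsManifold 𝓘(ℝ, E) ∞ N] [IsManifold 𝓘(ℝ, E') ∞ N'] [IsManifold 𝓘(ℝ, F) ∞ H]

/-- The map `Φ` in charts. -/
def chartMap (Φ : N × H → N') (n₀ : N) (h₀ : H) (n' : N') (z : E × F) : E' :=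
  extChartAt 𝓘(ℝ, E') n' (Φ ((extChartAt 𝓘(ℝ, E) n₀).symm z.1, (extChartAt 𝓘(ℝ, F) h₀).symm z.2))

variable {Φ : N × H → N'} {n₀ : N} {h₀ : H} {n' : N'}

theorem contDiffAt_chartMap
    (hΦ : ContMDiffAt (𝓘(ℝ, E).prod 𝓘(ℝ, F)) 𝓘(ℝ, E') ∞ Φ (n₀, h₀))
    (hn' : Φ (n₀, h₀) ∈ (extChartAt 𝓘(ℝ, E') n').source) :
    ContDiffAt ℝ ∞ (chartMap (E := E) (E' := E') (F := F) Φ n₀ h₀ n')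
      (extChartAt 𝓘(ℝ, E) n₀ n₀, extChartAt 𝓘(ℝ, F) h₀ h₀) := by
  rw [extChartAt_source] at hn'
  have h1 : ContMDiffAt 𝓘(ℝ, E × F) 𝓘(ℝ, E) ∞
      (fun z : E × F ↦ (extChartAt 𝓘(ℝ, E) n₀).symm z.1)
      (extChartAt 𝓘(ℝ, E) n₀ n₀, extChartAt 𝓘(ℝ, F) h₀ h₀) :=
    ContMDiffAt.comp (I' := 𝓘(ℝ, E)) (f := Prod.fst) _ ((contMDiffOn_extChartAt_symm n₀).contMDiffAt
      ((isOpen_extChartAt_target n₀).mem_nhds (mem_extChartAt_target n₀)))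
      contDiff_fst.contMDiff.contMDiffAt
  have h2 : ContMDiffAt 𝓘(ℝ, E × F) 𝓘(ℝ, F) ∞
      (fun z : E × F ↦ (extChartAt 𝓘(ℝ, F) h₀).symm z.2)
      (extChartAt 𝓘(ℝ, E) n₀ n₀, extChartAt 𝓘(ℝ, F) h₀ h₀) :=
    ContMDiffAt.comp (I' := 𝓘(ℝ, F)) (f := Prod.snd) _ ((contMDiffOn_extChartAt_symm h₀).contMDiffAt
      ((isOpen_extChartAt_target h₀).mem_nhds (mem_extChartAt_target h₀)))
      contDiff_snd.contMDiff.contMDiffAt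
  refine contMDiffAt_iff_contDiffAt.1 ?_
  have h3 := h1.prodMk h2
  have h4 : ((extChartAt 𝓘(ℝ, E) n₀).symm (extChartAt 𝓘(ℝ, E) n₀ n₀),
      (extChartAt 𝓘(ℝ, F) h₀).symm (extChartAt 𝓘(ℝ, F) h₀ h₀)) = (n₀, h₀) := by
    rw [extChartAt_to_inv, extChartAt_to_inv]
  have h5 := ContMDiffAt.comp_of_eq hΦ h3 h4
  refine ContMDiffAt.comp_of_eq (contMDiffAt_extChartAt' hn') h5 ?_
  exact congrArg Φ h4

/-- The chain rule for the partial derivative in the second variable. It holds for all `x` near the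
center with one fixed target chart, so both sides may be differentiated again in `x`. -/
theorem eventually_fderiv_chartMap_comp_inr
    (hΦ : ContMDiff (𝓘(ℝ, E).prod 𝓘(ℝ, F)) 𝓘(ℝ, E') ∞ Φ)
    (hn' : Φ (n₀, h₀) ∈ (extChartAt 𝓘(ℝ, E') n').source) :
    ∀ᶠ x in 𝓝 (extChartAt 𝓘(ℝ, E) n₀ n₀), ∀ v : F,
      fderiv ℝ (chartMap (E := E) (E' := E') (F := F) Φ n₀ h₀ n') (x, extChartAt 𝓘(ℝ, F) h₀ h₀)
          (0, tderiv (E := F) (E' := F) (extChartAt 𝓘(ℝ, F) h₀) h₀ v)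
        = tderiv (E := E') (E' := E') (extChartAt 𝓘(ℝ, E') n')
            (Φ ((extChartAt 𝓘(ℝ, E) n₀).symm x, h₀))
          (tderiv (E := F) (E' := E') (fun h ↦ Φ ((extChartAt 𝓘(ℝ, E) n₀).symm x, h)) h₀ v) := by
  set ψ := extChartAt 𝓘(ℝ, F) h₀
  set φ := extChartAt 𝓘(ℝ, E) n₀
  have hcd := contDiffAt_chartMap (hΦ (n₀, h₀)) hn'
  have hdiff : ∀ᶠ z in 𝓝 (φ n₀, ψ h₀),
      DifferentiableAt ℝ (chartMap (E := E) (E' := E') (F := F) Φ n₀ h₀ n') z := by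
    filter_upwards [(hcd.of_le (m := 1) (by simp)).eventually (by simp)] with z hz
    exact hz.differentiableAt (by simp)
  have hcont : ContinuousAt (fun x : E ↦ (x, ψ h₀)) (φ n₀) := by fun_prop
  have hsrc : ∀ᶠ x in 𝓝 (φ n₀), Φ (φ.symm x, h₀) ∈ (extChartAt 𝓘(ℝ, E') n').source := by
    have h1 : ContinuousAt (fun x ↦ Φ (φ.symm x, h₀)) (φ n₀) := by
      refine hΦ.continuous.continuousAt.comp (f := fun x ↦ (φ.symm x, h₀)) ?_
      exact (continuousAt_extChartAt_symm n₀).prodMk continuousAt_const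
    refine h1.preimage_mem_nhds ((isOpen_extChartAt_source n').mem_nhds ?_)
    simp only [φ, extChartAt_to_inv]
    exact hn'
  filter_upwards [hcont.eventually hdiff, hsrc] with x hx hxs v
  have h1 : HasFDerivAt (fun y : F ↦ chartMap (E := E) (E' := E') (F := F) Φ n₀ h₀ n' (x, y))
      ((fderiv ℝ (chartMap (E := E) (E' := E') (F := F) Φ n₀ h₀ n') (x, ψ h₀)).comp
        (ContinuousLinearMap.inr ℝ E F)) (ψ h₀) :=
    HasFDerivAt.comp (f := fun y : F ↦ (x, y)) _ hx.hasFDerivAt (hasFDerivAt_prodMk_right x (ψ h₀))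
  have hsm : ContMDiff 𝓘(ℝ, F) 𝓘(ℝ, E') ∞ (fun h ↦ Φ (φ.symm x, h)) :=
    hΦ.comp (contMDiff_const.prodMk contMDiff_id)
  have hψ : ψ.symm (ψ h₀) = h₀ := extChartAt_to_inv h₀
  have h2 : HasTDerivAt (E := F) (E' := E')
      ((extChartAt 𝓘(ℝ, E') n') ∘ (fun h ↦ Φ (φ.symm x, h)) ∘ ψ.symm) (ψ h₀)
      ((tderiv (E := E') (E' := E') (extChartAt 𝓘(ℝ, E') n') (Φ (φ.symm x, h₀))).comp
        ((tderiv (E := F) (E' := E') (fun h ↦ Φ (φ.symm x, h)) h₀).comp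
          (tderiv (E := F) (E' := F) ψ.symm (ψ h₀)))) := by
    have h3 : HasTDerivAt (E := F) (E' := F) ψ.symm (ψ h₀)
        (tderiv (E := F) (E' := F) ψ.symm (ψ h₀)) :=
      hasTDerivAt_extChartAt_symm (mem_extChartAt_target h₀)
    have h4 : HasTDerivAt (E := F) (E' := E') (fun h ↦ Φ (φ.symm x, h)) (ψ.symm (ψ h₀))
        (tderiv (E := F) (E' := E') (fun h ↦ Φ (φ.symm x, h)) h₀) := by
      rw [hψ]
      exact hasTDerivAt_of_contMDiff hsm
    have h5 : HasTDerivAt (E := E') (E' := E') (extChartAt 𝓘(ℝ, E') n')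
        (((fun h ↦ Φ (φ.symm x, h)) ∘ ψ.symm) (ψ h₀))
        (tderiv (E := E') (E' := E') (extChartAt 𝓘(ℝ, E') n') (Φ (φ.symm x, h₀))) := by
      simp only [Function.comp_apply, hψ]
      exact hasTDerivAt_extChartAt hxs
    exact h5.comp (h4.comp h3)
  have h6 := (hasTDerivAt_iff_hasFDerivAt.2 h1).unique h2
  have h7 := DFunLike.congr_fun h6 (tderiv (E := F) (E' := F) ψ h₀ v)
  have h8 := tderiv_extChartAt_symm_comp (a := h₀) (mem_extChartAt_source h₀) v
  simp only [ContinuousLinearMap.comp_apply, ContinuousLinearMap.inr_apply] at h7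
  rw [h7]
  exact congrArg _ (congrArg _ h8)

/-- The partial derivative in the second variable depends smoothly on the first one. -/
theorem contDiffAt_tderiv_snd
    (hΦ : ContMDiff (𝓘(ℝ, E).prod 𝓘(ℝ, F)) 𝓘(ℝ, E') ∞ Φ)
    (hn' : Φ (n₀, h₀) ∈ (extChartAt 𝓘(ℝ, E') n').source) :
    ContDiffAt ℝ ∞ (fun x ↦ (tderiv (E := E') (E' := E') (extChartAt 𝓘(ℝ, E') n')
            (Φ ((extChartAt 𝓘(ℝ, E) n₀).symm x, h₀))).comp
          (tderiv (E := F) (E' := E') (fun h ↦ Φ ((extChartAt 𝓘(ℝ, E) n₀).symm x, h)) h₀))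
      (extChartAt 𝓘(ℝ, E) n₀ n₀) := by
  have h1 : ContDiffAt ℝ ∞ (fun x ↦ (fderiv ℝ (chartMap (E := E) (E' := E') (F := F) Φ n₀ h₀ n')
      (x, extChartAt 𝓘(ℝ, F) h₀ h₀)).comp ((ContinuousLinearMap.inr ℝ E F).comp
        (tderiv (E := F) (E' := F) (extChartAt 𝓘(ℝ, F) h₀) h₀))) (extChartAt 𝓘(ℝ, E) n₀ n₀) := by
    refine ContDiffAt.clm_comp ?_ contDiffAt_const
    have := (contDiffAt_chartMap (hΦ (n₀, h₀)) hn').fderiv_right (m := ∞) (by simp)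
    exact this.comp (f := fun x ↦ (x, extChartAt 𝓘(ℝ, F) h₀ h₀)) _
      (contDiffAt_id.prodMk contDiffAt_const)
  refine h1.congr_of_eventuallyEq ?_
  filter_upwards [eventually_fderiv_chartMap_comp_inr hΦ hn'] with x hx
  ext v
  exact (hx v).symm

/-- Smoothness at a point may be tested in the chart centered there, so only the centers of charts
matter. -/
theorem isSmoothField_of_contDiffAt_chartField {X : N → E}
    (h : ∀ a, ContDiffAt ℝ ∞ (chartField a X) (extChartAt 𝓘(ℝ, E) a a)) : IsSmoothField X := by
  intro a
  refine (Bundle.contMDiffAt_section (IB := 𝓘(ℝ, E)) (E := TangentSpace 𝓘(ℝ, E)) a).2 ?_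
  have h1 : ContMDiffAt 𝓘(ℝ, E) 𝓘(ℝ, E) ∞ (fun b ↦ chartField a X (extChartAt 𝓘(ℝ, E) a b)) a :=
    ContMDiffAt.comp a (contMDiffAt_iff_contDiffAt.2 (h a))
      (contMDiffAt_extChartAt (I := 𝓘(ℝ, E)) (x := a))
  refine h1.congr_of_eventuallyEq ?_
  filter_upwards [(isOpen_extChartAt_source (I := 𝓘(ℝ, E)) a).mem_nhds
    (mem_extChartAt_source (I := 𝓘(ℝ, E)) a)] with b hb
  have hb' := hb
  rw [extChartAt_source] at hb'
  have h3 := TangentBundle.continuousLinearMapAt_trivializationAt (I := 𝓘(ℝ, E)) hb'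
  have h4 := DFunLike.congr_fun h3 (X b)
  have h5 : chartField a X (extChartAt 𝓘(ℝ, E) a b)
      = tderiv (E := E) (E' := E) (extChartAt 𝓘(ℝ, E) a) b (X b) := by
    rw [chartField, (extChartAt 𝓘(ℝ, E) a).left_inv hb]
  rw [h5]
  refine Eq.trans ?_ h4
  exact (Bundle.Trivialization.continuousLinearMapAt_apply_of_mem (R := ℝ)
    (trivializationAt E (TangentSpace 𝓘(ℝ, E)) a) (by exact hb') _).symm

end Partial

/-! ### The second derivatives of a multiplication -/

section Calculus

variable {V : Type*} [NormedAddCommGroup V] [NormedSpace ℝ V]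

/-- The derivative of the adjoint action in terms of the second derivatives of the
multiplication `m`, where `k` is the conjugation. -/
theorem hasFDerivAt_conj_of_mul {m k : V × V → V} {e : V} (hm : ContDiffAt ℝ ∞ m (e, e))
    (hk : ContDiffAt ℝ ∞ k (e, e)) (hm1 : ∀ᶠ x in 𝓝 e, m (x, e) = x)
    (hke : ∀ᶠ x in 𝓝 e, k (x, e) = e) (hk1 : ∀ᶠ x in 𝓝 e, k (e, x) = x)
    (hmk : ∀ᶠ z in 𝓝 (e, e), m z = m (k z, z.1)) (v w : V) :
    fderiv ℝ (fun x ↦ fderiv ℝ k (x, e) (0, w)) e v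
      = fderiv ℝ (fun x ↦ fderiv ℝ m (x, e) (0, w)) e v
        - fderiv ℝ (fun x ↦ fderiv ℝ m (x, e) (0, v)) e w := by
  have hdiff : ∀ {f : V × V → V}, ContDiffAt ℝ ∞ f (e, e) →
      ∀ᶠ z in 𝓝 (e, e), DifferentiableAt ℝ f z := by
    intro f hf
    filter_upwards [(hf.of_le (m := 1) (by simp)).eventually (by simp)] with z hz
    exact hz.differentiableAt (by simp)
  have hD : ∀ {f : V × V → V}, ContDiffAt ℝ ∞ f (e, e) →
      DifferentiableAt ℝ (fderiv ℝ f) (e, e) := fun hf ↦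
    (hf.fderiv_right (m := ∞) (by simp)).differentiableAt (by simp)
  have hc1 : ContinuousAt (fun x : V ↦ (x, e)) e := by fun_prop
  have hc2 : ContinuousAt (fun x : V ↦ (e, x)) e := by fun_prop
  -- partial derivatives of the second order
  have hB : ∀ {f : V × V → V}, ContDiffAt ℝ ∞ f (e, e) → ∀ w : V,
      HasFDerivAt (fun x ↦ fderiv ℝ f (x, e) (0, w))
        (((fderiv ℝ (fderiv ℝ f) (e, e)).flip (0, w)).comp (ContinuousLinearMap.inl ℝ V V)) e := by
    intro f hf w
    have h1 : HasFDerivAt (fun z ↦ fderiv ℝ f z (0, w))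
        ((fderiv ℝ (fderiv ℝ f) (e, e)).flip (0, w)) (e, e) := by
      have := (hD hf).hasFDerivAt.clm_apply (hasFDerivAt_const ((0 : V), w) (e, e))
      simpa using this
    exact HasFDerivAt.comp (f := fun x : V ↦ (x, e)) e h1 (hasFDerivAt_prodMk_left e e)
  have hsymm : IsSymmSndFDerivAt ℝ m (e, e) :=
    hm.isSymmSndFDerivAt (by rw [minSmoothness_of_isRCLikeNormedField]; exact ENat.LEInfty.out)
  -- the relation between the partial derivatives
  have hrel : ∀ᶠ x in 𝓝 e, fderiv ℝ m (x, e) (0, w)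
      = fderiv ℝ m (e, x) (fderiv ℝ k (x, e) (0, w), 0) := by
    filter_upwards [hc1.eventually (hdiff hm), hc2.eventually (hdiff hm),
      hc1.eventually (hdiff hk), hke, hc1.eventually hmk.eventually_nhds] with x h1 h2 h3 h4 h5
    have h6 : HasFDerivAt (fun y : V ↦ m (x, y))
        ((fderiv ℝ m (x, e)).comp (ContinuousLinearMap.inr ℝ V V)) e :=
      HasFDerivAt.comp (f := fun y : V ↦ (x, y)) e h1.hasFDerivAt (hasFDerivAt_prodMk_right x e)
    have h7 : HasFDerivAt (fun y : V ↦ k (x, y))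
        ((fderiv ℝ k (x, e)).comp (ContinuousLinearMap.inr ℝ V V)) e :=
      HasFDerivAt.comp (f := fun y : V ↦ (x, y)) e h3.hasFDerivAt (hasFDerivAt_prodMk_right x e)
    have h8 : HasFDerivAt (fun y : V ↦ m (k (x, y), x))
        ((fderiv ℝ m (e, x)).comp ((ContinuousLinearMap.inl ℝ V V).comp
          ((fderiv ℝ k (x, e)).comp (ContinuousLinearMap.inr ℝ V V)))) e := by
      have h9 : HasFDerivAt (fun y : V ↦ (y, x)) (ContinuousLinearMap.inl ℝ V V) (k (x, e)) :=
        hasFDerivAt_prodMk_left _ _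
      have h10 : HasFDerivAt m (fderiv ℝ m (e, x)) (k (x, e), x) := by
        rw [h4]
        exact h2.hasFDerivAt
      exact HasFDerivAt.comp (g := m) (f := fun y : V ↦ (k (x, y), x)) e h10
        (HasFDerivAt.comp (g := fun y : V ↦ (y, x)) (f := fun y : V ↦ k (x, y)) e h9 h7)
    have hcx : ContinuousAt (fun y : V ↦ (x, y)) e := by fun_prop
    have h9 := h6.unique (h8.congr_of_eventuallyEq (hcx.eventually h5))
    exact DFunLike.congr_fun h9 w
  have hkw : fderiv ℝ k (e, e) (0, w) = w := by
    have h1 : HasFDerivAt (fun y : V ↦ k (e, y))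
        ((fderiv ℝ k (e, e)).comp (ContinuousLinearMap.inr ℝ V V)) e :=
      HasFDerivAt.comp (f := fun y : V ↦ (e, y)) e (hk.differentiableAt (by simp)).hasFDerivAt
        (hasFDerivAt_prodMk_right e e)
    exact DFunLike.congr_fun (h1.unique ((hasFDerivAt_id e).congr_of_eventuallyEq hk1)) w
  have hmw : ∀ w, fderiv ℝ m (e, e) (w, 0) = w := by
    intro w
    have h1 : HasFDerivAt (fun y : V ↦ m (y, e))
        ((fderiv ℝ m (e, e)).comp (ContinuousLinearMap.inl ℝ V V)) e :=
      HasFDerivAt.comp (f := fun y : V ↦ (y, e)) e (hm.differentiableAt (by simp)).hasFDerivAt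
        (hasFDerivAt_prodMk_left e e)
    exact DFunLike.congr_fun (h1.unique ((hasFDerivAt_id e).congr_of_eventuallyEq hm1)) w
  have hR : HasFDerivAt (fun x ↦ fderiv ℝ m (e, x) (fderiv ℝ k (x, e) (0, w), 0))
      ((fderiv ℝ m (e, e)).comp ((ContinuousLinearMap.inl ℝ V V).comp
          (fderiv ℝ (fun x ↦ fderiv ℝ k (x, e) (0, w)) e))
        + ((fderiv ℝ (fderiv ℝ m) (e, e)).comp (ContinuousLinearMap.inr ℝ V V)).flip (w, 0)) e := by
    have h1 : HasFDerivAt (fun x ↦ fderiv ℝ m (e, x))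
        ((fderiv ℝ (fderiv ℝ m) (e, e)).comp (ContinuousLinearMap.inr ℝ V V)) e :=
      HasFDerivAt.comp (f := fun x : V ↦ (e, x)) e (hD hm).hasFDerivAt
        (hasFDerivAt_prodMk_right e e)
    have h2 : HasFDerivAt (fun x ↦ (fderiv ℝ k (x, e) (0, w), (0 : V)))
        ((ContinuousLinearMap.inl ℝ V V).comp
          (fderiv ℝ (fun x ↦ fderiv ℝ k (x, e) (0, w)) e)) e :=
      HasFDerivAt.comp (g := fun y : V ↦ (y, (0 : V))) e (hasFDerivAt_prodMk_left _ _)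
        (hB hk w).differentiableAt.hasFDerivAt
    have h3 := h1.clm_apply h2
    rwa [hkw] at h3
  -- The relation `m(x, y) = m(k(x, y), x)`, differentiated in `y` along `w` and then in `x` along
  -- `v`. The unwanted term is a mixed second derivative of `m`, which symmetry turns into the
  -- subtracted one.
  have h1 := ((hB hm w).congr_of_eventuallyEq (hrel.mono fun x hx ↦ hx.symm)).unique hR
  have h2 := DFunLike.congr_fun h1 v
  rw [(hB hm w).fderiv, (hB hm v).fderiv]
  simp only [ContinuousLinearMap.comp_apply, ContinuousLinearMap.inl_apply,
    ContinuousLinearMap.flip_apply, _root_.add_apply,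
    ContinuousLinearMap.inr_apply, hmw] at h2 ⊢
  rw [h2, hsymm.eq (w, 0) (0, v), add_sub_cancel_right]

end Calculus
/-! ### The exponential map and the adjoint action of a Lie group -/

section LieGroups

open Set Metric

variable {F : Type*} [NormedAddCommGroup F] [NormedSpace ℝ F]
  {H : Type*} [TopologicalSpace H] [ChartedSpace F H] [Group H]

/-- The left invariant vector field with value `Z` at `1`. -/
def leftField (Z : F) (g : H) : F := tderiv (E := F) (E' := F) (fun a : H ↦ g * a) 1 Z

/-- The exponential map. -/
def gexp (Z : F) : H := flow (E := F) (leftField Z) 1 (1 : H)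

/-- The adjoint action as an operator on the model space. -/
def adj (g : H) : F →L[ℝ] F := tderiv (E := F) (E' := F) (fun a : H ↦ g * a * g⁻¹) 1

theorem leftField_smul (c : ℝ) (Z : F) (g : H) : leftField (c • Z) g = c • leftField Z g :=
  map_smul _ _ _

theorem leftField_one (Z : F) : leftField Z (1 : H) = Z := by
  have h : HasTDerivAt (E := F) (E' := F) (fun a : H ↦ 1 * a) 1 (ContinuousLinearMap.id ℝ F) :=
    (hasTDerivAt_id (1 : H)).congr_of_eventuallyEq (by simp; rfl)
  rw [leftField, h.tderiv_eq]
  rfl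

variable [LieGroup 𝓘(ℝ, F) ∞ H]

theorem contMDiff_mul_prod : ContMDiff (𝓘(ℝ, F).prod 𝓘(ℝ, F)) 𝓘(ℝ, F) ∞
    (fun z : H × H ↦ z.1 * z.2) := contMDiff_mul 𝓘(ℝ, F) ∞

theorem contMDiff_conj_prod : ContMDiff (𝓘(ℝ, F).prod 𝓘(ℝ, F)) 𝓘(ℝ, F) ∞
    (fun z : H × H ↦ z.1 * z.2 * z.1⁻¹) :=
  (contMDiff_fst.mul contMDiff_snd).mul (contMDiff_fst.inv)

theorem hasTDerivAt_mul_left (g a : H) : HasTDerivAt (E := F) (E' := F) (fun b : H ↦ g * b) a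
    (tderiv (E := F) (E' := F) (fun b : H ↦ g * b) a) :=
  hasTDerivAt_of_contMDiff contMDiff_mul_left

theorem hasTDerivAt_conj (g a : H) : HasTDerivAt (E := F) (E' := F) (fun b : H ↦ g * b * g⁻¹) a
    (tderiv (E := F) (E' := F) (fun b : H ↦ g * b * g⁻¹) a) :=
  hasTDerivAt_of_contMDiff ((contMDiff_const.mul contMDiff_id).mul contMDiff_const)

theorem tderiv_mul_left_leftField (a b : H) (Z : F) :
    tderiv (E := F) (E' := F) (fun c : H ↦ a * c) b (leftField Z b) = leftField Z (a * b) := by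
  have h1 : HasTDerivAt (E := F) (E' := F) (fun c : H ↦ a * c) ((fun c : H ↦ b * c) 1)
      (tderiv (E := F) (E' := F) (fun c : H ↦ a * c) b) := by
    simp only [mul_one]
    exact hasTDerivAt_mul_left a b
  have h2 := h1.comp (hasTDerivAt_mul_left b 1)
  have h3 : (fun c : H ↦ a * c) ∘ (fun c : H ↦ b * c) = fun c ↦ a * b * c := by
    funext c
    simp [mul_assoc]
  rw [h3] at h2
  exact (DFunLike.congr_fun h2.tderiv_eq Z).symm

theorem isSmoothField_leftField (Z : F) : IsSmoothField (leftField Z : H → F) := by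
  refine isSmoothField_of_contDiffAt_chartField fun a ↦ ?_
  have h := contDiffAt_tderiv_snd (n₀ := a) (h₀ := (1 : H)) (n' := a)
    (contMDiff_mul_prod (F := F) (H := H)) (by simp)
  have h1 := h.clm_apply (contDiffAt_const (c := Z))
  refine h1.congr_of_eventuallyEq (Filter.Eventually.of_forall fun x ↦ ?_)
  simp only [chartField, mul_one]
  rfl

variable [FiniteDimensional ℝ F] [T2Space H]

/-- Left invariant fields are complete: left translates of the local solution through `1` solve the
equation for the same time `ε` at every point, and a uniform existence time gives global curves. -/
theorem exists_oneParam (Z : F) :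
    ∃ γ : ℝ → H, γ 0 = 1 ∧ ∀ t, HasVelocityAt γ t (leftField Z (γ t)) := by
  obtain ⟨ρ, hρ, g, -, hg0, -, hg⟩ := exists_contMDiffOn_timeOne
    (F := F) (fun b : H ↦ (tderiv (E := F) (E' := F) (fun a : H ↦ b * a) 1).toLinearMap)
    (fun Y ↦ isSmoothField_leftField Y) 1
  obtain ⟨ε, hε, hεZ⟩ : ∃ ε : ℝ, 0 < ε ∧ ∀ s ∈ Ioo (-ε) ε, s • Z ∈ ball (0 : F) ρ := by
    refine ⟨ρ / (‖Z‖ + 1), by positivity, fun s hs ↦ ?_⟩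
    rw [mem_ball_zero_iff, norm_smul, Real.norm_eq_abs]
    have h1 : |s| < ρ / (‖Z‖ + 1) := abs_lt.2 hs
    calc |s| * ‖Z‖ ≤ |s| * (‖Z‖ + 1) := by gcongr; linarith
      _ < ρ := by rwa [lt_div_iff₀ (by positivity)] at h1
  obtain ⟨γ, h0, hγ⟩ := exists_isMIntegralCurve_of_isMIntegralCurveOn
    ((isSmoothField_leftField (H := H) Z).of_le (by exact_mod_cast le_top)) hε (fun a ↦ by
    refine ⟨fun s ↦ a * g (s • Z), by simp [hg0], HasVelocityAt.isMIntegralCurveOn (X := leftField Z)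
      fun s hs ↦ ?_⟩
    have h1 := (hasTDerivAt_mul_left a (g (s • Z))).hasVelocityAt_comp
      (γ := fun s ↦ g (s • Z)) (hg Z s (hεZ s hs))
    have h2 := tderiv_mul_left_leftField a (g (s • Z)) Z
    rw [← h2]
    exact h1) 1
  exact ⟨γ, h0, hγ⟩

theorem exists_oneParam_gexp (Z : F) :
    ∃ γ : ℝ → H, γ 0 = 1 ∧ (∀ t, HasVelocityAt γ t (leftField Z (γ t))) ∧
      ∀ t, gexp (t • Z) = γ t := by
  obtain ⟨γ, h0, hγ⟩ := exists_oneParam (H := H) Z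
  refine ⟨γ, h0, hγ, fun t ↦ ?_⟩
  have h1 : ∀ s, HasVelocityAt (fun s ↦ γ (t * s)) s (leftField (t • Z) (γ (t * s))) := by
    intro s
    rw [leftField_smul]
    have h := (hγ (t * s)).scomp (c := fun s ↦ t * s) (c' := t)
      (by simpa using (hasDerivAt_id s).const_mul t)
    exact h
  have h2 := (flow_eq_of_forall_hasVelocityAt (isSmoothField_leftField (t • Z)) h1 1).2
  simp only [mul_zero, h0, mul_one] at h2
  exact h2

theorem hasVelocityAt_gexp (Z : F) (t : ℝ) :
    HasVelocityAt (fun t ↦ (gexp (t • Z) : H)) t (leftField Z (gexp (t • Z) : H)) := by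
  obtain ⟨γ, -, hγ, h⟩ := exists_oneParam_gexp (H := H) Z
  simp only [h]
  exact hγ t

theorem gexp_zero : (gexp (0 : F) : H) = 1 := by
  obtain ⟨γ, h0, -, h⟩ := exists_oneParam_gexp (H := H) (0 : F)
  have := h 0
  rwa [zero_smul, h0] at this

theorem eq_gexp_of_hasVelocityAt {Z : F} {γ : ℝ → H} (h0 : γ 0 = 1)
    (hγ : ∀ t, HasVelocityAt γ t (leftField Z (γ t))) (t : ℝ) : γ t = gexp (t • Z) := by
  have := eq_of_hasVelocityAt (isSmoothField_leftField Z) hγ (hasVelocityAt_gexp Z) (t₀ := 0)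
    (by rw [h0, zero_smul, gexp_zero])
  exact congrFun this t

theorem gexp_add_smul (Z : F) (s t : ℝ) :
    (gexp ((s + t) • Z) : H) = gexp (s • Z) * gexp (t • Z) := by
  have h1 : ∀ t, HasVelocityAt (fun t ↦ (gexp ((s + t) • Z) : H)) t
      (leftField Z (gexp ((s + t) • Z) : H)) := by
    intro t
    have h := (hasVelocityAt_gexp (H := H) Z (s + t)).scomp (c := fun t ↦ s + t) (c' := 1)
      ((hasDerivAt_id t).const_add s)
    rwa [one_smul] at h
  have h2 : ∀ t, HasVelocityAt (fun t ↦ (gexp (s • Z) * gexp (t • Z) : H)) t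
      (leftField Z (gexp (s • Z) * gexp (t • Z) : H)) := by
    intro t
    rw [← tderiv_mul_left_leftField]
    exact (hasTDerivAt_mul_left _ _).hasVelocityAt_comp (hasVelocityAt_gexp (H := H) Z t)
  exact congrFun (eq_of_hasVelocityAt (isSmoothField_leftField Z) h1 h2 (t₀ := 0)
    (by simp [gexp_zero])) t

theorem gexp_neg (Z : F) : (gexp (-Z) : H) = (gexp Z)⁻¹ := by
  have h := gexp_add_smul (H := H) Z (-1) 1
  rw [neg_add_cancel, zero_smul, gexp_zero, neg_one_smul, one_smul] at h
  exact eq_inv_of_mul_eq_one_left h.symm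

theorem gexp_nsmul (Z : F) (n : ℕ) : (gexp (n • Z) : H) = gexp Z ^ n := by
  induction n with
  | zero => simp [gexp_zero]
  | succ n ih =>
    rw [pow_succ, ← ih, ← Nat.cast_smul_eq_nsmul ℝ, ← Nat.cast_smul_eq_nsmul ℝ, Nat.cast_succ,
      gexp_add_smul, one_smul]

/-- Near `0` this is smooth dependence on parameters. Elsewhere `exp(Y) = exp(Y/n)^n` with `Y/n`
near `0`. -/
theorem contMDiff_gexp : ContMDiff 𝓘(ℝ, F) 𝓘(ℝ, F) ∞ (gexp : F → H) := by
  obtain ⟨ρ, hρ, g, hsm, hg0, -, hg⟩ := exists_contMDiffOn_timeOne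
    (F := F) (fun b : H ↦ (tderiv (E := F) (E' := F) (fun a : H ↦ b * a) 1).toLinearMap)
    (fun Y ↦ isSmoothField_leftField Y) 1
  have heq : ∀ Y ∈ ball (0 : F) ρ, gexp Y = g Y := by
    intro Y hY
    rw [← (flow_one_eq_of_hasVelocityAt (isSmoothField_leftField Y) hY (hg Y)).2, hg0]
    rfl
  have hball : ContMDiffOn 𝓘(ℝ, F) 𝓘(ℝ, F) ∞ (gexp : F → H) (ball 0 ρ) := hsm.congr heq
  intro Y
  obtain ⟨n, hn⟩ := exists_nat_gt (‖Y‖ / ρ)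
  have hn0 : (0 : ℝ) < n := lt_of_le_of_lt (by positivity) hn
  have hY : (n : ℝ)⁻¹ • Y ∈ ball (0 : F) ρ := by
    rw [mem_ball_zero_iff, norm_smul, norm_inv, Real.norm_of_nonneg hn0.le, inv_mul_lt_iff₀ hn0]
    rwa [div_lt_iff₀ hρ] at hn
  have h1 : ContMDiffAt 𝓘(ℝ, F) 𝓘(ℝ, F) ∞ (fun Y : F ↦ (gexp ((n : ℝ)⁻¹ • Y) : H)) Y :=
    ContMDiffAt.comp (f := fun Y : F ↦ (n : ℝ)⁻¹ • Y) Y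
      (hball.contMDiffAt (isOpen_ball.mem_nhds hY)) (contDiff_const_smul _).contMDiff.contMDiffAt
  have h2 : (gexp : F → H) = fun Y ↦ (gexp ((n : ℝ)⁻¹ • Y) : H) ^ n := by
    funext Y
    rw [← gexp_nsmul, ← Nat.cast_smul_eq_nsmul ℝ, smul_smul, mul_inv_cancel₀ hn0.ne', one_smul]
  rw [h2]
  exact (contMDiff_pow n).contMDiffAt.comp Y h1

end LieGroups

/-! ### Conjugation in a Lie group -/

section Conj

/-- Conjugation as a homomorphism. -/
def conjHom {H : Type*} [Group H] (g : H) : H →* H := (MulAut.conj g).toMonoidHom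

theorem conjHom_apply {H : Type*} [Group H] (g a : H) : conjHom g a = g * a * g⁻¹ := rfl

variable {F : Type*} [NormedAddCommGroup F] [NormedSpace ℝ F]
  {H : Type*} [TopologicalSpace H] [ChartedSpace F H] [Group H]

theorem adj_one (Z : F) : adj (1 : H) Z = Z := Ad_one (G := H) (EG := F) Z

end Conj

/-! ### Smooth homomorphisms, the exponential map and the adjoint action -/

section Homs

variable {F F' : Type*} [NormedAddCommGroup F] [NormedSpace ℝ F]
  [NormedAddCommGroup F'] [NormedSpace ℝ F']
  {H H' : Type*} [TopologicalSpace H] [ChartedSpace F H] [Group H] [LieGroup 𝓘(ℝ, F) ∞ H]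
  [TopologicalSpace H'] [ChartedSpace F' H'] [Group H'] [LieGroup 𝓘(ℝ, F') ∞ H']

theorem tderiv_hom_leftField (f : H →* H') (hf : ContMDiff 𝓘(ℝ, F) 𝓘(ℝ, F') ∞ f) (g : H) (Z : F) :
    tderiv (E := F) (E' := F') f g (leftField Z g)
      = leftField (tderiv (E := F) (E' := F') f 1 Z) (f g) := by
  have h1 : HasTDerivAt (E := F) (E' := F') f ((fun a : H ↦ g * a) 1)
      (tderiv (E := F) (E' := F') f g) := by
    simp only [mul_one]
    exact hasTDerivAt_of_contMDiff hf
  have h2 := h1.comp (hasTDerivAt_mul_left g 1)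
  have h3 : HasTDerivAt (E := F') (E' := F') (fun a : H' ↦ f g * a) (f 1)
      (tderiv (E := F') (E' := F') (fun a : H' ↦ f g * a) 1) := by
    rw [map_one]
    exact hasTDerivAt_mul_left _ _
  have h4 := h3.comp (hasTDerivAt_of_contMDiff hf (a := 1))
  have h5 : (f : H → H') ∘ (fun a : H ↦ g * a) = (fun a : H' ↦ f g * a) ∘ f := by
    funext a
    simp
  rw [h5] at h2
  exact DFunLike.congr_fun (h2.unique h4) Z

/-- The image of a one-parameter group is an integral curve of the left invariant field of the image
vector. Applied below to conjugations and to the inclusion of `P` into `G`. -/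
theorem hom_gexp [FiniteDimensional ℝ F] [FiniteDimensional ℝ F'] [T2Space H] [T2Space H']
    (f : H →* H') (hf : ContMDiff 𝓘(ℝ, F) 𝓘(ℝ, F') ∞ f)
    (Z : F) : f (gexp Z) = gexp (tderiv (E := F) (E' := F') f 1 Z) := by
  have h := eq_gexp_of_hasVelocityAt (H := H') (Z := tderiv (E := F) (E' := F') f 1 Z)
    (γ := fun t ↦ f (gexp (t • Z))) (by simp [gexp_zero]) (fun t ↦ by
      rw [← tderiv_hom_leftField f hf]
      exact (hasTDerivAt_of_contMDiff hf).hasVelocityAt_comp (hasVelocityAt_gexp (H := H) Z t)) 1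
  simpa using h

theorem contMDiff_conjHom (g : H) : ContMDiff 𝓘(ℝ, F) 𝓘(ℝ, F) ∞ (conjHom g) :=
  (contMDiff_const.mul contMDiff_id).mul contMDiff_const

theorem conj_gexp [FiniteDimensional ℝ F] [T2Space H] (g : H) (Z : F) : g * gexp Z * g⁻¹ = gexp (adj g Z) :=
  hom_gexp (conjHom g) (contMDiff_conjHom g) Z

theorem hom_adj (f : H →* H') (hf : ContMDiff 𝓘(ℝ, F) 𝓘(ℝ, F') ∞ f) (g : H) (Z : F) :
    tderiv (E := F) (E' := F') f 1 (adj g Z)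
      = adj (f g) (tderiv (E := F) (E' := F') f 1 Z) := by
  have h1 : HasTDerivAt (E := F) (E' := F') f (conjHom g 1)
      (tderiv (E := F) (E' := F') f 1) := by
    rw [map_one]
    exact hasTDerivAt_of_contMDiff hf
  have h2 := h1.comp (hasTDerivAt_of_contMDiff (contMDiff_conjHom g) (a := 1))
  have h3 : HasTDerivAt (E := F') (E' := F') (conjHom (f g)) (f 1)
      (tderiv (E := F') (E' := F') (conjHom (f g)) 1) := by
    rw [map_one]
    exact hasTDerivAt_of_contMDiff (contMDiff_conjHom _)
  have h4 := h3.comp (hasTDerivAt_of_contMDiff hf (a := 1))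
  have h5 : (f : H → H') ∘ (conjHom g) = (conjHom (f g)) ∘ f := by
    funext a
    simp [conjHom_apply]
  rw [h5] at h2
  exact DFunLike.congr_fun (h2.unique h4) Z

theorem adj_mul (g h : H) (Z : F) : adj (g * h) Z = adj g (adj h Z) :=
  Ad_mul (G := H) (EG := F) g h Z

theorem adj_inv_adj (g : H) (Z : F) : adj g⁻¹ (adj g Z) = Z := by
  rw [← adj_mul, inv_mul_cancel, adj_one]

theorem adj_adj_inv (g : H) (Z : F) : adj g (adj g⁻¹ Z) = Z := by
  rw [← adj_mul, mul_inv_cancel, adj_one]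

end Homs
/-! ### The differential of the adjoint action -/

section Adjoint

open Set Metric

variable {F : Type*} [NormedAddCommGroup F] [NormedSpace ℝ F]
  {H : Type*} [TopologicalSpace H] [ChartedSpace F H] [Group H] [LieGroup 𝓘(ℝ, F) ∞ H]

/-- `adj` is the partial derivative at `1` of the conjugation in its second variable. All
conjugations fix `1`, so the chart at `1` serves as the target chart throughout and is removed by a
constant linear map. -/
theorem contMDiff_adj : ContMDiff 𝓘(ℝ, F) 𝓘(ℝ, F →L[ℝ] F) ∞ (adj : H → F →L[ℝ] F) := by
  intro g
  set φ := extChartAt 𝓘(ℝ, F) (1 : H)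
  have h := contDiffAt_tderiv_snd (n₀ := g) (h₀ := (1 : H)) (n' := (1 : H))
    (contMDiff_conj_prod (F := F) (H := H)) (by simp)
  have h1 := (contDiffAt_const (c := tderiv (E := F) (E' := F) φ.symm (φ 1))).clm_comp h
  have h2 : ContDiffAt ℝ ∞ (fun x ↦ (adj ((extChartAt 𝓘(ℝ, F) g).symm x) : F →L[ℝ] F))
      (extChartAt 𝓘(ℝ, F) g g) := by
    refine h1.congr_of_eventuallyEq (Filter.Eventually.of_forall fun x ↦ ?_)
    ext v
    simp only [mul_one, mul_inv_cancel, ContinuousLinearMap.comp_apply]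
    exact (tderiv_extChartAt_symm_comp (mem_extChartAt_source (1 : H)) _).symm
  have h3 : ContMDiffAt 𝓘(ℝ, F) 𝓘(ℝ, F →L[ℝ] F) ∞
      (fun b ↦ (adj ((extChartAt 𝓘(ℝ, F) g).symm (extChartAt 𝓘(ℝ, F) g b)) : F →L[ℝ] F)) g :=
    ContMDiffAt.comp g (contMDiffAt_iff_contDiffAt.2 h2)
      (contMDiffAt_extChartAt (I := 𝓘(ℝ, F)) (x := g))
  refine h3.congr_of_eventuallyEq ?_
  filter_upwards [(isOpen_extChartAt_source (I := 𝓘(ℝ, F)) g).mem_nhds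
    (mem_extChartAt_source (I := 𝓘(ℝ, F)) g)] with b hb
  rw [(extChartAt 𝓘(ℝ, F) g).left_inv hb]

variable (H) in
/-- The Lie bracket on the model space `F`, which is the tangent space of `H` at `1`. -/
def lieBr (X Y : F) : F := bracketField (leftField X) (leftField Y) (1 : H)

variable [FiniteDimensional ℝ F] [T2Space H]

/-- In the chart at `1` the bracket of two left invariant fields is the antisymmetrized second
derivative of the multiplication. By `hasFDerivAt_conj_of_mul` this is the derivative at `1` of `g ↦
Ad(g)Y`. -/
theorem hasDerivAt_adj_gexp_zero (A Y : F) :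
    HasDerivAt (fun t : ℝ ↦ adj (gexp (t • A) : H) Y) (lieBr H A Y) 0 := by
  set φ := extChartAt 𝓘(ℝ, F) (1 : H) with hφ
  set e := φ 1
  have hone : φ.symm e = 1 := extChartAt_to_inv 1
  have htar : ∀ᶠ x in 𝓝 e, x ∈ φ.target :=
    (isOpen_extChartAt_target (1 : H)).mem_nhds (mem_extChartAt_target _)
  let m : F × F → F := chartMap (E := F) (E' := F) (F := F) (fun z : H × H ↦ z.1 * z.2) 1 1 1
  let k : F × F → F :=
    chartMap (E := F) (E' := F) (F := F) (fun z : H × H ↦ z.1 * z.2 * z.1⁻¹) 1 1 1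
  have hm : ContDiffAt ℝ ∞ m (e, e) := contDiffAt_chartMap (contMDiff_mul_prod _) (by simp)
  have hk : ContDiffAt ℝ ∞ k (e, e) := contDiffAt_chartMap (contMDiff_conj_prod _) (by simp)
  have hmr : ∀ x z, m (x, z) = φ (φ.symm x * φ.symm z) := fun _ _ ↦ rfl
  have hkr : ∀ x z, k (x, z) = φ (φ.symm x * φ.symm z * (φ.symm x)⁻¹) := fun _ _ ↦ rfl
  have hm1 : ∀ᶠ x in 𝓝 e, m (x, e) = x := by
    filter_upwards [htar] with x hx
    rw [hmr, hone, mul_one, φ.right_inv hx]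
  have hke : ∀ᶠ x in 𝓝 e, k (x, e) = e := Filter.Eventually.of_forall fun x ↦ by
    rw [hkr, hone, mul_one, mul_inv_cancel]
  have hk1 : ∀ᶠ x in 𝓝 e, k (e, x) = x := by
    filter_upwards [htar] with x hx
    rw [hkr, hone, one_mul, inv_one, mul_one, φ.right_inv hx]
  have hmk : ∀ᶠ z in 𝓝 (e, e), m z = m (k z, z.1) := by
    have hc : ContinuousAt (fun z : F × F ↦ φ.symm z.1 * φ.symm z.2 * (φ.symm z.1)⁻¹) (e, e) := by
      have h1 : ContinuousAt φ.symm e := continuousAt_extChartAt_symm 1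
      have h2 : ContinuousAt (fun z : F × F ↦ φ.symm z.1) (e, e) :=
        ContinuousAt.comp (f := Prod.fst) h1 continuousAt_fst
      have h3 : ContinuousAt (fun z : F × F ↦ φ.symm z.2) (e, e) :=
        ContinuousAt.comp (f := Prod.snd) h1 continuousAt_snd
      have h4 : Continuous (fun z : H × H ↦ z.1 * z.2 * z.1⁻¹) :=
        (contMDiff_conj_prod (F := F) (H := H)).continuous
      exact h4.continuousAt.comp (f := fun z : F × F ↦ (φ.symm z.1, φ.symm z.2)) (h2.prodMk h3)
    have h5 := hc.preimage_mem_nhds ((isOpen_extChartAt_source (I := 𝓘(ℝ, F)) (1 : H)).mem_nhds (by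
      change φ.symm e * φ.symm e * (φ.symm e)⁻¹ ∈ _
      simp [hone]))
    filter_upwards [h5] with z hz
    have h6 : φ.symm (k z) = φ.symm z.1 * φ.symm z.2 * (φ.symm z.1)⁻¹ := φ.left_inv hz
    rw [show m (k z, z.1) = φ (φ.symm (k z) * φ.symm z.1) from rfl, h6, inv_mul_cancel_right]
    rfl
  set v := tderiv (E := F) (E' := F) φ (1 : H) A
  set w := tderiv (E := F) (E' := F) φ (1 : H) Y
  have hcf : ∀ Z : F, (fun x ↦ fderiv ℝ m (x, e) (0, tderiv (E := F) (E' := F) φ (1 : H) Z))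
      =ᶠ[𝓝 e] chartField 1 (leftField Z : H → F) := by
    intro Z
    filter_upwards [eventually_fderiv_chartMap_comp_inr (n₀ := (1 : H)) (h₀ := (1 : H))
      (n' := (1 : H)) (contMDiff_mul_prod (F := F) (H := H)) (by simp)] with x hx
    refine (hx Z).trans ?_
    simp only [mul_one]
    rfl
  have hkf : (fun x ↦ fderiv ℝ k (x, e) (0, w))
      =ᶠ[𝓝 e] fun x ↦ tderiv (E := F) (E' := F) φ (1 : H) (adj (φ.symm x) Y) := by
    filter_upwards [eventually_fderiv_chartMap_comp_inr (n₀ := (1 : H)) (h₀ := (1 : H))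
      (n' := (1 : H)) (contMDiff_conj_prod (F := F) (H := H)) (by simp)] with x hx
    refine (hx Y).trans ?_
    simp only [mul_one, mul_inv_cancel]
    rfl
  have hval : ∀ Z : F, chartField 1 (leftField Z : H → F) e
      = tderiv (E := F) (E' := F) φ (1 : H) Z := by
    intro Z
    change tderiv (E := F) (E' := F) φ (φ.symm e) (leftField Z (φ.symm e)) = _
    rw [hone, leftField_one]
  have hbr := chartField_bracketField (isSmoothField_leftField (H := H) A)
    (isSmoothField_leftField Y) 1 (mem_extChartAt_target (1 : H))
  have hbr' : chartField 1 (bracketField (leftField A : H → F) (leftField Y)) e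
      = tderiv (E := F) (E' := F) φ (1 : H) (lieBr H A Y) := by
    change tderiv (E := F) (E' := F) φ (φ.symm e) (bracketField _ _ (φ.symm e)) = _
    rw [hone]
    rfl
  have hmain := hasFDerivAt_conj_of_mul hm hk hm1 hke hk1 hmk v w
  rw [(hcf Y).fderiv_eq, (hcf A).fderiv_eq, hkf.fderiv_eq] at hmain
  have hval' : ∀ Z : F, chartField 1 (leftField Z : H → F) (extChartAt 𝓘(ℝ, F) (1 : H) 1)
      = tderiv (E := F) (E' := F) φ (1 : H) Z := hval
  rw [hval' A, hval' Y] at hbr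
  have hmain' : fderiv ℝ (fun x ↦ tderiv (E := F) (E' := F) φ (1 : H) (adj (φ.symm x) Y)) e v
      = tderiv (E := F) (E' := F) φ (1 : H) (lieBr H A Y) := hmain.trans (hbr.symm.trans hbr')
  -- along the one-parameter group
  have hdiff : DifferentiableAt ℝ
      (fun x ↦ tderiv (E := F) (E' := F) φ (1 : H) (adj (φ.symm x) Y)) e := by
    have h1 : ContMDiffAt 𝓘(ℝ, F) 𝓘(ℝ, F →L[ℝ] F) ∞ (fun x ↦ (adj (φ.symm x) : F →L[ℝ] F)) e :=
      (contMDiff_adj.contMDiffAt).comp e ((contMDiffOn_extChartAt_symm (1 : H)).contMDiffAt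
        ((isOpen_extChartAt_target (1 : H)).mem_nhds (mem_extChartAt_target _)))
    have h2 := (contMDiffAt_iff_contDiffAt.1 h1).differentiableAt (by simp)
    have h3 : DifferentiableAt ℝ (fun x ↦ (adj (φ.symm x) : F →L[ℝ] F) Y) e :=
      h2.clm_apply (differentiableAt_const Y)
    exact (ContinuousLinearMap.differentiableAt
      (tderiv (E := F) (E' := F) φ (1 : H) : F →L[ℝ] F)).comp e h3
  have hg0 : (gexp ((0 : ℝ) • A) : H) = 1 := by rw [zero_smul, gexp_zero]
  have hcurve : HasDerivAt (fun t : ℝ ↦ φ (gexp (t • A) : H)) v 0 := by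
    have h1 := hasDerivAt_extChartAt_comp (a := (1 : H)) (γ := fun t : ℝ ↦ (gexp (t • A) : H))
      (s := 0) (by rw [hg0]; exact mem_extChartAt_source _) (hasVelocityAt_gexp A 0)
    rw [hg0, leftField_one] at h1
    exact h1
  have hcomp : HasDerivAt (fun t : ℝ ↦ tderiv (E := F) (E' := F) φ (1 : H)
      (adj (φ.symm (φ (gexp (t • A) : H))) Y))
      (tderiv (E := F) (E' := F) φ (1 : H) (lieBr H A Y)) 0 := by
    rw [← hmain']
    have h5 : HasFDerivAt (fun x ↦ tderiv (E := F) (E' := F) φ (1 : H) (adj (φ.symm x) Y))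
        (fderiv ℝ (fun x ↦ tderiv (E := F) (E' := F) φ (1 : H) (adj (φ.symm x) Y)) e)
        (φ (gexp ((0 : ℝ) • A) : H)) := by
      rw [hg0]
      exact hdiff.hasFDerivAt
    exact h5.comp_hasDerivAt (f := fun t : ℝ ↦ φ (gexp (t • A) : H)) 0 hcurve
  have hfin := (ContinuousLinearMap.hasFDerivAt
    (tderiv (E := F) (E' := F) φ.symm e : F →L[ℝ] F)).comp_hasDerivAt 0 hcomp
  have hinv : ∀ Z, tderiv (E := F) (E' := F) φ.symm e (tderiv (E := F) (E' := F) φ (1 : H) Z) = Z :=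
    tderiv_extChartAt_symm_comp (mem_extChartAt_source (1 : H))
  simp only [Function.comp_def, hinv] at hfin
  refine hfin.congr_of_eventuallyEq ?_
  have hcont : ContinuousAt (fun t : ℝ ↦ (gexp (t • A) : H)) 0 :=
    (hasVelocityAt_gexp A 0).continuousAt
  filter_upwards [hcont.preimage_mem_nhds ((isOpen_extChartAt_source (I := 𝓘(ℝ, F)) (1 : H)).mem_nhds
    (by rw [hg0]; exact mem_extChartAt_source _))] with t ht
  rw [φ.left_inv ht]

theorem hasDerivAt_adj_gexp (A Y : F) (t : ℝ) :
    HasDerivAt (fun t : ℝ ↦ adj (gexp (t • A) : H) Y) (lieBr H A (adj (gexp (t • A) : H) Y)) t := by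
  have h := hasDerivAt_adj_gexp_zero (H := H) A (adj (gexp (t • A) : H) Y)
  rw [← sub_self t] at h
  refine (h.comp_sub_const t t).congr_of_eventuallyEq (Filter.Eventually.of_forall fun s ↦ ?_)
  simp only
  rw [← adj_mul, ← gexp_add_smul, sub_add_cancel]

/-- Differentiate `Ad(g) Ad(exp(tX)) = Ad(exp(t Ad(g)X)) Ad(g)` at `t = 0`. -/
theorem adj_lieBr (g : H) (X Y : F) : adj g (lieBr H X Y) = lieBr H (adj g X) (adj g Y) := by
  have h1 := (adj g : F →L[ℝ] F).hasFDerivAt.comp_hasDerivAt 0 (hasDerivAt_adj_gexp_zero (H := H) X Y)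
  have h2 := hasDerivAt_adj_gexp_zero (H := H) (adj g X) (adj g Y)
  refine h1.unique (h2.congr_of_eventuallyEq (Filter.Eventually.of_forall fun t ↦ ?_))
  simp only [Function.comp_apply]
  rw [← map_smul, ← conj_gexp, adj_mul, adj_mul, adj_inv_adj]

end Adjoint

/-! ### The adjoint action of one-parameter groups -/

section Exp

variable {F : Type*} [NormedAddCommGroup F] [NormedSpace ℝ F] [FiniteDimensional ℝ F]

/-- The terms of the exponential series from the second order on lie in `S`, and a
finite-dimensional subspace is closed. -/
theorem exp_apply_sub_mem (T : F →L[ℝ] F) (S : Submodule ℝ F) (hS : ∀ y ∈ S, T y ∈ S) (x : F)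
    (hx : T (T x) ∈ S) : NormedSpace.exp T x - x - T x ∈ S := by
  have h1 := NormedSpace.exp_series_hasSum_exp' (𝕂 := ℝ) T
  have h2 : HasSum (fun n : ℕ ↦ (n.factorial : ℝ)⁻¹ • (T ^ n) x) (NormedSpace.exp T x) := by
    have := ContinuousLinearMap.hasSum (ContinuousLinearMap.apply ℝ F x) h1
    exact this
  have h3 := (hasSum_nat_add_iff' 2).2 h2
  have h4 : ∑ i ∈ Finset.range 2, ((i.factorial : ℝ)⁻¹ • (T ^ i) x) = x + T x := by
    rw [Finset.sum_range_succ, Finset.sum_range_one, pow_zero, pow_one]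
    norm_num
  have hpow : ∀ n : ℕ, (T ^ (n + 2)) x ∈ S := by
    intro n
    induction n with
    | zero =>
      rw [zero_add, pow_two]
      exact hx
    | succ n ih =>
      rw [show n + 1 + 2 = (n + 2) + 1 from rfl, pow_succ']
      exact hS _ ih
  rw [h4] at h3
  rw [sub_sub]
  have hcl : IsClosed (S : Set F) := S.closed_of_finiteDimensional
  have h5 : ∀ s : Finset ℕ, ∑ n ∈ s, ((n + 2).factorial : ℝ)⁻¹ • (T ^ (n + 2)) x ∈ (S : Set F) :=
    fun s ↦ S.sum_mem fun n _ ↦ S.smul_mem _ (hpow n)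
  have h6 : Filter.Tendsto (fun s : Finset ℕ ↦ ∑ n ∈ s, ((n + 2).factorial : ℝ)⁻¹ • (T ^ (n + 2)) x)
      Filter.atTop (𝓝 (NormedSpace.exp T x - (x + T x))) := h3
  exact hcl.mem_of_tendsto h6 (Filter.Eventually.of_forall h5)

variable {H : Type*} [TopologicalSpace H] [ChartedSpace F H] [Group H] [LieGroup 𝓘(ℝ, F) ∞ H]

variable (H) in
/-- The operator `ad A` on the model space. -/
def adL (A : F) : F →L[ℝ] F :=
  LinearMap.toContinuousLinearMap
    (show F →ₗ[ℝ] F from LieAlgebra.ad ℝ (GroupLieAlgebra 𝓘(ℝ, F) H) A)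

variable [T2Space H]

/-- Along `tA` both sides solve `y' = ad(A) y` with `y(0) = Y`. -/
theorem adj_gexp (A Y : F) : adj (gexp A : H) Y = NormedSpace.exp (adL H A) Y := by
  have h1 : ∀ t : ℝ, HasDerivAt (fun t : ℝ ↦ NormedSpace.exp (t • adL H A) Y)
      (adL H A (NormedSpace.exp (t • adL H A) Y)) t := by
    intro t
    have := (hasDerivAt_exp_smul_const' (𝕂 := ℝ) (adL H A) t).clm_apply (hasDerivAt_const t Y)
    simpa using this
  have h2 := ODE_solution_unique_of_mem_Ioo (a := -1) (b := 2) (t₀ := 0)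
    (v := fun _ y ↦ adL H A y) (s := fun _ ↦ Set.univ) (K := ‖adL H A‖₊)
    (f := fun t : ℝ ↦ adj (gexp (t • A) : H) Y)
    (g := fun t : ℝ ↦ NormedSpace.exp (t • adL H A) Y)
    (fun t _ ↦ (adL H A).lipschitz.lipschitzOnWith) (by norm_num)
    (fun t _ ↦ ⟨hasDerivAt_adj_gexp A Y t, trivial⟩) (fun t _ ↦ ⟨h1 t, trivial⟩)
    (by simp [gexp_zero, adj_one])
  have h3 := h2 (show (1 : ℝ) ∈ Set.Ioo (-1 : ℝ) 2 by norm_num)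
  simpa using h3

theorem adj_gexp_sub_mem (A : F) (S : Submodule ℝ F) (hS : ∀ y ∈ S, lieBr H A y ∈ S) (x : F)
    (hx : lieBr H A (lieBr H A x) ∈ S) : adj (gexp A : H) x - x - lieBr H A x ∈ S := by
  rw [adj_gexp]
  exact exp_apply_sub_mem _ S hS x hx

/-- The adjoint action of `g` as an automorphism of the Lie algebra. -/
def adEquiv (g : H) : GroupLieAlgebra 𝓘(ℝ, F) H ≃ₗ⁅ℝ⁆ GroupLieAlgebra 𝓘(ℝ, F) H where
  toFun := Ad g
  invFun := Ad g⁻¹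
  left_inv := fun Y ↦ adj_inv_adj (F := F) g Y
  right_inv := fun Y ↦ adj_adj_inv (F := F) g Y
  map_add' := fun X Y ↦ map_add (Ad g) X Y
  map_smul' := fun c Y ↦ map_smul (Ad g) c Y
  map_lie' := fun {X Y} ↦ adj_lieBr (F := F) g X Y

end Exp
/-! ### The structure of parabolic subgroups -/

section Subgroups

set_option linter.unusedSectionVars false

open Set

variable {EG : Type*} [NormedAddCommGroup EG] [NormedSpace ℝ EG] [FiniteDimensional ℝ EG]
  {EP : Type*} [NormedAddCommGroup EP] [NormedSpace ℝ EP] [FiniteDimensional ℝ EP]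
  {G : Type*} [TopologicalSpace G] [T2Space G] [ChartedSpace EG G] [Group G]
  [LieGroup 𝓘(ℝ, EG) ∞ G]
  {P : Subgroup G} [ChartedSpace EP P] [LieGroup 𝓘(ℝ, EP) ∞ P]
  {gr : Grading (GroupLieAlgebra 𝓘(ℝ, EG) G)}

instance finiteDimensional_groupLieAlgebra {E : Type*} [NormedAddCommGroup E] [NormedSpace ℝ E]
    [FiniteDimensional ℝ E] {H : Type*} [TopologicalSpace H] [ChartedSpace E H] [Group H] :
    Module.Finite ℝ (GroupLieAlgebra 𝓘(ℝ, E) H) :=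
  inferInstanceAs (Module.Finite ℝ E)

theorem IsParabolicPair.isKilling (hP : IsParabolicPair (EP := EP) P gr) :
    LieAlgebra.IsKilling ℝ (GroupLieAlgebra 𝓘(ℝ, EG) G) := by
  have := hP.isSemisimple
  infer_instance

variable (EG EP P) in
/-- The inclusion of Lie algebras as a map between the model spaces. -/
def incl : EP →L[ℝ] EG := tderiv (E := EP) (E' := EG) (fun p : P ↦ (p : G)) 1

theorem incl_adj (hP : IsClosedLieSubgroup (EG := EG) (EP := EP) P) (p : P) (Z : EP) :
    incl EG EP P (adj p Z) = adj (p : G) (incl EG EP P Z) :=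
  hom_adj P.subtype hP.contMDiff_coe p Z

theorem coe_gexp (hP : IsClosedLieSubgroup (EG := EG) (EP := EP) P) (Z : EP) :
    ((gexp Z : P) : G) = gexp (incl EG EP P Z) :=
  hom_gexp P.subtype hP.contMDiff_coe Z

theorem incl_mem_nonneg (hP : IsParabolicPair (EP := EP) P gr) (Z : EP) :
    incl EG EP P Z ∈ gr.nonneg := by
  rw [← hP.lieAlgebra_eq]
  exact ⟨Z, rfl⟩

theorem exists_incl_eq (hP : IsParabolicPair (EP := EP) P gr) {Y : EG} (hY : Y ∈ gr.nonneg) :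
    ∃ Z, incl EG EP P Z = Y := by
  rw [← hP.lieAlgebra_eq] at hY
  obtain ⟨Z, hZ⟩ := hY
  exact ⟨Z, hZ⟩

/-- A linear left inverse of the inclusion of Lie algebras. -/
theorem exists_incl_leftInverse (hP : IsParabolicPair (EP := EP) P gr) :
    ∃ L : EG →L[ℝ] EP, ∀ Y ∈ gr.nonneg, incl EG EP P (L Y) = Y := by
  obtain ⟨L, hL⟩ := (incl EG EP P).toLinearMap.exists_leftInverse_of_injective
    (LinearMap.ker_eq_bot.2 hP.isClosedLieSubgroup.injective_lieIncl)
  refine ⟨LinearMap.toContinuousLinearMap L, fun Y hY ↦ ?_⟩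
  obtain ⟨Z, rfl⟩ := exists_incl_eq hP hY
  have h : L (incl EG EP P Z) = Z := DFunLike.congr_fun hL Z
  change incl EG EP P (L (incl EG EP P Z)) = _
  rw [h]

theorem Ad_mem_nonneg (hP : IsParabolicPair (EP := EP) P gr) (p : P)
    {Y : GroupLieAlgebra 𝓘(ℝ, EG) G} (hY : Y ∈ gr.nonneg) : Ad (p : G) Y ∈ gr.nonneg := by
  obtain ⟨Z, rfl⟩ := exists_incl_eq hP hY
  have h := incl_mem_nonneg hP (adj p Z)
  rwa [incl_adj hP.isClosedLieSubgroup] at h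

theorem Ad_mem_nonneg_iff (hP : IsParabolicPair (EP := EP) P gr) (p : P)
    {Y : GroupLieAlgebra 𝓘(ℝ, EG) G} : Ad (p : G) Y ∈ gr.nonneg ↔ Y ∈ gr.nonneg := by
  refine ⟨fun h ↦ ?_, Ad_mem_nonneg hP p⟩
  have h1 := Ad_mem_nonneg hP p⁻¹ h
  rwa [Subgroup.coe_inv, show Ad (p : G)⁻¹ (Ad (p : G) Y) = Y from adj_inv_adj (F := EG) _ _] at h1

/-- `Ad(p)` preserves the Lie algebra `𝔭` of `P`, hence also its Killing orthogonal. -/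
theorem Ad_mem_pos (hP : IsParabolicPair (EP := EP) P gr) (p : P)
    {Y : GroupLieAlgebra 𝓘(ℝ, EG) G} (hY : Y ∈ gr.pos) : Ad (p : G) Y ∈ gr.pos := by
  have := hP.isKilling
  exact gr.map_mem_pos (adEquiv (p : G)) (fun x ↦ Ad_mem_nonneg_iff hP p) hY

theorem Ad_lie (g : G) (X Y : GroupLieAlgebra 𝓘(ℝ, EG) G) : Ad g ⁅X, Y⁆ = ⁅Ad g X, Ad g Y⁆ :=
  adj_lieBr (F := EG) g X Y

theorem gexp_mem_Pplus {Z : EP} (hZ : incl EG EP P Z ∈ gr.pos) :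
    (gexp Z : P) ∈ Pplus EP P gr := Subgroup.subset_closure ⟨Z, hZ, rfl⟩

/-- The parabolic subgroup normalizes `P_+`. -/
theorem conj_mem_Pplus (hP : IsParabolicPair (EP := EP) P gr) (p : P) {n : P}
    (hn : n ∈ Pplus EP P gr) : p * n * p⁻¹ ∈ Pplus EP P gr := by
  refine Subgroup.closure_induction (p := fun (n : P) _ ↦ p * n * p⁻¹ ∈ Pplus EP P gr) ?_ ?_ ?_ ?_ hn
  · rintro _ ⟨Z, hZ, rfl⟩
    have h : p * lieExp Z * p⁻¹ = gexp (F := EP) (adj (F := EP) p Z) := conj_gexp (F := EP) p Z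
    rw [h]
    refine gexp_mem_Pplus ?_
    have h2 : incl EG EP P (adj (F := EP) p Z) = Ad (p : G) (incl EG EP P Z) :=
      incl_adj hP.isClosedLieSubgroup p Z
    have h3 : Ad (p : G) (incl EG EP P Z) ∈ gr.pos := Ad_mem_pos hP p hZ
    rwa [← h2] at h3
  · simp
  · intro a b _ _ ha hb
    have h := mul_mem ha hb
    rwa [show p * a * p⁻¹ * (p * b * p⁻¹) = p * (a * b) * p⁻¹ by group] at h
  · intro a _ ha
    have h := inv_mem ha
    rwa [show (p * a * p⁻¹)⁻¹ = p * a⁻¹ * p⁻¹ by group] at h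

/-- The remainder of `exp(ad A)` after the linear term begins with two applications of `ad A`, each
raising the filtration degree by `i`; further ones do not lower it, as `i ≥ 0`. -/
theorem Ad_gexp_sub_mem {A : GroupLieAlgebra 𝓘(ℝ, EG) G} {i j : ℤ} (hi : 0 ≤ i)
    (hA : A ∈ gr.fil i) {y : GroupLieAlgebra 𝓘(ℝ, EG) G} (hy : y ∈ gr.fil j) :
    Ad (gexp (F := EG) A : G) y - y - ⁅A, y⁆ ∈ gr.fil (i + (i + j)) := by
  refine adj_gexp_sub_mem (F := EG) (H := G) A (gr.fil (i + (i + j))) (fun z hz ↦ ?_) y ?_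
  · exact gr.fil_anti (by omega) (gr.lie_mem_fil hA hz)
  · exact gr.lie_mem_fil hA (gr.lie_mem_fil hA hy)

/-- The adjoint action of `P_+` is unipotent. -/
theorem Ad_sub_mem_fil (hP : IsParabolicPair (EP := EP) P gr) {n : P} (hn : n ∈ Pplus EP P gr) :
    ∀ j, ∀ y ∈ gr.fil j, Ad (n : G) y - y ∈ gr.fil (j + 1) := by
  refine Subgroup.closure_induction
    (p := fun (n : P) _ ↦ ∀ j, ∀ y ∈ gr.fil j, Ad (n : G) y - y ∈ gr.fil (j + 1)) ?_ ?_ ?_ ?_ hn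
  · rintro _ ⟨Z, hZ, rfl⟩ j y hy
    have h : ((lieExp Z : P) : G) = gexp (incl EG EP P Z) := coe_gexp hP.isClosedLieSubgroup Z
    rw [h]
    have hA : incl EG EP P Z ∈ gr.fil 1 := hZ
    have h1 := Ad_gexp_sub_mem zero_le_one hA hy
    have h2 := gr.lie_mem_fil hA hy
    have h3 := add_mem (gr.fil_anti (j := j + 1) (by omega) h1)
      (gr.fil_anti (j := j + 1) (by omega) h2)
    rwa [sub_add_cancel] at h3
  · intro j y _
    rw [Subgroup.coe_one, Ad_one, sub_self]
    exact zero_mem _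
  · intro a b _ _ ha hb j y hy
    have hby : Ad (b : G) y ∈ gr.fil j := by
      have := add_mem (gr.fil_anti (by omega) (hb j y hy)) hy
      rwa [sub_add_cancel] at this
    rw [Subgroup.coe_mul, Ad_mul, ← sub_add_sub_cancel _ (Ad (b : G) y) y]
    exact add_mem (ha j _ hby) (hb j y hy)
  · intro a _ ha j y hy
    -- To treat the inverse, `Ad(a)` must map the filtration subspace onto itself; it is injective
    -- there and the dimension is finite.
    have hmaps : ∀ z ∈ gr.fil j, (Ad (a : G)).toLinearMap z ∈ gr.fil j := fun z hz ↦ by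
      have := add_mem (gr.fil_anti (by omega) (ha j z hz)) hz
      rwa [sub_add_cancel] at this
    have hinj : Function.Injective ((Ad (a : G)).toLinearMap.restrict hmaps) := by
      intro z w hzw
      have h1 : adEquiv (a : G) (z : GroupLieAlgebra 𝓘(ℝ, EG) G)
          = adEquiv (a : G) (w : GroupLieAlgebra 𝓘(ℝ, EG) G) := congrArg Subtype.val hzw
      exact Subtype.ext ((adEquiv (a : G)).injective h1)
    obtain ⟨⟨z, hz⟩, hzy⟩ := LinearMap.injective_iff_surjective.1 hinj ⟨y, hy⟩
    have h1 : Ad (a : G) z = y := congrArg Subtype.val hzy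
    have h2 : Ad ((a : G)⁻¹) y = z := by
      rw [← h1]
      exact adj_inv_adj (F := EG) _ _
    rw [Subgroup.coe_inv, h2, ← h1, ← neg_sub]
    exact neg_mem (ha j z hz)

/-! ### Conjugating elements of `x₀ + 𝔭_+` to `x₀` -/

section Conjugation

variable {x₀ : GroupLieAlgebra 𝓘(ℝ, EG) G}

/-- If `x₀ ∈ 𝔤_0` acts injectively on `𝔭_+`, then all elements of `x₀ + 𝔭_+` are conjugate to `x₀`
under `P_+`, smoothly. -/
theorem exists_contMDiff_conj (hP : IsParabolicPair (EP := EP) P gr) (hx₀ : x₀ ∈ gr.comp 0)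
    (hinj : ∀ y ∈ gr.pos, ⁅x₀, y⁆ = 0 → y = 0) :
    ∃ ζ : EG → P, ContMDiff 𝓘(ℝ, EG) 𝓘(ℝ, EP) ∞ ζ ∧ (∀ x, ζ x ∈ Pplus EP P gr) ∧ ζ x₀ = 1 ∧
      ∀ x : GroupLieAlgebra 𝓘(ℝ, EG) G, x - x₀ ∈ gr.pos → Ad (ζ x : G) x = x₀ := by
  obtain ⟨L, hL⟩ := exists_incl_leftInverse hP
  -- The error is removed degree by degree; beyond the depth of the grading the filtration vanishes.
  suffices h : ∀ i : ℕ, ∃ ζ : EG → P, ContMDiff 𝓘(ℝ, EG) 𝓘(ℝ, EP) ∞ ζ ∧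
      (∀ x, ζ x ∈ Pplus EP P gr) ∧ ζ x₀ = 1 ∧
      ∀ x : GroupLieAlgebra 𝓘(ℝ, EG) G, x - x₀ ∈ gr.pos →
        Ad (ζ x : G) x - x₀ ∈ gr.fil ((i : ℤ) + 1) by
    obtain ⟨ζ, h1, h2, h3, h4⟩ := h gr.depth
    refine ⟨ζ, h1, h2, h3, fun x hx ↦ ?_⟩
    have := h4 x hx
    rw [gr.fil_eq_bot (by omega)] at this
    exact sub_eq_zero.1 this
  intro i
  induction i with
  | zero =>
    refine ⟨fun _ ↦ 1, contMDiff_const, fun _ ↦ one_mem _, rfl, fun x hx ↦ ?_⟩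
    rw [Subgroup.coe_one, Ad_one]
    exact hx
  | succ i ih =>
    obtain ⟨ζ, h1, h2, h3, h4⟩ := ih
    -- the inverse of `ad x₀` in degree `i + 1`
    have hmaps : ∀ y ∈ gr.comp ((i : ℤ) + 1),
        LieAlgebra.ad ℝ (GroupLieAlgebra 𝓘(ℝ, EG) G) x₀ y ∈ gr.comp ((i : ℤ) + 1) := fun y hy ↦ by
      have := gr.lie_mem 0 _ x₀ hx₀ y hy
      rwa [zero_add] at this
    have hTinj : Function.Injective
        ((LieAlgebra.ad ℝ (GroupLieAlgebra 𝓘(ℝ, EG) G) x₀).restrict hmaps) := by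
      rw [injective_iff_map_eq_zero]
      intro y hy
      exact Subtype.ext (hinj y (gr.comp_le_fil (j := 1) (by omega) y.2) (congrArg Subtype.val hy))
    let T := LinearEquiv.ofInjectiveEndo _ hTinj
    let S : GroupLieAlgebra 𝓘(ℝ, EG) G →ₗ[ℝ] GroupLieAlgebra 𝓘(ℝ, EG) G :=
      (gr.comp ((i : ℤ) + 1)).subtype ∘ₗ T.symm.toLinearMap ∘ₗ
        (gr.proj ((i : ℤ) + 1)).codRestrict _ (gr.proj_mem _)
    have hS : ∀ y, S y ∈ gr.comp ((i : ℤ) + 1) := fun y ↦ Subtype.mem _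
    have hS' : ∀ y, ⁅x₀, S y⁆ = gr.proj ((i : ℤ) + 1) y := by
      intro y
      have := T.apply_symm_apply ((gr.proj ((i : ℤ) + 1)).codRestrict _ (gr.proj_mem _) y)
      exact congrArg Subtype.val this
    let S' : EG →L[ℝ] EG := LinearMap.toContinuousLinearMap (show EG →ₗ[ℝ] EG from S)
    have hpos : ∀ y, S y ∈ gr.pos := fun y ↦ gr.comp_le_fil (j := 1) (by omega) (hS y)
    have hincl : ∀ y : GroupLieAlgebra 𝓘(ℝ, EG) G, incl EG EP P (L (S y)) = S y :=
      fun y ↦ hL _ (gr.pos_le_nonneg (hpos y))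
    -- With `z = Ad(ζ x)x`, conjugating by `exp(S z)` changes `z` to first order by `[S z, x₀] =
    -- -z_{i+1}`, which cancels the lowest component of the error. `S` is linear, so `ζ` stays
    -- smooth.
    refine ⟨fun x ↦ gexp (L (S' (adj (ζ x : G) x))) * ζ x, ?_, ?_, ?_, ?_⟩
    · have hadj : ContMDiff 𝓘(ℝ, EG) 𝓘(ℝ, EG →L[ℝ] EG) ∞ (fun x : EG ↦ (adj (ζ x : G) : EG →L[ℝ] EG)) :=
        contMDiff_adj.comp (hP.isClosedLieSubgroup.contMDiff_coe.comp h1)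
      have hx : ContMDiff 𝓘(ℝ, EG) 𝓘(ℝ, EG) ∞ (fun x : EG ↦ adj (ζ x : G) x) :=
        (hadj.contDiff.clm_apply contDiff_id).contMDiff
      have hLS : ContMDiff 𝓘(ℝ, EG) 𝓘(ℝ, EP) ∞ (fun y : EG ↦ L (S' y)) :=
        (L.comp S').contDiff.contMDiff
      exact (contMDiff_gexp.comp (hLS.comp hx)).mul h1
    · intro x
      refine mul_mem (gexp_mem_Pplus ?_) (h2 x)
      have := hpos (Ad (ζ x : G) x)
      rw [← hincl] at this
      exact this
    · simp only [h3, mul_one, Subgroup.coe_one]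
      have h5 : S' (adj (1 : G) x₀) = 0 := by
        have h6 : adj (1 : G) (F := EG) x₀ = x₀ := adj_one (F := EG) x₀
        rw [h6]
        exact hinj _ (hpos x₀) ((hS' x₀).trans (gr.proj_of_mem_ne hx₀ (by omega)))
      rw [h5, map_zero, gexp_zero]
    · intro x hx
      have h5 := h4 x hx
      set z : GroupLieAlgebra 𝓘(ℝ, EG) G := Ad (ζ x : G) x with hz
      have h6 : ((gexp (L (S' (adj (ζ x : G) x))) * ζ x : P) : G)
          = gexp (F := EG) (S z) * (ζ x : G) := by
        rw [Subgroup.coe_mul, coe_gexp hP.isClosedLieSubgroup]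
        exact congrArg (fun y : EG ↦ (gexp y : G) * (ζ x : G)) (hincl z)
      rw [h6, Ad_mul, ← hz]
      have hA : S z ∈ gr.fil ((i : ℤ) + 1) := gr.comp_le_fil le_rfl (hS z)
      have h7 := Ad_gexp_sub_mem (by omega) hA (gr.comp_le_fil (j := 0) le_rfl hx₀)
      have h8 := Ad_gexp_sub_mem (by omega) hA h5
      have h9 := gr.lie_mem_fil hA h5
      have h10 := gr.sub_proj_mem_fil h5
      have h11 : gr.proj ((i : ℤ) + 1) (z - x₀) = gr.proj ((i : ℤ) + 1) z := by
        rw [map_sub, gr.proj_of_mem_ne hx₀ (by omega), sub_zero]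
      have h12 : ⁅S z, x₀⁆ = - gr.proj ((i : ℤ) + 1) z := by rw [← hS', lie_skew]
      rw [h11] at h10
      rw [h12] at h7
      -- Each of the four terms has filtration degree at least `i + 2`: two exponential remainders,
      -- a bracket of `S z` with the error, and the error without its lowest component.
      have hsum : Ad (gexp (F := EG) (S z) : G) z - x₀
          = (Ad (gexp (F := EG) (S z) : G) x₀ - x₀ - -gr.proj ((i : ℤ) + 1) z)
            + (Ad (gexp (F := EG) (S z) : G) (z - x₀) - (z - x₀) - ⁅S z, z - x₀⁆)
            + ⁅S z, z - x₀⁆ + (z - x₀ - gr.proj ((i : ℤ) + 1) z) := by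
        rw [map_sub]
        abel
      rw [hsum]
      push_cast
      exact add_mem (add_mem (add_mem (gr.fil_anti (by omega) h7) (gr.fil_anti (by omega) h8))
        (gr.fil_anti (by omega) h9)) h10

end Conjugation

end Subgroups
/-! ### The decomposition of a parabolic subgroup -/

section Levi

set_option linter.unusedSectionVars false

open Set

variable {EG : Type*} [NormedAddCommGroup EG] [NormedSpace ℝ EG] [FiniteDimensional ℝ EG]
  {EP : Type*} [NormedAddCommGroup EP] [NormedSpace ℝ EP] [FiniteDimensional ℝ EP]
  {G : Type*} [TopologicalSpace G] [T2Space G] [ChartedSpace EG G] [Group G]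
  [LieGroup 𝓘(ℝ, EG) ∞ G]
  {P : Subgroup G} [ChartedSpace EP P] [LieGroup 𝓘(ℝ, EP) ∞ P]
  {gr : Grading (GroupLieAlgebra 𝓘(ℝ, EG) G)}

/-! ### The decomposition `P = G₀ P_+` -/

section Killing

variable [LieAlgebra.IsKilling ℝ (GroupLieAlgebra 𝓘(ℝ, EG) G)]

/-- Conjugates of the grading element differ from it by elements of `𝔭_+`. -/
theorem Ad_gradingElement_sub_mem (hP : IsParabolicPair (EP := EP) P gr) (q : P) :
    Ad (q : G) gr.gradingElement - gr.gradingElement ∈ gr.pos := by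
  have hpres : ∀ p : P, ∀ x, adEquiv (p : G) x ∈ gr.nonneg ↔ x ∈ gr.nonneg :=
    fun p x ↦ Ad_mem_nonneg_iff hP p
  set x : GroupLieAlgebra 𝓘(ℝ, EG) G := Ad (q : G) gr.gradingElement with hx
  have hxn : x ∈ gr.nonneg := Ad_mem_nonneg hP q gr.gradingElement_mem_nonneg
  -- Injectivity of `ad x` on `𝔭_+` passes to the degree zero part `x₀` of `x`, so some element of
  -- `P_+` conjugates `x` to `x₀`. The composite automorphism maps `E` into `𝔤_0`, hence fixes it,
  -- and therefore `x₀ = E`.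
  have hinj := gr.lie_map_gradingElement_injective (adEquiv (q : G)) (hpres q)
  have hinj0 := gr.lie_proj_zero_injective hxn hinj
  obtain ⟨ζ, -, -, -, hζ⟩ := exists_contMDiff_conj hP (gr.proj_mem 0 x) hinj0
  have h1 := hζ x (gr.sub_proj_zero_mem_pos hxn)
  have h2 : adEquiv ((ζ x * q : P) : G) gr.gradingElement = gr.proj 0 x := by
    rw [← h1, hx]
    exact Ad_mul (ζ x : G) (q : G) gr.gradingElement
  have h3 := gr.map_gradingElement_eq (adEquiv ((ζ x * q : P) : G)) (hpres _)
    (by rw [h2]; exact gr.proj_mem 0 x)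
  rw [← h3, h2]
  exact gr.sub_proj_zero_mem_pos hxn

/-- `𝔤_i` is the eigenspace of `ad E` for the eigenvalue `i`. If `Ad(q)` preserves all of them, then
`Ad(q)E` acts on `𝔤` as `E` does, and the center is zero. -/
theorem mem_G₀_iff {q : P} :
    q ∈ G₀ P gr ↔ Ad (q : G) gr.gradingElement = gr.gradingElement := by
  constructor
  · intro hq
    refine sub_eq_zero.1 (Grading.eq_zero_of_lie_eq_zero fun y ↦ ?_)
    refine gr.induction_comp y (fun i z hz ↦ ?_) fun z w hz hw ↦ by rw [lie_add, hz, hw, add_zero]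
    have h1 : Ad (q : G) (Ad (q : G)⁻¹ z) = z := adj_adj_inv (F := EG) _ _
    have h2 : Ad (q : G)⁻¹ z ∈ gr.comp i := (hq i _).1 (by rwa [h1])
    have h3 : ⁅Ad (q : G) gr.gradingElement, z⁆ = (i : ℝ) • z := by
      conv_lhs => rw [← h1]
      rw [← Ad_lie, gr.gradingElement_lie h2, map_smul, h1]
    rw [sub_lie, h3, gr.gradingElement_lie hz, sub_self]
  · intro hq i Y
    have h : ⁅gr.gradingElement, Ad (q : G) Y⁆ = Ad (q : G) ⁅gr.gradingElement, Y⁆ := by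
      rw [Ad_lie, hq]
    refine ⟨fun hY ↦ gr.mem_comp_of_gradingElement_lie ((adEquiv (q : G)).injective ?_),
      fun hY ↦ gr.mem_comp_of_gradingElement_lie ?_⟩
    · change Ad (q : G) ⁅gr.gradingElement, Y⁆ = Ad (q : G) ((i : ℝ) • Y)
      rw [← h, gr.gradingElement_lie hY, map_smul]
    · rw [h, gr.gradingElement_lie hY, map_smul]

/-- Elements of `P_+` are joined to `1` by smooth curves in `P_+`. -/
theorem exists_curve_of_mem_Pplus {n : P} (hn : n ∈ Pplus EP P gr) :
    ∃ c : ℝ → P, ContMDiff 𝓘(ℝ, ℝ) 𝓘(ℝ, EP) ∞ c ∧ c 0 = 1 ∧ c 1 = n ∧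
      ∀ s, c s ∈ Pplus EP P gr := by
  refine Subgroup.closure_induction (p := fun (n : P) _ ↦ ∃ c : ℝ → P,
    ContMDiff 𝓘(ℝ, ℝ) 𝓘(ℝ, EP) ∞ c ∧ c 0 = 1 ∧ c 1 = n ∧ ∀ s, c s ∈ Pplus EP P gr) ?_ ?_ ?_ ?_ hn
  · rintro _ ⟨(Z : EP), hZ, rfl⟩
    refine ⟨fun s ↦ gexp (s • Z), ?_, by simp [gexp_zero], ?_, fun s ↦ gexp_mem_Pplus ?_⟩
    · exact contMDiff_gexp.comp (contDiff_id.smul contDiff_const).contMDiff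
    · simp only [one_smul]
      rfl
    · rw [map_smul]
      exact Submodule.smul_mem _ s hZ
  · exact ⟨fun _ ↦ 1, contMDiff_const, rfl, rfl, fun _ ↦ one_mem _⟩
  · rintro a b _ _ ⟨c, h1, h2, h3, h4⟩ ⟨d, k1, k2, k3, k4⟩
    exact ⟨fun s ↦ c s * d s, h1.mul k1, by simp [h2, k2], by simp [h3, k3],
      fun s ↦ mul_mem (h4 s) (k4 s)⟩
  · rintro a _ ⟨c, h1, h2, h3, h4⟩
    exact ⟨fun s ↦ (c s)⁻¹, h1.inv, by simp [h2], by simp [h3], fun s ↦ inv_mem (h4 s)⟩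

theorem eq_zero_of_lieBr_eq_zero {A : EG} (h : ∀ Y : EG, lieBr G A Y = 0) : A = 0 :=
  Grading.eq_zero_of_lie_eq_zero (𝔤 := GroupLieAlgebra 𝓘(ℝ, EG) G) (x := A) h

/-- A smooth curve in the kernel of the adjoint representation is constant. -/
theorem eq_of_adj_eq (hP : IsClosedLieSubgroup (EG := EG) (EP := EP) P) {c : ℝ → P}
    (hc : ContMDiff 𝓘(ℝ, ℝ) 𝓘(ℝ, EP) ∞ c) (h : ∀ s, ∀ Y : EG, adj (c s : G) Y = Y) (s t : ℝ) :
    c s = c t := by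
  have hv : ∀ s, HasVelocityAt c s (0 : EP) := by
    intro s
    have h1 : HasVelocityAt c s (tderiv c s (1 : ℝ) : EP) := hasVelocityAt_of_contMDiffAt (hc s)
    set v : EP := tderiv c s (1 : ℝ)
    -- translate the curve to the identity
    let W : EP := tderiv (E := EP) (E' := EP) (fun a : P ↦ (c s)⁻¹ * a) (c s) v
    have h2 : HasVelocityAt (fun t ↦ (c s)⁻¹ * c t) s W :=
      (hasTDerivAt_mul_left _ _).hasVelocityAt_comp h1
    have h3 : HasVelocityAt (fun t ↦ (((c s)⁻¹ * c t : P) : G)) s (incl EG EP P W) := by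
      refine HasTDerivAt.hasVelocityAt_comp (f := fun p : P ↦ (p : G)) ?_ h2
      simp only [inv_mul_cancel]
      exact hasTDerivAt_of_contMDiff hP.contMDiff_coe
    -- `Ad` is trivial along the translated curve. Its derivative there depends only on the velocity
    -- `W`, so it may be computed along `exp(tW)`, giving `ad W = 0`; a semisimple algebra has no
    -- center.
    have h4 : incl EG EP P W = 0 := by
      refine eq_zero_of_lieBr_eq_zero (G := G) fun Y ↦ ?_
      let D : EG →L[ℝ] EG →L[ℝ] EG :=
        tderiv (E := EG) (E' := EG →L[ℝ] EG) (adj : G → EG →L[ℝ] EG) 1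
      have hD : HasTDerivAt (E := EG) (E' := EG →L[ℝ] EG) (adj : G → EG →L[ℝ] EG) 1 D :=
        hasTDerivAt_of_contMDiff contMDiff_adj
      have h5 : HasDerivAt (fun t ↦ (adj (((c s)⁻¹ * c t : P) : G) : EG →L[ℝ] EG))
          (D (incl EG EP P W)) s := by
        refine hasVelocityAt_iff_hasDerivAt.1 (HasTDerivAt.hasVelocityAt_comp
          (f := (adj : G → EG →L[ℝ] EG)) ?_ h3)
        simp only [inv_mul_cancel, Subgroup.coe_one]
        exact hD
      have h6 : HasDerivAt (fun t : ℝ ↦ (adj (gexp (t • incl EG EP P W) : G) : EG →L[ℝ] EG))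
          (D (incl EG EP P W)) 0 := by
        have h7 := hasVelocityAt_gexp (H := G) (incl EG EP P W) 0
        rw [zero_smul, gexp_zero, leftField_one] at h7
        refine hasVelocityAt_iff_hasDerivAt.1 (HasTDerivAt.hasVelocityAt_comp
          (f := (adj : G → EG →L[ℝ] EG)) ?_ h7)
        simp only [zero_smul, gexp_zero]
        exact hD
      have h7 : HasDerivAt (fun t : ℝ ↦ (adj (gexp (t • incl EG EP P W) : G) : EG →L[ℝ] EG) Y)
          (D (incl EG EP P W) Y) 0 := by
        have := h6.clm_apply (hasDerivAt_const (0 : ℝ) Y)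
        rwa [map_zero, add_zero] at this
      have h8 : HasDerivAt (fun t ↦ (adj (((c s)⁻¹ * c t : P) : G) : EG →L[ℝ] EG) Y)
          (D (incl EG EP P W) Y) s := by
        have := h5.clm_apply (hasDerivAt_const s Y)
        rwa [map_zero, add_zero] at this
      have h9 : ∀ t, (adj (((c s)⁻¹ * c t : P) : G) : EG →L[ℝ] EG) Y = Y := by
        intro t
        rw [Subgroup.coe_mul, adj_mul, h t, Subgroup.coe_inv]
        conv_lhs => rw [← h s Y]
        exact adj_inv_adj _ _
      simp only [h9] at h8
      rw [(hasDerivAt_adj_gexp_zero (incl EG EP P W) Y).unique h7, h8.unique (hasDerivAt_const s Y)]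
    have h5 : W = 0 := hP.injective_lieIncl (h4.trans (map_zero (incl EG EP P)).symm)
    have h6 : HasVelocityAt (fun t ↦ c s * ((c s)⁻¹ * c t)) s
        (tderiv (E := EP) (E' := EP) (fun a : P ↦ c s * a) ((c s)⁻¹ * c s) W) :=
      (hasTDerivAt_mul_left (c s) ((c s)⁻¹ * c s)).hasVelocityAt_comp h2
    rw [h5, map_zero] at h6
    simpa using h6
  -- A curve of velocity zero is an integral curve of the zero field, as the constant curve is.
  have hsm : IsSmoothField (fun _ : P ↦ (0 : EP)) := by
    have := isSmoothField_leftField (H := P) (0 : EP)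
    have h0 : (leftField (0 : EP) : P → EP) = fun _ ↦ 0 := by
      funext g
      exact map_zero _
    rwa [h0] at this
  have := eq_of_hasVelocityAt hsm hv (η := fun _ ↦ c t) (fun s ↦ ?_) (t₀ := t) rfl
  · exact congrFun this s
  · have h1 := hasTDerivAt_const (E := ℝ) (E' := EP) s (c t)
    have h2 : (1 : ℝ →L[ℝ] ℝ).smulRight (0 : EP) = 0 := by
      ext
      simp
    rw [HasVelocityAt, h2]
    exact h1

/-- A curve `c` in `P_+` from `1` to `n` is corrected by `ζ` to a curve `d` in `P_+` that fixes `E`.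
Then `Ad(d)` is unipotent and preserves degrees, so it is trivial, and `d` is constant. The
correction is `1` at both ends because `n` fixes `E`. -/
theorem eq_one_of_mem_Pplus_of_mem_G₀ (hP : IsParabolicPair (EP := EP) P gr) {n : P}
    (hn : n ∈ Pplus EP P gr) (hn' : n ∈ G₀ P gr) : n = 1 := by
  obtain ⟨c, hc, hc0, hc1, hcP⟩ := exists_curve_of_mem_Pplus hn
  obtain ⟨ζ, hζ, hζP, hζ1, hζE⟩ := exists_contMDiff_conj hP gr.gradingElement_mem
    fun y hy h ↦ gr.eq_zero_of_gradingElement_lie hy h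
  let E : EG := gr.gradingElement
  let d : ℝ → P := fun s ↦ ζ (adj (c s : G) E) * c s
  have hd : ContMDiff 𝓘(ℝ, ℝ) 𝓘(ℝ, EP) ∞ d := by
    have h1 : ContMDiff 𝓘(ℝ, ℝ) 𝓘(ℝ, EG →L[ℝ] EG) ∞ (fun s ↦ (adj (c s : G) : EG →L[ℝ] EG)) :=
      contMDiff_adj.comp (hP.isClosedLieSubgroup.contMDiff_coe.comp hc)
    have h2 : ContMDiff 𝓘(ℝ, ℝ) 𝓘(ℝ, EG) ∞ (fun s ↦ (adj (c s : G) : EG →L[ℝ] EG) E) :=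
      (h1.contDiff.clm_apply contDiff_const).contMDiff
    exact (hζ.comp h2).mul hc
  have hdE : ∀ s, Ad (d s : G) gr.gradingElement = gr.gradingElement := by
    intro s
    rw [Subgroup.coe_mul, Ad_mul]
    exact hζE _ (Ad_gradingElement_sub_mem hP (c s))
  have hdad : ∀ s, ∀ Y : EG, adj (d s : G) Y = Y := by
    intro s Y
    refine gr.induction_comp (p := fun Y ↦ Ad (d s : G) Y = Y) Y (fun i z hz ↦ ?_)
      fun z w hz hw ↦ by rw [map_add, hz, hw]
    have h1 : Ad (d s : G) z - z ∈ gr.fil (i + 1) :=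
      Ad_sub_mem_fil hP (mul_mem (hζP _) (hcP s)) i z (gr.comp_le_fil le_rfl hz)
    have h2 : Ad (d s : G) z - z ∈ gr.comp i :=
      sub_mem ((mem_G₀_iff.2 (hdE s) i z).2 hz) hz
    exact sub_eq_zero.1 (gr.eq_zero_of_mem_comp_of_mem_fil (lt_add_one i) h2 h1)
  have h0 : d 0 = 1 := by
    have : adj (1 : G) E = E := adj_one E
    simp only [d, hc0, Subgroup.coe_one, this, mul_one]
    exact hζ1
  have h1 : d 1 = n := by
    have : adj (n : G) E = E := mem_G₀_iff.1 hn'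
    simp only [d, hc1, this]
    rw [show ζ E = 1 from hζ1, one_mul]
  rw [← h1, ← h0]
  exact eq_of_adj_eq hP.isClosedLieSubgroup hd hdad 1 0

/-- The smooth retraction `r` of `P` onto the Levi subgroup `G_0`, with `r (q) ∈ q P_+`. -/
theorem exists_retraction (hP : IsParabolicPair (EP := EP) P gr) :
    ∃ r : P → P, ContMDiff 𝓘(ℝ, EP) 𝓘(ℝ, EP) ∞ r ∧ (∀ q, r q ∈ G₀ P gr) ∧
      (∀ q, q⁻¹ * r q ∈ Pplus EP P gr) ∧ (∀ q, ∀ n ∈ Pplus EP P gr, r (q * n) = r q) ∧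
      (∀ q, ∀ g ∈ G₀ P gr, r (q * g) = r q * g) ∧ (∀ q, ∀ g ∈ G₀ P gr, r (g * q) = g * r q) ∧
      ∀ g ∈ G₀ P gr, r g = g := by
  obtain ⟨ζ, hζ, hζP, hζ1, hζE⟩ := exists_contMDiff_conj hP gr.gradingElement_mem
    fun y hy h ↦ gr.eq_zero_of_gradingElement_lie hy h
  let E : EG := gr.gradingElement
  -- `ζ` carries `Ad(q⁻¹)E`, an element of `E + 𝔭_+`, back to `E`. So `(r q)⁻¹` fixes `E`, and `r q`
  -- differs from `q` by an element of `P_+`.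
  let r : P → P := fun q ↦ q * (ζ (adj ((q⁻¹ : P) : G) E))⁻¹
  have hr : ContMDiff 𝓘(ℝ, EP) 𝓘(ℝ, EP) ∞ r := by
    have h1 : ContMDiff 𝓘(ℝ, EP) 𝓘(ℝ, EG →L[ℝ] EG) ∞
        (fun q : P ↦ (adj ((q⁻¹ : P) : G) : EG →L[ℝ] EG)) :=
      contMDiff_adj.comp (hP.isClosedLieSubgroup.contMDiff_coe.comp (contMDiff_inv 𝓘(ℝ, EP) ∞))
    have h2 : ContMDiff 𝓘(ℝ, EP) 𝓘(ℝ, EG) ∞ (fun q : P ↦ (adj ((q⁻¹ : P) : G) : EG →L[ℝ] EG) E) :=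
      ContMDiff.comp (I' := 𝓘(ℝ, EG →L[ℝ] EG)) (g := fun T : EG →L[ℝ] EG ↦ T E)
        (ContinuousLinearMap.apply ℝ EG E).contDiff.contMDiff h1
    exact contMDiff_id.mul (hζ.comp h2).inv
  have hrG : ∀ q, r q ∈ G₀ P gr := by
    intro q
    rw [← inv_mem_iff]
    refine mem_G₀_iff.2 ?_
    have h1 : (r q)⁻¹ = ζ (adj ((q⁻¹ : P) : G) E) * q⁻¹ := by simp [r]
    rw [h1, Subgroup.coe_mul, Ad_mul]
    exact hζE _ (Ad_gradingElement_sub_mem hP q⁻¹)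
  have hrP : ∀ q, q⁻¹ * r q ∈ Pplus EP P gr := by
    intro q
    simp only [r, inv_mul_cancel_left]
    exact inv_mem (hζP _)
  -- `r q` is the only element of `G₀` in `q P_+`; all the equivariance properties of `r` follow
  -- from this.
  have huniq : ∀ q g, g ∈ G₀ P gr → q⁻¹ * g ∈ Pplus EP P gr → r q = g := by
    intro q g hg hqg
    have h1 : (r q)⁻¹ * g = 1 := by
      refine eq_one_of_mem_Pplus_of_mem_G₀ hP ?_ (mul_mem (inv_mem (hrG q)) hg)
      have := mul_mem (inv_mem (hrP q)) hqg
      rwa [mul_inv_rev, inv_inv, mul_assoc, mul_inv_cancel_left] at this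
    exact (eq_of_inv_mul_eq_one h1)
  refine ⟨r, hr, hrG, hrP, fun q n hn ↦ huniq _ _ (hrG q) ?_,
    fun q g hg ↦ huniq _ _ (mul_mem (hrG q) hg) ?_, fun q g hg ↦ huniq _ _ (mul_mem hg (hrG q)) ?_,
    fun g hg ↦ huniq _ _ hg ?_⟩
  · rw [mul_inv_rev, mul_assoc]
    exact mul_mem (inv_mem hn) (hrP q)
  · have := conj_mem_Pplus hP g⁻¹ (hrP q)
    rwa [inv_inv, show g⁻¹ * (q⁻¹ * r q) * g = (q * g)⁻¹ * (r q * g) by group] at this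
  · rw [show (g * q)⁻¹ * (g * r q) = q⁻¹ * r q by group]
    exact hrP q
  · rw [inv_mul_cancel]
    exact one_mem _

end Killing

end Levi
/-! ### Derivatives of maps of two variables -/

section TwoVariables

variable {E E' E₁ F : Type*} [NormedAddCommGroup E] [NormedSpace ℝ E]
  [NormedAddCommGroup E'] [NormedSpace ℝ E'] [NormedAddCommGroup F] [NormedSpace ℝ F]
  [NormedAddCommGroup E₁] [NormedSpace ℝ E₁]
  {N N' N₁ H : Type*} [TopologicalSpace N] [ChartedSpace E N]
  [TopologicalSpace N'] [ChartedSpace E' N'] [TopologicalSpace H] [ChartedSpace F H]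
  [TopologicalSpace N₁] [ChartedSpace E₁ N₁]

theorem hasTDerivAt_of_contMDiff_prod {Φ : N × H → N'}
    (hΦ : ContMDiff (𝓘(ℝ, E).prod 𝓘(ℝ, F)) 𝓘(ℝ, E') ∞ Φ) {f : N₁ → N} {g : N₁ → H} {a : N₁}
    {L : E₁ →L[ℝ] E} {L' : E₁ →L[ℝ] F} (hf : HasTDerivAt f a L) (hg : HasTDerivAt g a L') :
    HasTDerivAt (fun z ↦ Φ (f z, g z)) a
      ((tderiv (E := E) (E' := E') (fun x ↦ Φ (x, g a)) (f a)).comp L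
        + (tderiv (E := F) (E' := E') (fun y ↦ Φ (f a, y)) (g a)).comp L') := by
  have h1 : MDifferentiableAt (𝓘(ℝ, E).prod 𝓘(ℝ, F)) 𝓘(ℝ, E') Φ (f a, g a) :=
    (hΦ _).mdifferentiableAt (by simp)
  have h2 := HasMFDerivAt.prodMk hf hg
  have h3 := HasMFDerivAt.comp a h1.hasMFDerivAt h2
  have h4 := mfderiv_prod_eq_add_comp h1
  rw [h4] at h3
  have h5 : (((tderiv (E := E) (E' := E') (fun x ↦ Φ (x, g a)) (f a)).comp
        (ContinuousLinearMap.fst ℝ E F) + (tderiv (E := F) (E' := E') (fun y ↦ Φ (f a, y)) (g a)).comp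
        (ContinuousLinearMap.snd ℝ E F)).comp (L.prod L'))
      = (tderiv (E := E) (E' := E') (fun x ↦ Φ (x, g a)) (f a)).comp L
        + (tderiv (E := F) (E' := E') (fun y ↦ Φ (f a, y)) (g a)).comp L' := by
    ext v
    rfl
  rw [← h5]
  exact h3

end TwoVariables

/-! ### Principal bundles -/

section Bundle

set_option linter.unusedSectionVars false

variable {EG : Type*} [NormedAddCommGroup EG] [NormedSpace ℝ EG]
  {EP : Type*} [NormedAddCommGroup EP] [NormedSpace ℝ EP]
  {EB : Type*} [NormedAddCommGroup EB] [NormedSpace ℝ EB]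
  {EM : Type*} [NormedAddCommGroup EM] [NormedSpace ℝ EM]
  {G : Type*} [TopologicalSpace G] [ChartedSpace EG G] [Group G]
  {P : Subgroup G} [ChartedSpace EP P]
  {B : Type*} [TopologicalSpace B] [ChartedSpace EB B] [MulAction Pᵐᵒᵖ B]
  {M : Type*} [TopologicalSpace M] [ChartedSpace EM M] {π : B → M}

theorem rmul_one (u : B) : rmul u (1 : P) = u := one_smul _ u

theorem rmul_mul (u : B) (p q : P) : rmul u (p * q) = rmul (rmul u p) q :=
  mul_smul (MulOpposite.op q) (MulOpposite.op p) u

theorem IsPrincipalBundle.contMDiff_rmul_right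
    (hπ : IsPrincipalBundle (EP := EP) (EB := EB) (EM := EM) P π) (p : P) :
    ContMDiff 𝓘(ℝ, EB) 𝓘(ℝ, EB) ∞ (fun w : B ↦ rmul w p) :=
  hπ.contMDiff_rmul.comp (contMDiff_id.prodMk contMDiff_const)

theorem IsPrincipalBundle.contMDiff_rmul_left
    (hπ : IsPrincipalBundle (EP := EP) (EB := EB) (EM := EM) P π) (u : B) :
    ContMDiff 𝓘(ℝ, EP) 𝓘(ℝ, EB) ∞ (fun p : P ↦ rmul u p) :=
  hπ.contMDiff_rmul.comp (contMDiff_const.prodMk contMDiff_id)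

/-- A local trivialization as a section `s`, the unit in each fibre, and an equivariant fibre
coordinate `τ`. -/
theorem IsPrincipalBundle.exists_localSection
    (hπ : IsPrincipalBundle (EP := EP) (EB := EB) (EM := EM) P π) (x : M) :
    ∃ U : Set M, IsOpen U ∧ x ∈ U ∧ ∃ (s : M → B) (τ : B → P),
      ContMDiffOn 𝓘(ℝ, EM) 𝓘(ℝ, EB) ∞ s U ∧ ContMDiffOn 𝓘(ℝ, EB) 𝓘(ℝ, EP) ∞ τ (π ⁻¹' U) ∧
      (∀ y ∈ U, π (s y) = y) ∧ (∀ w, π w ∈ U → rmul (s (π w)) (τ w) = w) ∧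
      ∀ w, π w ∈ U → ∀ p, τ (rmul w p) = τ w * p := by
  obtain ⟨U, hU, hx, e, hes, het, he⟩ := hπ.locallyTrivial x
  have hmem : ∀ y ∈ U, (y, (1 : P)) ∈ e.target := fun y hy ↦ by
    rw [het]
    exact ⟨hy, Set.mem_univ _⟩
  have hsrc : ∀ y ∈ U, e.symm (y, (1 : P)) ∈ e.source := fun y hy ↦ e.map_target' (hmem y hy)
  have hval : ∀ y ∈ U, e (e.symm (y, (1 : P))) = (y, 1) := fun y hy ↦ e.right_inv' (hmem y hy)
  have hsec : ∀ y ∈ U, π (e.symm (y, (1 : P))) = y := fun y hy ↦ by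
    rw [← (he _ (hsrc y hy)).1, hval y hy]
  have hin : ∀ w, π w ∈ U ↔ w ∈ e.source := fun w ↦ by rw [hes]; rfl
  refine ⟨U, hU, hx, fun y ↦ e.symm (y, (1 : P)), fun w ↦ (e w).2, ?_, ?_, hsec, ?_, ?_⟩
  · exact e.contMDiffOn_invFun.comp (contMDiff_id.prodMk contMDiff_const).contMDiffOn hmem
  · rw [← hes]
    exact contMDiff_snd.comp_contMDiffOn e.contMDiffOn_toFun
  · intro w hw
    have h1 := (he _ (hsrc _ hw)).2 (e w).2
    refine e.toPartialEquiv.injOn ?_ ((hin w).1 hw) ?_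
    · rw [← hin, hπ.proj_rmul, hsec _ hw]
      exact hw
    · refine h1.trans ?_
      rw [hval _ hw, hsec _ hw, ← (he w ((hin w).1 hw)).1]
      simp
  · intro w hw p
    exact congrArg Prod.snd ((he w ((hin w).1 hw)).2 p)

theorem IsPrincipalBundle.rmul_injective
    (hπ : IsPrincipalBundle (EP := EP) (EB := EB) (EM := EM) P π) (u : B) :
    Function.Injective (fun p : P ↦ rmul u p) := by
  intro p q h
  obtain ⟨U, -, hx, s, τ, -, -, -, -, h4⟩ := hπ.exists_localSection (π u)
  have h5 := h4 u hx p
  have h6 : rmul u p = rmul u q := h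
  rw [h6, h4 u hx q] at h5
  exact (mul_left_cancel h5).symm

variable (P EB) in
/-- The fundamental vector field of `A`, with values in the model space. -/
def fund (A : EP) (u : B) : EB := tderiv (E := EP) (E' := EB) (fun p : P ↦ rmul u p) 1 A

/-- The derivative of the right translation by `p`. -/
def dright (EB : Type*) [NormedAddCommGroup EB] [NormedSpace ℝ EB] [ChartedSpace EB B]
    (p : P) (u : B) : EB →L[ℝ] EB := tderiv (E := EB) (E' := EB) (fun w : B ↦ rmul w p) u

theorem IsPrincipalBundle.hasTDerivAt_rmul_right
    (hπ : IsPrincipalBundle (EP := EP) (EB := EB) (EM := EM) P π) (p : P) (u : B) :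
    HasTDerivAt (fun w : B ↦ rmul w p) u (dright EB p u) :=
  hasTDerivAt_of_contMDiff (hπ.contMDiff_rmul_right p)

theorem IsPrincipalBundle.hasTDerivAt_rmul_left
    (hπ : IsPrincipalBundle (EP := EP) (EB := EB) (EM := EM) P π) (p : P) (u : B) :
    HasTDerivAt (E := EP) (E' := EB) (fun q : P ↦ rmul u q) p
      (tderiv (fun q : P ↦ rmul u q) p) :=
  hasTDerivAt_of_contMDiff (hπ.contMDiff_rmul_left u)

theorem IsPrincipalBundle.hasTDerivAt_proj
    (hπ : IsPrincipalBundle (EP := EP) (EB := EB) (EM := EM) P π) (u : B) :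
    HasTDerivAt (E := EB) (E' := EM) π u (tderiv π u) :=
  hasTDerivAt_of_contMDiff hπ.contMDiff_proj

variable [LieGroup 𝓘(ℝ, EP) ∞ P]

theorem IsPrincipalBundle.tderiv_rmul_left_leftField
    (hπ : IsPrincipalBundle (EP := EP) (EB := EB) (EM := EM) P π) (u : B) (q : P) (A : EP) :
    tderiv (E := EP) (E' := EB) (fun p : P ↦ rmul u p) q (leftField A q)
      = fund EB P A (rmul u q) := by
  have h1 : HasTDerivAt (E := EP) (E' := EB) (fun p : P ↦ rmul u p) ((fun a : P ↦ q * a) 1)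
      (tderiv (E := EP) (E' := EB) (fun p : P ↦ rmul u p) q) := by
    simp only [mul_one]
    exact hπ.hasTDerivAt_rmul_left q u
  have h2 := h1.comp (hasTDerivAt_mul_left q 1)
  have h3 : (fun p : P ↦ rmul u p) ∘ (fun a : P ↦ q * a) = fun a : P ↦ rmul (rmul u q) a := by
    funext a
    exact rmul_mul u q a
  rw [h3] at h2
  exact (DFunLike.congr_fun h2.tderiv_eq A).symm

theorem IsPrincipalBundle.dright_fund
    (hπ : IsPrincipalBundle (EP := EP) (EB := EB) (EM := EM) P π) (u : B) (q : P) (A : EP) :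
    dright EB q u (fund EB P A u) = fund EB P (adj q⁻¹ A) (rmul u q) := by
  have h1 : HasTDerivAt (fun w : B ↦ rmul w q) ((fun p : P ↦ rmul u p) 1) (dright EB q u) := by
    simp only [rmul_one]
    exact hπ.hasTDerivAt_rmul_right q u
  have h2 := h1.comp (hπ.hasTDerivAt_rmul_left 1 u)
  have h3 : HasTDerivAt (E := EP) (E' := EB) (fun p : P ↦ rmul (rmul u q) p)
      ((fun a : P ↦ q⁻¹ * a * q⁻¹⁻¹) 1) (tderiv (fun p : P ↦ rmul (rmul u q) p) 1) := by
    simp only [mul_one, inv_inv, inv_mul_cancel]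
    exact hπ.hasTDerivAt_rmul_left 1 _
  have h4 := HasTDerivAt.comp (f := fun a : P ↦ q⁻¹ * a * q⁻¹⁻¹) h3 (hasTDerivAt_conj q⁻¹ 1)
  have h5 : (fun w : B ↦ rmul w q) ∘ (fun p : P ↦ rmul u p)
      = (fun p : P ↦ rmul (rmul u q) p) ∘ (fun a : P ↦ q⁻¹ * a * q⁻¹⁻¹) := by
    funext a
    simp only [Function.comp_apply, ← rmul_mul]
    congr 1
    group
  rw [h5] at h2
  exact DFunLike.congr_fun (h2.unique h4) A

theorem IsPrincipalBundle.tderiv_proj_fund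
    (hπ : IsPrincipalBundle (EP := EP) (EB := EB) (EM := EM) P π) (u : B) (A : EP) :
    tderiv (E := EB) (E' := EM) π u (fund EB P A u) = 0 := by
  have h1 : HasTDerivAt (E := EB) (E' := EM) π ((fun p : P ↦ rmul u p) 1) (tderiv π u) := by
    simp only [rmul_one]
    exact hπ.hasTDerivAt_proj u
  have h2 := h1.comp (hπ.hasTDerivAt_rmul_left 1 u)
  have h3 : π ∘ (fun p : P ↦ rmul u p) = fun _ ↦ π u := by
    funext p
    exact hπ.proj_rmul u p
  rw [h3] at h2
  exact DFunLike.congr_fun (h2.unique (hasTDerivAt_const (1 : P) (π u))) A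

theorem exists_leftField_eq (q : P) (v : EP) : ∃ A : EP, leftField A q = v := by
  have h1 : HasTDerivAt (E := EP) (E' := EP) (fun a : P ↦ q * a) ((fun a : P ↦ q⁻¹ * a) q)
      (tderiv (fun a : P ↦ q * a) 1) := by
    simp only [inv_mul_cancel]
    exact hasTDerivAt_mul_left q 1
  have h2 := h1.comp (hasTDerivAt_mul_left q⁻¹ q)
  have h3 : (fun a : P ↦ q * a) ∘ (fun a : P ↦ q⁻¹ * a) = id := by
    funext a
    simp
  rw [h3] at h2
  exact ⟨_, DFunLike.congr_fun (h2.unique (hasTDerivAt_id q)) v⟩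

/-- Differentiate `w = s(π w).τ(w)` along a vertical vector: only the derivative of `τ` contributes,
and it is the value of a left invariant field. -/
theorem IsPrincipalBundle.exists_fund_eq [IsManifold 𝓘(ℝ, EB) ∞ B] [IsManifold 𝓘(ℝ, EM) ∞ M]
    (hπ : IsPrincipalBundle (EP := EP) (EB := EB) (EM := EM) P π) (u : B) {v : EB}
    (hv : tderiv (E := EB) (E' := EM) π u v = 0) : ∃ A : EP, fund EB P A u = v := by
  obtain ⟨U, hU, hx, s, τ, hs, hτ, h1, h2, h3⟩ := hπ.exists_localSection (π u)
  have hπU : IsOpen (π ⁻¹' U) := hU.preimage hπ.contMDiff_proj.continuous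
  have hs' : HasTDerivAt (E := EM) (E' := EB) s (π u) (tderiv s (π u)) :=
    hasTDerivAt_of_contMDiffAt (hs.contMDiffAt (hU.mem_nhds hx))
  have hτ' : HasTDerivAt (E := EB) (E' := EP) τ u (tderiv τ u) :=
    hasTDerivAt_of_contMDiffAt (hτ.contMDiffAt (hπU.mem_nhds hx))
  have h4 := hasTDerivAt_of_contMDiff_prod (Φ := fun z : B × P ↦ rmul z.1 z.2)
    hπ.contMDiff_rmul (hs'.comp (hπ.hasTDerivAt_proj u)) hτ'
  have h5 : HasTDerivAt (E := EB) (E' := EB) (fun w ↦ rmul ((s ∘ π) w) (τ w)) u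
      (ContinuousLinearMap.id ℝ EB) := by
    refine (hasTDerivAt_id u).congr_of_eventuallyEq ?_
    filter_upwards [hπU.mem_nhds hx] with w hw using h2 w hw
  have h6 := DFunLike.congr_fun (h5.unique h4) v
  obtain ⟨A, hA⟩ := exists_leftField_eq (τ u) (tderiv (E := EB) (E' := EP) τ u v)
  have h7 := hπ.tderiv_rmul_left_leftField (s (π u)) (τ u) A
  rw [h2 u hx, hA] at h7
  refine ⟨A, h7.symm.trans ?_⟩
  have h8 : (tderiv (E := EM) (E' := EB) s (π u)) (tderiv (E := EB) (E' := EM) π u v) = 0 := by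
    rw [hv, map_zero]
  simp only [ContinuousLinearMap.id_apply, add_apply,
    ContinuousLinearMap.comp_apply, h8, map_zero, zero_add] at h6
  exact h6.symm

theorem IsPrincipalBundle.tderiv_proj_surjective
    [IsManifold 𝓘(ℝ, EB) ∞ B] [IsManifold 𝓘(ℝ, EM) ∞ M]
    (hπ : IsPrincipalBundle (EP := EP) (EB := EB) (EM := EM) P π) (u : B) :
    Function.Surjective (tderiv (E := EB) (E' := EM) π u) := by
  obtain ⟨U, hU, hx, s, τ, hs, hτ, h1, h2, h3⟩ := hπ.exists_localSection (π u)
  have hs' : HasTDerivAt (E := EM) (E' := EB) s (π u) (tderiv s (π u)) :=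
    hasTDerivAt_of_contMDiffAt (hs.contMDiffAt (hU.mem_nhds hx))
  have h4 := (hπ.hasTDerivAt_rmul_right (τ u) (s (π u))).comp hs'
  have h5 : HasTDerivAt (E := EB) (E' := EM) π (((fun w : B ↦ rmul w (τ u)) ∘ s) (π u))
      (tderiv π u) := by
    have : ((fun w : B ↦ rmul w (τ u)) ∘ s) (π u) = u := h2 u hx
    rw [this]
    exact hπ.hasTDerivAt_proj u
  have h6 := h5.comp h4
  have h7 : HasTDerivAt (E := EM) (E' := EM) (π ∘ ((fun w : B ↦ rmul w (τ u)) ∘ s)) (π u)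
      (ContinuousLinearMap.id ℝ EM) := by
    refine (hasTDerivAt_id (π u)).congr_of_eventuallyEq ?_
    filter_upwards [hU.mem_nhds hx] with y hy
    exact (hπ.proj_rmul _ _).trans (h1 y hy)
  intro v
  exact ⟨_, DFunLike.congr_fun (h6.unique h7) v⟩

end Bundle
-- One-parameter subgroups and the vectors that they fix
section OneParameter

variable {F : Type*} [NormedAddCommGroup F] [NormedSpace ℝ F] [FiniteDimensional ℝ F]
  {H : Type*} [TopologicalSpace H] [ChartedSpace F H] [Group H] [LieGroup 𝓘(ℝ, F) ∞ H] [T2Space H]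

theorem eq_of_gexp_smul_eq {A A' : F} (h : ∀ s : ℝ, (gexp (s • A) : H) = gexp (s • A')) :
    A = A' := by
  have h1 := hasVelocityAt_gexp (H := H) A 0
  have h2 := hasVelocityAt_gexp (H := H) A' 0
  simp only [← h] at h2
  have h3 := h1.unique h2
  rw [zero_smul, gexp_zero, leftField_one, leftField_one] at h3
  exact h3

theorem gexp_smul_comm (A : F) (s t : ℝ) :
    (gexp (s • A) : H) * gexp (t • A) = gexp (t • A) * gexp (s • A) := by
  rw [← gexp_add_smul, ← gexp_add_smul, add_comm]

theorem adj_gexp_smul_self (A : F) (t : ℝ) : adj (gexp (t • A) : H) A = A := by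
  refine eq_of_gexp_smul_eq (H := H) fun s ↦ ?_
  rw [← map_smul, ← conj_gexp, gexp_smul_comm, mul_inv_cancel_right]

theorem adj_inv_gexp_smul_self (A : F) (t : ℝ) : adj (gexp (t • A) : H)⁻¹ A = A := by
  rw [← gexp_neg, ← neg_smul, adj_gexp_smul_self]

theorem inv_mul_gexp_mul (g : H) (A : F) : g⁻¹ * gexp A * g = gexp (adj g⁻¹ A) := by
  rw [← conj_gexp, inv_inv]

/-- The derivative of `Ad(exp(tA))Y` is `Ad(exp(tA))[A, Y]`, because `Ad(exp(tA))` fixes `A`. -/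
theorem forall_adj_gexp_eq_iff (A Y : F) :
    (∀ t : ℝ, adj (gexp (t • A) : H) Y = Y) ↔ lieBr H A Y = 0 := by
  constructor
  · intro h
    have h2 := hasDerivAt_adj_gexp_zero (H := H) A Y
    simp only [h] at h2
    exact h2.unique (hasDerivAt_const _ _)
  · intro h
    have h1 : ∀ t : ℝ, HasDerivAt (fun t : ℝ ↦ adj (gexp (t • A) : H) Y) 0 t := by
      intro t
      have h2 := hasDerivAt_adj_gexp (H := H) A Y t
      have h3 := adj_lieBr (gexp (t • A) : H) A Y
      rw [h, adj_gexp_smul_self, map_zero] at h3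
      rwa [← h3] at h2
    intro t
    have h4 := is_const_of_deriv_eq_zero (fun t ↦ (h1 t).differentiableAt)
      (fun t ↦ (h1 t).deriv) t 0
    simpa [gexp_zero, adj_one] using h4

end OneParameter

/-! ### Holonomy -/

section Holonomy

set_option linter.unusedSectionVars false

variable {EG : Type*} [NormedAddCommGroup EG] [NormedSpace ℝ EG] [FiniteDimensional ℝ EG]
  {EP : Type*} [NormedAddCommGroup EP] [NormedSpace ℝ EP] [FiniteDimensional ℝ EP]
  {EB : Type*} [NormedAddCommGroup EB] [NormedSpace ℝ EB] [FiniteDimensional ℝ EB]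
  {EM : Type*} [NormedAddCommGroup EM] [NormedSpace ℝ EM] [FiniteDimensional ℝ EM]
  {G : Type*} [TopologicalSpace G] [T2Space G] [ChartedSpace EG G] [Group G]
  [LieGroup 𝓘(ℝ, EG) ∞ G]
  {P : Subgroup G} [ChartedSpace EP P] [LieGroup 𝓘(ℝ, EP) ∞ P]
  {gr : Grading (GroupLieAlgebra 𝓘(ℝ, EG) G)}
  {B : Type*} [TopologicalSpace B] [T2Space B] [ChartedSpace EB B] [IsManifold 𝓘(ℝ, EB) ∞ B]
  {M : Type*} [TopologicalSpace M] [T2Space M] [ChartedSpace EM M] [IsManifold 𝓘(ℝ, EM) ∞ M]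
  [MulAction Pᵐᵒᵖ B] {π : B → M}
  {θ : ∀ u : B, TangentSpace 𝓘(ℝ, EB) u →L[ℝ] GroupLieAlgebra 𝓘(ℝ, EG) G}
  {XB : B → EB}

theorem IsInfinitesimalAutomorphism.dright_eq
    (hXB : IsInfinitesimalAutomorphism (EB := EB) P θ XB) (p : P) (u : B) :
    dright EB p u (XB u) = XB (rmul u p) := hXB.rightInvariant p u

theorem IsInfinitesimalAutomorphism.eq_fund_rmul
    (hπ : IsPrincipalBundle (EP := EP) (EB := EB) (EM := EM) P π)
    (hXB : IsInfinitesimalAutomorphism (EB := EB) P θ XB) {u : B} {A : EP}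
    (hA : XB u = fund EB P A u) (p : P) : XB (rmul u p) = fund EB P (adj p⁻¹ A) (rmul u p) := by
  rw [← hXB.dright_eq, hA, hπ.dright_fund]

/-- By right invariance `XB` at `u.exp(tA)` is the fundamental field of `Ad(exp(-tA))A = A`, which
is the velocity of the curve. -/
theorem IsInfinitesimalAutomorphism.hasVelocityAt_rmul_gexp
    (hπ : IsPrincipalBundle (EP := EP) (EB := EB) (EM := EM) P π)
    (hXB : IsInfinitesimalAutomorphism (EB := EB) P θ XB) {u : B} {A : EP}
    (hA : XB u = fund EB P A u) (t : ℝ) :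
    HasVelocityAt (fun t : ℝ ↦ rmul u (gexp (t • A) : P)) t
      (XB (rmul u (gexp (t • A) : P))) := by
  rw [hXB.eq_fund_rmul hπ hA, adj_inv_gexp_smul_self, ← hπ.tderiv_rmul_left_leftField]
  exact (hπ.hasTDerivAt_rmul_left (gexp (t • A) : P) u).hasVelocityAt_comp
    (hasVelocityAt_gexp (H := P) A t)

theorem IsInfinitesimalAutomorphism.isHolonomy_gexp
    (hπ : IsPrincipalBundle (EP := EP) (EB := EB) (EM := EM) P π)
    (hXB : IsInfinitesimalAutomorphism (EB := EB) P θ XB) {u : B} {A : EP}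
    (hA : XB u = fund EB P A u) :
    IsHolonomy (EB := EB) P XB u (fun t : ℝ ↦ (gexp (t • A) : P)) where
  map_add s t := gexp_add_smul A s t
  flow_eq := by
    refine ⟨1, one_pos, fun t _ ↦ ?_⟩
    have h := flow_eq_of_forall_hasVelocityAt hXB.smooth (hXB.hasVelocityAt_rmul_gexp hπ hA) t
    simp only [zero_smul, gexp_zero, rmul_one] at h
    exact h

/-- The action is free, so the two one-parameter groups agree for small times; every `t` is a
natural multiple of a small time. No continuity of `h` is needed. -/
theorem IsHolonomy.eq_gexp
    (hπ : IsPrincipalBundle (EP := EP) (EB := EB) (EM := EM) P π)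
    (hXB : IsInfinitesimalAutomorphism (EB := EB) P θ XB) {u : B} {A : EP}
    (hA : XB u = fund EB P A u) {h : ℝ → P} (hh : IsHolonomy (EB := EB) P XB u h) (t : ℝ) :
    h t = gexp (t • A) := by
  obtain ⟨ε, hε, hflow⟩ := hh.flow_eq
  obtain ⟨ε', hε', hflow'⟩ := (hXB.isHolonomy_gexp hπ hA).flow_eq
  have hsmall : ∀ s : ℝ, |s| < min ε ε' → h s = gexp (s • A) := by
    intro s hs
    have h1 := (hflow s (hs.trans_le (min_le_left _ _))).2
    have h2 := (hflow' s (hs.trans_le (min_le_right _ _))).2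
    exact hπ.rmul_injective u (h1.symm.trans h2)
  have h0 : h 0 = 1 := by
    have := hh.map_add 0 0
    rw [add_zero] at this
    exact left_eq_mul.1 this
  have hpow : ∀ (s : ℝ) (n : ℕ), h (n * s) = h s ^ n := by
    intro s n
    induction n with
    | zero => simp [h0]
    | succ n ih => rw [Nat.cast_succ, add_mul, one_mul, hh.map_add, ih, pow_succ]
  obtain ⟨n, hn⟩ := exists_nat_gt (|t| / min ε ε')
  have hm : 0 < min ε ε' := lt_min hε hε'
  have hn0 : (0 : ℝ) < n := lt_of_le_of_lt (by positivity) hn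
  have ht : t = n * (t / n) := by field_simp
  rw [ht, hpow, hsmall, ← gexp_nsmul, ← Nat.cast_smul_eq_nsmul ℝ, smul_smul]
  rw [abs_div, Nat.abs_cast, div_lt_iff₀ hn0]
  rw [div_lt_iff₀ hm] at hn
  linarith

theorem existsUnique_isHolonomy
    (hπ : IsPrincipalBundle (EP := EP) (EB := EB) (EM := EM) P π)
    (hXB : IsInfinitesimalAutomorphism (EB := EB) P θ XB) {u : B} {A : EP}
    (hA : XB u = fund EB P A u) : ∃! h : ℝ → P, IsHolonomy (EB := EB) P XB u h :=
  ⟨_, hXB.isHolonomy_gexp hπ hA, fun _ hh ↦ funext (hh.eq_gexp hπ hXB hA)⟩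

/-- `G₀` is the stabilizer of `E`, so the condition is `[A, E] = 0`; the kernel of `ad E` is `𝔤_0`.
-/
theorem gexp_smul_mem_G₀_iff (hP : IsParabolicPair (EP := EP) P gr) (A : EP) :
    (∀ t : ℝ, (gexp (t • A) : P) ∈ G₀ P gr) ↔ incl EG EP P A ∈ gr.comp 0 := by
  have := hP.isKilling
  obtain ⟨A', hA'⟩ : ∃ A' : GroupLieAlgebra 𝓘(ℝ, EG) G, A' = incl EG EP P A := ⟨_, rfl⟩
  have h1 : (∀ t : ℝ, Ad (gexp (F := EG) (t • incl EG EP P A) : G) gr.gradingElement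
      = gr.gradingElement) ↔ ⁅A', gr.gradingElement⁆ = 0 := by
    rw [hA']
    exact forall_adj_gexp_eq_iff (H := G) (F := EG) _ _
  have h2 : (∀ t : ℝ, (gexp (t • A) : P) ∈ G₀ P gr) ↔ ⁅A', gr.gradingElement⁆ = 0 := by
    rw [← h1]
    refine forall_congr' fun t ↦ ?_
    rw [mem_G₀_iff, coe_gexp hP.isClosedLieSubgroup, map_smul]
  have h3 : incl EG EP P A ∈ gr.comp 0 ↔ A' ∈ gr.comp 0 := by
    rw [hA']
    exact Iff.rfl
  rw [h2, h3, ← lie_skew, neg_eq_zero]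
  constructor
  · intro h
    exact gr.mem_comp_of_gradingElement_lie (by simpa using h)
  · intro h
    simpa using gr.gradingElement_lie h

theorem conj_holonomy_mem_G₀_iff
    (hP : IsParabolicPair (EP := EP) P gr)
    (hπ : IsPrincipalBundle (EP := EP) (EB := EB) (EM := EM) P π)
    (hXB : IsInfinitesimalAutomorphism (EB := EB) P θ XB) {u : B} {A : EP}
    (hA : XB u = fund EB P A u) {h : ℝ → P} (hh : IsHolonomy (EB := EB) P XB u h) (p : P) :
    (∀ t : ℝ, p⁻¹ * h t * p ∈ G₀ P gr) ↔ incl EG EP P (adj p⁻¹ A) ∈ gr.comp 0 := by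
  rw [← gexp_smul_mem_G₀_iff hP]
  refine forall_congr' fun t ↦ ?_
  rw [hh.eq_gexp hπ hXB hA, inv_mul_gexp_mul, map_smul]

theorem IsCartanConnection.apply_fund (hθ : IsCartanConnection (EP := EP) P θ) (A : EP) (u : B) :
    θ u (fund EB P A u) = incl EG EP P A := hθ.fundamental A u

theorem IsCartanConnection.apply_rmul (hθ : IsCartanConnection (EP := EP) P θ)
    (hXB : IsInfinitesimalAutomorphism (EB := EB) P θ XB) (u : B) (p : P) :
    θ (rmul u p) (XB (rmul u p)) = Ad ((p : G)⁻¹) (θ u (XB u)) := by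
  have h := hθ.equivariant p u (XB u)
  have h1 := hXB.rightInvariant p u
  exact (congrArg (θ (rmul u p)) h1).symm.trans h

end Holonomy
/-! ### The constant vector fields of a Cartan connection -/

section ConstantFields

set_option linter.unusedSectionVars false

open Set

/-- A bijective linear map between finite-dimensional spaces as a continuous linear equivalence. -/
def equivOfBijective {E F : Type*} [NormedAddCommGroup E] [NormedSpace ℝ E]
    [NormedAddCommGroup F] [NormedSpace ℝ F] [FiniteDimensional ℝ E] (L : E →L[ℝ] F)
    (hL : Function.Bijective L) : E ≃L[ℝ] F :=
  (LinearEquiv.ofBijective L.toLinearMap hL).toContinuousLinearEquiv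

variable {EG : Type*} [NormedAddCommGroup EG] [NormedSpace ℝ EG] [FiniteDimensional ℝ EG]
  {EP : Type*} [NormedAddCommGroup EP] [NormedSpace ℝ EP] [FiniteDimensional ℝ EP]
  {EB : Type*} [NormedAddCommGroup EB] [NormedSpace ℝ EB] [FiniteDimensional ℝ EB]
  {G : Type*} [TopologicalSpace G] [T2Space G] [ChartedSpace EG G] [Group G]
  [LieGroup 𝓘(ℝ, EG) ∞ G]
  {P : Subgroup G} [ChartedSpace EP P] [LieGroup 𝓘(ℝ, EP) ∞ P]
  {B : Type*} [TopologicalSpace B] [T2Space B] [ChartedSpace EB B] [IsManifold 𝓘(ℝ, EB) ∞ B]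
  [MulAction Pᵐᵒᵖ B]
  {θ : ∀ u : B, TangentSpace 𝓘(ℝ, EB) u →L[ℝ] GroupLieAlgebra 𝓘(ℝ, EG) G}
  {XB : B → EB}

/-- The Cartan connection at `u` as an isomorphism of the model spaces. -/
def IsCartanConnection.coframe (hθ : IsCartanConnection (EP := EP) P θ) (u : B) : EB ≃L[ℝ] EG :=
  equivOfBijective (E := EB) (F := EG) (θ u) (hθ.bijective u)

theorem IsCartanConnection.constField_eq (hθ : IsCartanConnection (EP := EP) P θ) (Y : EG)
    (u : B) : constField θ Y u = (hθ.coframe u).symm Y := by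
  have h : hθ.coframe u (constField θ Y u) = Y :=
    Function.rightInverse_invFun (hθ.bijective u).2 Y
  exact ((ContinuousLinearEquiv.eq_symm_apply (M₁ := EB) _).2 h)

/-- The value at `u` of the constant vector fields, as a linear map. -/
def IsCartanConnection.frame (hθ : IsCartanConnection (EP := EP) P θ) (u : B) : EG →ₗ[ℝ] EB :=
  (hθ.coframe u).symm.toLinearEquiv.toLinearMap

theorem IsCartanConnection.frame_eq (hθ : IsCartanConnection (EP := EP) P θ) (Y : EG) :
    constField θ Y = fun u ↦ hθ.frame u Y := funext fun u ↦ hθ.constField_eq Y u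

theorem IsCartanConnection.coframe_frame (hθ : IsCartanConnection (EP := EP) P θ) (u : B)
    (Y : EG) : hθ.coframe u (hθ.frame u Y) = Y := (hθ.coframe u).apply_symm_apply Y

theorem IsCartanConnection.eq_frame_iff (hθ : IsCartanConnection (EP := EP) P θ) {u : B}
    {v : EB} {Y : EG} : v = hθ.frame u Y ↔ hθ.coframe u v = Y :=
  ContinuousLinearEquiv.eq_symm_apply _

/-- The matrix of `θ` in the chart. It is smooth because `θ` is evaluated on the coordinate fields,
which are smooth curves of tangent vectors with constant component in the trivialization. -/
theorem IsCartanConnection.contDiffOn_coframe_comp (hθ : IsCartanConnection (EP := EP) P θ)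
    (a : B) :
    ContDiffOn ℝ ∞ (fun x ↦ ((hθ.coframe ((extChartAt 𝓘(ℝ, EB) a).symm x) : EB →L[ℝ] EG)).comp
      (tderiv (E := EB) (E' := EB) (extChartAt 𝓘(ℝ, EB) a).symm x))
      (extChartAt 𝓘(ℝ, EB) a).target := by
  refine contDiffOn_clm_apply.2 fun v ↦ ?_
  have hsrc : MapsTo (fun x ↦ (⟨(extChartAt 𝓘(ℝ, EB) a).symm x,
      tderiv (E := EB) (E' := EB) (extChartAt 𝓘(ℝ, EB) a).symm x v⟩ : TangentBundle 𝓘(ℝ, EB) B))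
      (extChartAt 𝓘(ℝ, EB) a).target (trivializationAt EB (TangentSpace 𝓘(ℝ, EB)) a).source := by
    intro x hx
    have := (extChartAt 𝓘(ℝ, EB) a).map_target hx
    rw [extChartAt_source] at this
    rw [Bundle.Trivialization.mem_source]
    exact this
  have h1 : ContMDiffOn 𝓘(ℝ, EB) 𝓘(ℝ, EB).tangent ∞
      (fun x ↦ (⟨(extChartAt 𝓘(ℝ, EB) a).symm x,
        tderiv (E := EB) (E' := EB) (extChartAt 𝓘(ℝ, EB) a).symm x v⟩ :
        TangentBundle 𝓘(ℝ, EB) B)) (extChartAt 𝓘(ℝ, EB) a).target := by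
    refine ((trivializationAt EB (TangentSpace 𝓘(ℝ, EB)) a).contMDiffOn_iff
      (IB := 𝓘(ℝ, EB)) (n := ∞) hsrc).2 ⟨contMDiffOn_extChartAt_symm a, ?_⟩
    refine (contMDiffOn_const (c := v)).congr fun x hx ↦ ?_
    have hx' := (extChartAt 𝓘(ℝ, EB) a).map_target hx
    rw [extChartAt_source] at hx'
    have h3 := TangentBundle.continuousLinearMapAt_trivializationAt (I := 𝓘(ℝ, EB)) hx'
    have h4 := DFunLike.congr_fun h3
      (tderiv (E := EB) (E' := EB) (extChartAt 𝓘(ℝ, EB) a).symm x v)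
    refine (Bundle.Trivialization.continuousLinearMapAt_apply_of_mem (R := ℝ)
      (trivializationAt EB (TangentSpace 𝓘(ℝ, EB)) a) (by exact hx') _).symm.trans (h4.trans ?_)
    exact tderiv_extChartAt_comp_symm hx v
  have h2 := hθ.contMDiff.comp_contMDiffOn h1
  exact contMDiffOn_iff_contDiffOn.1 h2

/-- In the chart the field is the inverse matrix of `θ` applied to `Y`, and inversion of invertible
operators is smooth. -/
theorem IsCartanConnection.isSmoothField_frame (hθ : IsCartanConnection (EP := EP) P θ)
    (Y : EG) : IsSmoothField (fun b ↦ hθ.frame b Y) := by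
  refine isSmoothField_of_contDiffAt_chartField fun a ↦ ?_
  set φ := extChartAt 𝓘(ℝ, EB) a with hφ
  let Q : EB → EB →L[ℝ] EG := fun x ↦ ((hθ.coframe (φ.symm x) : EB →L[ℝ] EG)).comp
    (tderiv (E := EB) (E' := EB) φ.symm x)
  have hQ : ∀ x ∈ φ.target, ∃ e : EB ≃L[ℝ] EG, (e : EB →L[ℝ] EG) = Q x := by
    intro x hx
    refine ⟨(ContinuousLinearEquiv.equivOfInverse (tderiv (E := EB) (E' := EB) φ.symm x)
      (tderiv (E := EB) (E' := EB) φ (φ.symm x)) (tderiv_extChartAt_comp_symm hx)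
      (fun v ↦ ?_)).trans (hθ.coframe (φ.symm x)), rfl⟩
    have h := tderiv_extChartAt_symm_comp (φ.map_target hx) v
    rwa [φ.right_inv hx] at h
  have hmem : φ a ∈ φ.target := mem_extChartAt_target a
  have hopen : φ.target ∈ 𝓝 (φ a) := (isOpen_extChartAt_target a).mem_nhds hmem
  obtain ⟨e, he⟩ := hQ _ hmem
  have h1 : ContDiffAt ℝ ∞ Q (φ a) := (hθ.contDiffOn_coframe_comp a).contDiffAt hopen
  have h2 : ContDiffAt ℝ ∞ (fun x ↦ ContinuousLinearMap.inverse (Q x)) (φ a) := by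
    have hinv : ContDiffAt ℝ ∞ (ContinuousLinearMap.inverse : (EB →L[ℝ] EG) → EG →L[ℝ] EB)
        (Q (φ a)) := by
      rw [← he]
      exact contDiffAt_map_inverse e
    exact hinv.comp (φ a) h1
  refine (h2.clm_apply (contDiffAt_const (c := Y))).congr_of_eventuallyEq ?_
  filter_upwards [hopen] with x hx
  obtain ⟨e', he'⟩ := hQ x hx
  have h3 : Q x (chartField a (fun b ↦ hθ.frame b Y) x) = Y := by
    have h4 := tderiv_symm_chartField (fun b ↦ hθ.frame b Y) hx
    have h5 := hθ.coframe_frame (φ.symm x) Y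
    rw [← h4] at h5
    exact h5
  rw [← he'] at h3 ⊢
  rw [ContinuousLinearMap.inverse_equiv]
  exact (ContinuousLinearEquiv.eq_symm_apply _).2 h3

/-- `θ(Ŷ)` is constant, so `(𝓛_X θ)(Ŷ) = -θ([X, Ŷ])`, and `θ` is injective on tangent spaces. -/
theorem IsInfinitesimalAutomorphism.bracketField_frame
    (hθ : IsCartanConnection (EP := EP) P θ)
    (hXB : IsInfinitesimalAutomorphism (EB := EB) P θ XB) (Y : EG) :
    bracketField XB (fun b ↦ hθ.frame b Y) = 0 := by
  funext u
  have h1 := congrFun (hXB.lieDeriv_eq_zero _ (hθ.isSmoothField_frame Y)) u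
  have h2 : formApply θ (fun b ↦ hθ.frame b Y) = fun _ ↦ Y := funext fun b ↦ hθ.coframe_frame b Y
  have h3 : fieldDeriv (B := B) XB (fun _ ↦ Y) u = 0 := by
    have := (hasTDerivAt_const (E := EB) (E' := EG) u Y).tderiv_eq
    exact DFunLike.congr_fun this (XB u)
  have h4 : fieldDeriv XB (formApply θ (fun b ↦ hθ.frame b Y)) u
      - hθ.coframe u (bracketField XB (fun b ↦ hθ.frame b Y) u) = 0 := h1
  rw [h2, h3, zero_sub, neg_eq_zero] at h4
  exact (hθ.coframe u).map_eq_zero_iff.1 h4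

theorem IsCartanConnection.dright_frame (hθ : IsCartanConnection (EP := EP) P θ) (g : P) (u : B)
    (Y : EG) : dright EB g u (hθ.frame u Y) = hθ.frame (rmul u g) (adj (g : G)⁻¹ Y) := by
  rw [hθ.eq_frame_iff]
  have h : hθ.coframe (rmul u g) (dright EB g u (hθ.frame u Y))
      = adj (F := EG) (g : G)⁻¹ (hθ.coframe u (hθ.frame u Y)) :=
    hθ.equivariant g u (hθ.frame u Y)
  refine h.trans ?_
  exact congrArg (adj (F := EG) (g : G)⁻¹) (hθ.coframe_frame u Y)

end ConstantFields
/-! ### Exponential coordinates of a Cartan connection -/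

section NormalCoordinates

set_option linter.unusedSectionVars false

open Set Metric

variable {EG : Type*} [NormedAddCommGroup EG] [NormedSpace ℝ EG] [FiniteDimensional ℝ EG]
  {EP : Type*} [NormedAddCommGroup EP] [NormedSpace ℝ EP] [FiniteDimensional ℝ EP]
  {EB : Type*} [NormedAddCommGroup EB] [NormedSpace ℝ EB] [FiniteDimensional ℝ EB]
  {EM : Type*} [NormedAddCommGroup EM] [NormedSpace ℝ EM] [FiniteDimensional ℝ EM]
  {G : Type*} [TopologicalSpace G] [T2Space G] [ChartedSpace EG G] [Group G]
  [LieGroup 𝓘(ℝ, EG) ∞ G]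
  {P : Subgroup G} [ChartedSpace EP P] [LieGroup 𝓘(ℝ, EP) ∞ P]
  {gr : Grading (GroupLieAlgebra 𝓘(ℝ, EG) G)}
  {B : Type*} [TopologicalSpace B] [T2Space B] [ChartedSpace EB B] [IsManifold 𝓘(ℝ, EB) ∞ B]
  {M : Type*} [TopologicalSpace M] [T2Space M] [ChartedSpace EM M] [IsManifold 𝓘(ℝ, EM) ∞ M]
  [MulAction Pᵐᵒᵖ B] {π : B → M}
  {θ : ∀ u : B, TangentSpace 𝓘(ℝ, EB) u →L[ℝ] GroupLieAlgebra 𝓘(ℝ, EG) G}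
  {XB : B → EB}

/-- On the ball of radius `ρ`, the map `F` is the exponential map of the Cartan connection at `v`. -/
structure IsNormalMap (hθ : IsCartanConnection (EP := EP) P θ) (v : B) (ρ : ℝ) (F : EG → B) :
    Prop where
  pos : 0 < ρ
  contMDiffOn : ContMDiffOn 𝓘(ℝ, EG) 𝓘(ℝ, EB) ∞ F (ball 0 ρ)
  map_zero : F 0 = v
  mem_source : ∀ Y ∈ ball (0 : EG) ρ, F Y ∈ (extChartAt 𝓘(ℝ, EB) v).source
  hasVelocityAt : ∀ (Y : EG) (s : ℝ), s • Y ∈ ball (0 : EG) ρ →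
    HasVelocityAt (fun s : ℝ ↦ F (s • Y)) s (hθ.frame (F (s • Y)) Y)

theorem exists_isNormalMap (hθ : IsCartanConnection (EP := EP) P θ) (v : B) :
    ∃ ρ F, IsNormalMap hθ v ρ F := by
  obtain ⟨ρ, hρ, F, h1, h2, h3, h4⟩ :=
    exists_contMDiffOn_timeOne hθ.frame hθ.isSmoothField_frame v
  exact ⟨ρ, F, hρ, h1, h2, h3, h4⟩

variable {hθ : IsCartanConnection (EP := EP) P θ} {v : B} {ρ : ℝ} {F : EG → B}

theorem IsNormalMap.flow_eq (hF : IsNormalMap hθ v ρ F) {Y : EG} (hY : Y ∈ ball (0 : EG) ρ) :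
    FlowDefined (constField θ Y) 1 v ∧ cartanExp θ v Y = F Y := by
  have h := flow_one_eq_of_hasVelocityAt (hθ.isSmoothField_frame Y) hY (hF.hasVelocityAt Y)
  rw [hF.map_zero] at h
  have h1 : FlowDefined (constField θ Y) 1 v ∧ flow (constField θ Y) 1 v = F Y := by
    rw [hθ.frame_eq]
    exact h
  exact h1

theorem IsNormalMap.hasTDerivAt_zero (hF : IsNormalMap hθ v ρ F) :
    HasTDerivAt (E := EG) (E' := EB) F 0 (LinearMap.toContinuousLinearMap (hθ.frame v)) := by
  have h0 : (0 : EG) ∈ ball (0 : EG) ρ := mem_ball_self hF.pos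
  have h1 : HasTDerivAt (E := EG) (E' := EB) F 0 (tderiv F 0) :=
    hasTDerivAt_of_contMDiffAt (hF.contMDiffOn.contMDiffAt (isOpen_ball.mem_nhds h0))
  have h2 : LinearMap.toContinuousLinearMap (hθ.frame v) = tderiv (E := EG) (E' := EB) F 0 := by
    ext Y
    have h3 : HasVelocityAt (fun s : ℝ ↦ s • Y) 0 Y := by
      refine hasVelocityAt_iff_hasDerivAt.2 ?_
      simpa using (hasDerivAt_id (0 : ℝ)).smul_const Y
    have h4 : HasTDerivAt (E := EG) (E' := EB) F ((0 : ℝ) • Y) (tderiv F 0) := by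
      rwa [zero_smul]
    have h5 := hF.hasVelocityAt Y 0 (by rwa [zero_smul])
    have h6 := h5.unique (h4.hasVelocityAt_comp h3)
    rw [zero_smul, hF.map_zero] at h6
    exact h6
  rw [h2]
  exact h1

theorem Grading.exists_sub_mem_nonneg {𝔤 : Type*} [LieRing 𝔤] [LieAlgebra ℝ 𝔤] (gr : Grading 𝔤)
    (x : 𝔤) : ∃ y ∈ gr.neg, x - y ∈ gr.nonneg := by
  have h : gr.neg ⊔ gr.nonneg = ⊤ := by
    rw [eq_top_iff, ← gr.isInternal.submodule_iSup_eq_top, iSup_le_iff]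
    intro i
    rcases lt_or_ge i 0 with hi | hi
    · exact (gr.comp_le_neg hi).trans le_sup_left
    · exact (gr.comp_le_nonneg hi).trans le_sup_right
  obtain ⟨y, hy, z, hz, hyz⟩ := Submodule.mem_sup.1 (h ▸ Submodule.mem_top : x ∈ gr.neg ⊔ gr.nonneg)
  exact ⟨y, hy, by rwa [← hyz, add_sub_cancel_left]⟩

/-- Projecting the constant vector fields at `v` identifies `𝔤_-` with the tangent space of the base. -/
theorem bijective_tderiv_proj_frame (hP : IsParabolicPair (EP := EP) P gr)
    (hπ : IsPrincipalBundle (EP := EP) (EB := EB) (EM := EM) P π)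
    (hθ : IsCartanConnection (EP := EP) P θ) (v : B) :
    Function.Bijective (fun Y : negSpace gr ↦
      tderiv (E := EB) (E' := EM) π v (hθ.frame v (Y : EG))) := by
  constructor
  · intro Y Y' hYY'
    have h1 : tderiv (E := EB) (E' := EM) π v (hθ.frame v ((Y - Y' : negSpace gr) : EG)) = 0 := by
      -- A difference in the kernel is vertical, so its value under `θ` lies in `𝔭 ∩ 𝔤_- = 0`.
      rw [Submodule.coe_sub, map_sub, map_sub, sub_eq_zero]
      exact hYY'
    obtain ⟨A, hA⟩ := hπ.exists_fund_eq v h1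
    have h2 := hθ.apply_fund A v
    rw [hA] at h2
    have h3 : ((Y - Y' : negSpace gr) : EG) = incl EG EP P A := by
      rw [← h2]
      exact (hθ.coframe_frame v _).symm
    have h4 : ((Y - Y' : negSpace gr) : EG) ∈ gr.nonneg := by
      rw [h3]
      exact incl_mem_nonneg hP A
    have h5 := gr.eq_zero_of_mem_nonneg_of_mem_neg h4 (Y - Y').2
    exact sub_eq_zero.1 (Subtype.ext h5)
  · intro w
    obtain ⟨z, rfl⟩ := hπ.tderiv_proj_surjective v w
    -- The part of `θ(z)` in `𝔭` comes from a fundamental field, which `π` kills.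
    obtain ⟨(y : EG), hy, hz⟩ := gr.exists_sub_mem_nonneg (hθ.coframe v z)
    obtain ⟨A, hA⟩ := exists_incl_eq hP hz
    refine ⟨⟨y, hy⟩, ?_⟩
    have h1 : z - hθ.frame v y = fund EB P A v := by
      refine (hθ.coframe v).injective ?_
      rw [map_sub, hθ.coframe_frame]
      exact (hA.symm.trans (hθ.apply_fund A v).symm)
    have h2 := hπ.tderiv_proj_fund v A
    rw [← h1, map_sub, sub_eq_zero] at h2
    exact h2.symm

theorem bijective_tderiv_extChartAt {N : Type*} [TopologicalSpace N] [ChartedSpace EM N]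
    [IsManifold 𝓘(ℝ, EM) ∞ N] (a : N) :
    Function.Bijective (tderiv (E := EM) (E' := EM) (extChartAt 𝓘(ℝ, EM) a) a) := by
  have ha : a ∈ (extChartAt 𝓘(ℝ, EM) a).source := mem_extChartAt_source a
  refine Function.bijective_iff_has_inverse.2
    ⟨tderiv (E := EM) (E' := EM) (extChartAt 𝓘(ℝ, EM) a).symm (extChartAt 𝓘(ℝ, EM) a a),
      tderiv_extChartAt_symm_comp ha, fun v ↦ ?_⟩
  have h := tderiv_extChartAt_comp_symm ((extChartAt 𝓘(ℝ, EM) a).map_source ha) v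
  rwa [(extChartAt 𝓘(ℝ, EM) a).left_inv ha] at h

/-- The exponential coordinates on the base. -/
theorem IsNormalMap.exists_partialDiffeomorph (hP : IsParabolicPair (EP := EP) P gr)
    (hπ : IsPrincipalBundle (EP := EP) (EB := EB) (EM := EM) P π) (hF : IsNormalMap hθ v ρ F) :
    ∃ Ψ : PartialDiffeomorph 𝓘(ℝ, negSpace gr) 𝓘(ℝ, EM) (negSpace gr) M ∞,
      (0 : negSpace gr) ∈ Ψ.source ∧
      ∀ Y ∈ Ψ.source, (Y : EG) ∈ ball (0 : EG) ρ ∧ Ψ Y = π (F (Y : EG)) := by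
  set φ := extChartAt 𝓘(ℝ, EM) (π v) with hφ
  let D₀ : Set (negSpace gr) := {Y | (Y : EG) ∈ ball (0 : EG) ρ}
  have hD₀ : IsOpen D₀ := isOpen_ball.preimage continuous_subtype_val
  let f₀ : negSpace gr → M := fun Y ↦ π (F (Y : EG))
  have hval : ContMDiff 𝓘(ℝ, negSpace gr) 𝓘(ℝ, EG) ∞ (fun Y : negSpace gr ↦ (Y : EG)) :=
    (negSpace gr).subtypeL.contDiff.contMDiff
  have hf₀ : ContMDiffOn 𝓘(ℝ, negSpace gr) 𝓘(ℝ, EM) ∞ f₀ D₀ :=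
    hπ.contMDiff_proj.comp_contMDiffOn (hF.contMDiffOn.comp hval.contMDiffOn fun Y hY ↦ hY)
  let D : Set (negSpace gr) := D₀ ∩ f₀ ⁻¹' φ.source
  have hD : IsOpen D := hf₀.continuousOn.isOpen_inter_preimage hD₀ (isOpen_extChartAt_source _)
  have hf0 : f₀ 0 = π v := by
    change π (F ((0 : negSpace gr) : EG)) = π v
    rw [Submodule.coe_zero, hF.map_zero]
  have h0 : (0 : negSpace gr) ∈ D := by
    refine ⟨mem_ball_self hF.pos, ?_⟩
    rw [mem_preimage, hf0]
    exact mem_extChartAt_source _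
  have hf : ContDiffOn ℝ ∞ (fun Y ↦ φ (f₀ Y)) D := by
    rw [← contMDiffOn_iff_contDiffOn]
    refine (contMDiffOn_extChartAt (I := 𝓘(ℝ, EM)) (x := π v)).comp (hf₀.mono inter_subset_left) ?_
    intro Y hY
    have := hY.2
    rwa [mem_preimage, hφ, extChartAt_source] at this
  have hderiv : HasTDerivAt (E := negSpace gr) (E' := EM) (fun Y ↦ φ (f₀ Y)) 0
      ((tderiv (E := EM) (E' := EM) φ (π v)).comp ((tderiv (E := EB) (E' := EM) π v).comp
        ((LinearMap.toContinuousLinearMap (hθ.frame v)).comp (negSpace gr).subtypeL))) := by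
    have h1 : HasTDerivAt (E := negSpace gr) (E' := EG) (fun Y : negSpace gr ↦ (Y : EG)) 0
        (negSpace gr).subtypeL := hasTDerivAt_iff_hasFDerivAt.2
      (ContinuousLinearMap.hasFDerivAt ((negSpace gr).subtypeL : negSpace gr →L[ℝ] EG))
    have h2 := HasTDerivAt.comp (f := fun Y : negSpace gr ↦ (Y : EG)) (a := 0)
      hF.hasTDerivAt_zero h1
    have h3 := HasTDerivAt.comp (E' := EB) (E'' := EM) (g := π) (a := (0 : negSpace gr))
      (f := F ∘ fun Y : negSpace gr ↦ (Y : EG)) (L' := tderiv π v)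
      (by
        have : (F ∘ fun Y : negSpace gr ↦ (Y : EG)) 0 = v := hF.map_zero
        rw [this]
        exact hπ.hasTDerivAt_proj v) h2
    exact HasTDerivAt.comp (E' := EM) (E'' := EM) (g := φ) (a := (0 : negSpace gr))
      (f := f₀) (L' := tderiv φ (π v))
      (by rw [hf0]; exact hasTDerivAt_extChartAt (mem_extChartAt_source _)) h3
  have hbij : Function.Bijective ((tderiv (E := EM) (E' := EM) φ (π v)).comp
      ((tderiv (E := EB) (E' := EM) π v).comp
        ((LinearMap.toContinuousLinearMap (hθ.frame v)).comp (negSpace gr).subtypeL))) :=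
    (bijective_tderiv_extChartAt (π v)).comp (bijective_tderiv_proj_frame hP hπ hθ v)
  obtain ⟨h, hh0, hhD, hhf, hhs⟩ := exists_openPartialHomeomorph_contDiffOn_symm hD h0 hf
    (equivOfBijective _ hbij) (hasTDerivAt_iff_hasFDerivAt.1 hderiv)
  -- `h` is the local inverse function for the coordinate expression `φ ∘ f₀`. Its source lies in
  -- `D`, where `f₀` stays in the chart domain, so the chart cancels and `e = f₀` there.
  let e := h.trans (chartAt EM (π v)).symm
  have hval' : ∀ Y ∈ h.source, e Y = f₀ Y := by
    intro Y hY
    have h1 : h Y = φ (f₀ Y) := congrFun hhf Y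
    have h2 : e Y = φ.symm (h Y) := rfl
    rw [h2, h1]
    exact φ.left_inv (hhD hY).2
  have hsrc : e.source = h.source := by
    refine Subset.antisymm (fun Y hY ↦ ?_) fun Y hY ↦ ?_
    · exact ((h.trans_source (chartAt EM (π v)).symm).subset hY).1
    · rw [h.trans_source]
      refine ⟨hY, ?_⟩
      have h1 : h Y = φ (f₀ Y) := congrFun hhf Y
      have h2 := φ.map_source (hhD hY).2
      rw [← h1, hφ] at h2
      simpa using h2
  refine ⟨⟨e.toPartialEquiv, e.open_source, e.open_target, ?_, ?_⟩, ?_, fun Y hY ↦ ?_⟩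
  · refine (hf₀.mono fun Y hY ↦ ?_).congr fun Y hY ↦ hval' Y ?_
    · rw [hsrc] at hY
      exact (hhD hY).1
    · rwa [hsrc] at hY
  · refine (contMDiffOn_iff_contDiffOn.2 hhs).comp
      ((contMDiffOn_chart (I := 𝓘(ℝ, EM)) (x := π v)).mono fun y hy ↦ ?_) fun y hy ↦ ?_
    · exact ((h.trans_target (chartAt EM (π v)).symm).subset hy).1
    · exact ((h.trans_target (chartAt EM (π v)).symm).subset hy).2
  · change (0 : negSpace gr) ∈ e.source
    rwa [hsrc]
  · have hY' : Y ∈ h.source := hsrc ▸ hY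
    exact ⟨(hhD hY').1, hval' Y hY'⟩

end NormalCoordinates
/-! ### Infinitesimal automorphisms in exponential coordinates -/

section AutomorphismsInCoordinates

set_option linter.unusedSectionVars false

open Set Metric

variable {EG : Type*} [NormedAddCommGroup EG] [NormedSpace ℝ EG] [FiniteDimensional ℝ EG]
  {EP : Type*} [NormedAddCommGroup EP] [NormedSpace ℝ EP] [FiniteDimensional ℝ EP]
  {EB : Type*} [NormedAddCommGroup EB] [NormedSpace ℝ EB] [FiniteDimensional ℝ EB]
  {EM : Type*} [NormedAddCommGroup EM] [NormedSpace ℝ EM] [FiniteDimensional ℝ EM]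
  {G : Type*} [TopologicalSpace G] [T2Space G] [ChartedSpace EG G] [Group G]
  [LieGroup 𝓘(ℝ, EG) ∞ G]
  {P : Subgroup G} [ChartedSpace EP P] [LieGroup 𝓘(ℝ, EP) ∞ P]
  {gr : Grading (GroupLieAlgebra 𝓘(ℝ, EG) G)}
  {B : Type*} [TopologicalSpace B] [T2Space B] [ChartedSpace EB B] [IsManifold 𝓘(ℝ, EB) ∞ B]
  {M : Type*} [TopologicalSpace M] [T2Space M] [ChartedSpace EM M] [IsManifold 𝓘(ℝ, EM) ∞ M]
  [MulAction Pᵐᵒᵖ B] {π : B → M}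
  {θ : ∀ u : B, TangentSpace 𝓘(ℝ, EB) u →L[ℝ] GroupLieAlgebra 𝓘(ℝ, EG) G}
  {XB : B → EB} {hθ : IsCartanConnection (EP := EP) P θ} {v : B} {ρ : ℝ} {F : EG → B}

theorem contMDiff_gexp_smul (A : EP) :
    ContMDiff 𝓘(ℝ, ℝ) 𝓘(ℝ, EP) ∞ (fun t : ℝ ↦ (gexp (t • A) : P)) :=
  contMDiff_gexp.comp (contDiff_id.smul contDiff_const).contMDiff

theorem contDiff_adj_gexp_smul (hP : IsClosedLieSubgroup (EG := EG) (EP := EP) P) (A : EP)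
    (Y : EG) : ContDiff ℝ ∞ (fun t : ℝ ↦ adj ((gexp (t • A) : P) : G) Y) := by
  have h : ContMDiff 𝓘(ℝ, ℝ) 𝓘(ℝ, EG →L[ℝ] EG) ∞
      (fun t : ℝ ↦ adj (F := EG) ((gexp (t • A) : P) : G)) :=
    contMDiff_adj.comp (hP.contMDiff_coe.comp (contMDiff_gexp_smul A))
  exact (contMDiff_iff_contDiff.1 h).clm_apply contDiff_const

theorem coe_gexp_zero_smul (A : EP) : ((gexp ((0 : ℝ) • A) : P) : G) = 1 := by
  rw [zero_smul, gexp_zero, Subgroup.coe_one]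

/-- In the variation `K(t, s) = F(s Ad(exp(tA))Y).exp(tA)`, equivariance of `θ` makes each curve `s
↦ K(t, s)` an integral curve of the same constant field `Ŷ`. At `s = 0` the variation is the
integral curve `v.exp(tA)` of `XB`. As `XB` commutes with `Ŷ`, the velocity in `t` at `t = 0` is
`XB` along the whole curve. -/
theorem IsNormalMap.hasVelocityAt_zero_rmul_gexp
    (hP : IsClosedLieSubgroup (EG := EG) (EP := EP) P)
    (hπ : IsPrincipalBundle (EP := EP) (EB := EB) (EM := EM) P π)
    (hXB : IsInfinitesimalAutomorphism (EB := EB) P θ XB) (hF : IsNormalMap hθ v ρ F)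
    {A : EP} (hA : XB v = fund EB P A v) {Y : EG} (hY : Y ∈ ball (0 : EG) ρ) :
    HasVelocityAt (fun t : ℝ ↦ rmul (F (adj ((gexp (t • A) : P) : G) Y)) (gexp (t • A) : P)) 0
      (XB (F Y)) := by
  let f : ℝ × ℝ → EG := fun z ↦ z.2 • adj ((gexp (z.1 • A) : P) : G) Y
  let K : ℝ × ℝ → B := fun z ↦ rmul (F (f z)) (gexp (z.1 • A) : P)
  have hf : ContDiff ℝ ∞ f :=
    contDiff_snd.smul ((contDiff_adj_gexp_smul hP A Y).comp contDiff_fst)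
  have hf0 : ∀ s, f (0, s) = s • Y := by
    intro s
    simp only [f, coe_gexp_zero_smul, adj_one]
  have hK0 : ∀ s, K (0, s) = F (s • Y) := by
    intro s
    simp only [K, hf0, zero_smul, gexp_zero, rmul_one]
  have hmem : ∀ s ∈ Icc (0 : ℝ) 1, f (0, s) ∈ ball (0 : EG) ρ := by
    intro s hs
    rw [hf0, mem_ball_zero_iff, norm_smul, Real.norm_of_nonneg hs.1]
    rw [mem_ball_zero_iff] at hY
    exact (mul_le_of_le_one_left (norm_nonneg _) hs.2).trans_lt hY
  have h1 := hasVelocityAt_of_bracketField_eq_zero hXB.smooth (hθ.isSmoothField_frame Y)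
    (hXB.bracketField_frame hθ Y) v (K := K) ?_ ?_ ?_ ?_ 1 ⟨zero_le_one, le_rfl⟩
  · rw [hK0, one_smul] at h1
    simpa only [K, f, one_smul] using h1
  · intro s hs
    have h2 : ContMDiffAt 𝓘(ℝ, ℝ × ℝ) 𝓘(ℝ, EB) ∞ (fun z ↦ F (f z)) (0, s) :=
      ContMDiffAt.comp (0, s)
        (hF.contMDiffOn.contMDiffAt (isOpen_ball.mem_nhds (hmem s hs))) hf.contMDiff.contMDiffAt
    have h3 : ContMDiffAt 𝓘(ℝ, ℝ × ℝ) 𝓘(ℝ, EP) ∞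
        (fun z : ℝ × ℝ ↦ (gexp (z.1 • A) : P)) (0, s) :=
      ((contMDiff_gexp_smul A).comp contDiff_fst.contMDiff).contMDiffAt
    exact hπ.contMDiff_rmul.contMDiffAt.comp (0, s) (h2.prodMk h3)
  · intro s hs
    rw [hK0, ← hf0]
    exact hF.mem_source _ (hmem s hs)
  · intro s hs
    filter_upwards [hf.continuous.continuousAt.eventually (isOpen_ball.mem_nhds (hmem s hs))]
      with z hz
    have h2 := (hπ.hasTDerivAt_rmul_right (gexp (z.1 • A) : P) (F (f z))).hasVelocityAt_comp
      (hF.hasVelocityAt (adj ((gexp (z.1 • A) : P) : G) Y) z.2 hz)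
    have h3 := hθ.dright_frame (gexp (z.1 • A) : P) (F (f z)) (adj ((gexp (z.1 • A) : P) : G) Y)
    rw [adj_inv_adj] at h3
    rw [← h3]
    exact h2
  · have h2 := hXB.hasVelocityAt_rmul_gexp hπ hA 0
    have h3 : (fun t : ℝ ↦ K (t, 0)) = fun t ↦ rmul v (gexp (t • A) : P) := by
      funext t
      simp only [K, f, zero_smul, hF.map_zero]
    rw [h3, hK0, zero_smul, hF.map_zero]
    rwa [zero_smul, gexp_zero, rmul_one] at h2

/-- Reduces to time zero: the curve after time `t` is the same curve started at `Ad(exp(tA))Y` and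
translated by `exp(tA)q`, and `XB` is right invariant. -/
theorem IsNormalMap.hasVelocityAt_rmul_gexp
    (hP : IsClosedLieSubgroup (EG := EG) (EP := EP) P)
    (hπ : IsPrincipalBundle (EP := EP) (EB := EB) (EM := EM) P π)
    (hXB : IsInfinitesimalAutomorphism (EB := EB) P θ XB) (hF : IsNormalMap hθ v ρ F)
    {A : EP} (hA : XB v = fund EB P A v) {Y : EG} (q : P) {t : ℝ}
    (hY : adj ((gexp (t • A) : P) : G) Y ∈ ball (0 : EG) ρ) :
    HasVelocityAt
      (fun t : ℝ ↦ rmul (F (adj ((gexp (t • A) : P) : G) Y)) ((gexp (t • A) : P) * q)) t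
      (XB (rmul (F (adj ((gexp (t • A) : P) : G) Y)) ((gexp (t • A) : P) * q))) := by
  have h1 := hF.hasVelocityAt_zero_rmul_gexp hP hπ hXB hA hY
  rw [← sub_self t] at h1
  have h2 := h1.scomp (c := fun s ↦ s - t) (c' := 1) ((hasDerivAt_id t).sub_const t)
  rw [one_smul] at h2
  have h3 := hπ.hasTDerivAt_rmul_right ((gexp (t • A) : P) * q)
    (F (adj ((gexp (t • A) : P) : G) Y))
  let γ : ℝ → B := fun s ↦ rmul (F (adj ((gexp ((s - t) • A) : P) : G)
    (adj ((gexp (t • A) : P) : G) Y))) (gexp ((s - t) • A) : P)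
  have h4 : γ t = F (adj ((gexp (t • A) : P) : G) Y) := by
    simp only [γ, sub_self, zero_smul, gexp_zero, Subgroup.coe_one, adj_one, rmul_one]
  rw [← h4] at h3
  have h5 := h3.hasVelocityAt_comp (γ := γ) h2
  rw [h4] at h5
  rw [hXB.dright_eq] at h5
  refine h5.congr_of_eventuallyEq (Filter.Eventually.of_forall fun s ↦ ?_)
  have h6 : (gexp (s • A) : P) = gexp ((s - t) • A) * gexp (t • A) := by
    rw [← gexp_add_smul, sub_add_cancel]
  simp only [γ, h6, Subgroup.coe_mul, adj_mul, ← rmul_mul, mul_assoc]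

/-- The flow of an infinitesimal automorphism in exponential coordinates. -/
theorem IsNormalMap.flow_rmul
    (hP : IsClosedLieSubgroup (EG := EG) (EP := EP) P)
    (hπ : IsPrincipalBundle (EP := EP) (EB := EB) (EM := EM) P π)
    (hXB : IsInfinitesimalAutomorphism (EB := EB) P θ XB) (hF : IsNormalMap hθ v ρ F)
    {A : EP} (hA : XB v = fund EB P A v) {Y : EG} (q : P) {t : ℝ} {a b : ℝ}
    (h0 : (0 : ℝ) ∈ Ioo a b) (ht : t ∈ Ioo a b)
    (hY : ∀ s ∈ Ioo a b, adj ((gexp (s • A) : P) : G) Y ∈ ball (0 : EG) ρ) :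
    flow (E := EB) XB t (rmul (F Y) q)
      = rmul (F (adj ((gexp (t • A) : P) : G) Y)) ((gexp (t • A) : P) * q) := by
  have h := (flow_eq_of_hasVelocityAt hXB.smooth h0 ht
    fun s hs ↦ hF.hasVelocityAt_rmul_gexp hP hπ hXB hA q (hY s hs)).2
  simpa only [zero_smul, gexp_zero, Subgroup.coe_one, adj_one, rmul_one, one_mul] using h

end AutomorphismsInCoordinates
/-! ### Local Weyl structures -/

section WeylStructures

set_option linter.unusedSectionVars false

open Set Metric

variable {EG : Type*} [NormedAddCommGroup EG] [NormedSpace ℝ EG] [FiniteDimensional ℝ EG]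
  {EP : Type*} [NormedAddCommGroup EP] [NormedSpace ℝ EP] [FiniteDimensional ℝ EP]
  {EB : Type*} [NormedAddCommGroup EB] [NormedSpace ℝ EB] [FiniteDimensional ℝ EB]
  {EM : Type*} [NormedAddCommGroup EM] [NormedSpace ℝ EM] [FiniteDimensional ℝ EM]
  {G : Type*} [TopologicalSpace G] [T2Space G] [ChartedSpace EG G] [Group G]
  [LieGroup 𝓘(ℝ, EG) ∞ G]
  {P : Subgroup G} [ChartedSpace EP P] [LieGroup 𝓘(ℝ, EP) ∞ P]
  {gr : Grading (GroupLieAlgebra 𝓘(ℝ, EG) G)}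
  {B : Type*} [TopologicalSpace B] [T2Space B] [ChartedSpace EB B] [IsManifold 𝓘(ℝ, EB) ∞ B]
  {M : Type*} [TopologicalSpace M] [T2Space M] [ChartedSpace EM M] [IsManifold 𝓘(ℝ, EM) ∞ M]
  [MulAction Pᵐᵒᵖ B] {π : B → M}
  {θ : ∀ u : B, TangentSpace 𝓘(ℝ, EB) u →L[ℝ] GroupLieAlgebra 𝓘(ℝ, EG) G}
  {XB : B → EB} {hθ : IsCartanConnection (EP := EP) P θ} {v : B} {ρ : ℝ} {F : EG → B}

theorem projPlus_rmul (w : B) {n : P} (hn : n ∈ Pplus EP P gr) :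
    projPlus EP P gr (rmul w n) = projPlus EP P gr w :=
  Quotient.sound ⟨⟨MulOpposite.op n, hn⟩, rfl⟩

theorem exists_out_projPlus (w : B) :
    ∃ n ∈ Pplus EP P gr, Quotient.out (projPlus EP P gr w) = rmul w n := by
  obtain ⟨⟨g, hg⟩, h⟩ := Quotient.exact (Quotient.out_eq (projPlus EP P gr w))
  exact ⟨g.unop, hg, h.symm⟩

/-- The fibre coordinate defined by a local section. -/
theorem IsPrincipalBundle.exists_fiberCoordinate
    (hπ : IsPrincipalBundle (EP := EP) (EB := EB) (EM := EM) P π) {U : Set M} (hU : IsOpen U)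
    {s : M → B} (hs : ContMDiffOn 𝓘(ℝ, EM) 𝓘(ℝ, EB) ∞ s U) (hsec : ∀ y ∈ U, π (s y) = y) :
    ∃ τ : B → P, ContMDiffOn 𝓘(ℝ, EB) 𝓘(ℝ, EP) ∞ τ (π ⁻¹' U) ∧
      (∀ w, π w ∈ U → rmul (s (π w)) (τ w) = w) ∧
      ∀ y ∈ U, ∀ p : P, τ (rmul (s y) p) = p := by
  have hex : ∀ w, ∃ p : P, π w ∈ U → rmul (s (π w)) p = w := by
    intro w
    by_cases hw : π w ∈ U
    · obtain ⟨U', -, hx, s', τ', -, -, -, h2, -⟩ := hπ.exists_localSection (π w)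
      -- The quotient of the fibre coordinates of `w` and of the section point, in any local
      -- trivialization. The same formula gives smoothness of `τ` below.
      refine ⟨(τ' (s (π w)))⁻¹ * τ' w, fun _ ↦ ?_⟩
      have h3 := h2 (s (π w)) (by rwa [hsec _ hw])
      rw [hsec _ hw] at h3
      nth_rw 1 [← h3]
      rw [← rmul_mul, mul_inv_cancel_left, h2 w hx]
    · exact ⟨1, fun h ↦ absurd h hw⟩
  choose τ hτ using hex
  refine ⟨τ, fun w₀ hw₀ ↦ ?_, hτ, fun y hy p ↦ ?_⟩
  · obtain ⟨U', hU', hx, s', τ', hs', hτ', h1, h2, h3⟩ := hπ.exists_localSection (π w₀)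
    have hw₀' : π w₀ ∈ U := hw₀
    have hcont : Continuous π := hπ.contMDiff_proj.continuous
    have h4 : ContMDiffAt 𝓘(ℝ, EB) 𝓘(ℝ, EP) ∞ τ' w₀ :=
      hτ'.contMDiffAt ((hU'.preimage hcont).mem_nhds hx)
    have h5 : ContMDiffAt 𝓘(ℝ, EB) 𝓘(ℝ, EB) ∞ (fun w ↦ s (π w)) w₀ :=
      ContMDiffAt.comp w₀ (hs.contMDiffAt (hU.mem_nhds hw₀)) hπ.contMDiff_proj.contMDiffAt
    have h6 : ContMDiffAt 𝓘(ℝ, EB) 𝓘(ℝ, EP) ∞ (fun w ↦ τ' (s (π w))) w₀ := by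
      refine ContMDiffAt.comp w₀ (hτ'.contMDiffAt ((hU'.preimage hcont).mem_nhds ?_)) h5
      rw [mem_preimage, hsec _ hw₀']
      exact hx
    refine ((h6.inv.mul h4).congr_of_eventuallyEq ?_).contMDiffWithinAt
    filter_upwards [(hU.preimage hcont).mem_nhds hw₀, (hU'.preimage hcont).mem_nhds hx]
      with w hw hw'
    have h7 := h3 (s (π w)) (by rw [hsec _ hw]; exact hw') (τ w)
    rw [hτ w hw] at h7
    exact eq_inv_mul_of_mul_eq h7.symm
  · have h1 := hτ (rmul (s y) p) (by rw [hπ.proj_rmul, hsec y hy]; exact hy)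
    rw [hπ.proj_rmul, hsec y hy] at h1
    exact hπ.rmul_injective (s y) h1

theorem Ad_mem_neg {q : P} (hq : q ∈ G₀ P gr) {Y : EG} (hY : Y ∈ negSpace gr) :
    adj (q : G) Y ∈ negSpace gr := by
  have h : gr.neg ≤ gr.neg.comap (Ad (q : G)).toLinearMap :=
    iSup₂_le fun i hi x hx ↦ gr.comp_le_neg hi ((hq i x).2 hx)
  exact h hY

/-- If the infinitesimal automorphism is vertical at `v`, in the direction of a one-parameter subgroup
of `G_0`, then it preserves the local Weyl structure defined by exponential coordinates at `v`. -/
theorem exists_isLocalWeylStructure (hP : IsParabolicPair (EP := EP) P gr)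
    (hπ : IsPrincipalBundle (EP := EP) (EB := EB) (EM := EM) P π)
    (hθ : IsCartanConnection (EP := EP) P θ)
    (hXB : IsInfinitesimalAutomorphism (EB := EB) P θ XB) (v : B) {A : EP}
    (hA : XB v = fund EB P A v) (hG₀ : ∀ t : ℝ, (gexp (t • A) : P) ∈ G₀ P gr) :
    ∃ (U : Set M) (σ : OrbitSpace EP P B gr → B), π v ∈ U ∧
      IsLocalWeylStructure (EB := EB) P gr π U σ ∧
      LieDerivWeylEqZero (EB := EB) P gr π XB U σ ∧
      IsExponentialWeyl (EM := EM) P gr θ π v U σ := by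
  have := hP.isKilling
  obtain ⟨ρ, F, hF⟩ := exists_isNormalMap hθ v
  obtain ⟨Ψ, hΨ0, hΨ⟩ := hF.exists_partialDiffeomorph hP hπ
  obtain ⟨r, hr, hrG, hrP, hrn, hrg, hgr, hrid⟩ := exists_retraction hP
  have hmemU : ∀ Y ∈ Ψ.source, π (F (Y : EG)) ∈ Ψ.target := fun Y hY ↦ by
    rw [← (hΨ Y hY).2]
    exact Ψ.map_source' hY
  have hsymm : ∀ Y ∈ Ψ.source, Ψ.symm (π (F (Y : EG))) = Y := fun Y hY ↦ by
    rw [← (hΨ Y hY).2]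
    exact Ψ.left_inv' hY
  have hsrc : ∀ y ∈ Ψ.target, Ψ.symm y ∈ Ψ.source := fun y hy ↦ Ψ.map_target' hy
  let s : M → B := fun y ↦ F ((Ψ.symm y : negSpace gr) : EG)
  have hsF : ∀ Y ∈ Ψ.source, s (π (F (Y : EG))) = F (Y : EG) := fun Y hY ↦ by
    simp only [s, hsymm Y hY]
  have hs : ContMDiffOn 𝓘(ℝ, EM) 𝓘(ℝ, EB) ∞ s Ψ.target := by
    refine hF.contMDiffOn.comp (((negSpace gr).subtypeL.contDiff.contMDiff).comp_contMDiffOn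
      Ψ.contMDiffOn_invFun) fun y hy ↦ (hΨ _ (hsrc y hy)).1
  have hsec : ∀ y ∈ Ψ.target, π (s y) = y := fun y hy ↦
    (hΨ _ (hsrc y hy)).2.symm.trans (Ψ.right_inv' hy)
  obtain ⟨τ, hτ, hτw, hτs⟩ := hπ.exists_fiberCoordinate Ψ.open_target hs hsec
  -- In the trivialization by the exponential section `s`, the fibre coordinate is retracted to
  -- `G₀`.
  let σ' : B → B := fun w ↦ rmul (s (π w)) (r (τ w))
  have hσ's : ∀ y ∈ Ψ.target, ∀ p : P, σ' (rmul (s y) p) = rmul (s y) (r p) := fun y hy p ↦ by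
    simp only [σ', hτs y hy p, hπ.proj_rmul, hsec y hy]
  have hσ'p : ∀ w, π w ∈ Ψ.target → ∀ p : P, σ' (rmul w p) = rmul (s (π w)) (r (τ w * p)) :=
    fun w hw p ↦ by
      nth_rw 1 [← hτw w hw]
      rw [← rmul_mul, hσ's _ hw]
  -- The choice of representative does not matter over `Ψ.target`, since `r` is invariant under
  -- right multiplication by `P_+`.
  let σ : OrbitSpace EP P B gr → B := fun o ↦ σ' (Quotient.out o)
  have hσ : ∀ w, π w ∈ Ψ.target → σ (projPlus EP P gr w) = σ' w := by
    intro w hw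
    obtain ⟨n, hn, h⟩ := exists_out_projPlus (EP := EP) (P := P) (gr := gr) w
    change σ' (Quotient.out (projPlus EP P gr w)) = σ' w
    rw [h, hσ'p w hw, hrn _ n hn]
  have hσF : ∀ Y ∈ Ψ.source, ∀ p : P, σ (projPlus EP P gr (rmul (F (Y : EG)) p))
      = rmul (F (Y : EG)) (r p) := by
    intro Y hY p
    rw [hσ _ (by rw [hπ.proj_rmul]; exact hmemU Y hY), ← hsF Y hY, hσ's _ (hmemU Y hY)]
  refine ⟨Ψ.target, σ, ?_, ⟨Ψ.open_target, ?_, ?_, ?_⟩, ?_, Ψ, hΨ0, rfl, ?_⟩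
  · have h := hmemU 0 hΨ0
    rwa [Submodule.coe_zero, hF.map_zero] at h
  · refine ContMDiffOn.congr (f := σ') ?_ fun w hw ↦ hσ w hw
    exact hπ.contMDiff_rmul.comp_contMDiffOn
      ((hs.comp hπ.contMDiff_proj.contMDiffOn fun w hw ↦ hw).prodMk (hr.comp_contMDiffOn hτ))
  · intro w hw
    have h : σ' w = rmul w ((τ w)⁻¹ * r (τ w)) := by
      nth_rw 2 [← hτw w hw]
      rw [← rmul_mul, mul_inv_cancel_left]
    rw [hσ w hw, h, projPlus_rmul w (hrP _)]
  · intro w hw g hg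
    rw [hσ _ (by rwa [hπ.proj_rmul]), hσ w hw, hσ'p w hw, hrg _ g hg, rmul_mul]
  · intro w hw
    set Y := Ψ.symm (π w) with hYdef
    have hY : Y ∈ Ψ.source := hsrc _ hw
    set q := τ w
    have hwq : w = rmul (F (Y : EG)) q := (hτw w hw).symm
    -- The exponential coordinates of the flow line. They stay in `𝔤_-` because `exp(tA)` lies in
    -- `G₀`.
    let f : ℝ → negSpace gr := fun t ↦ ⟨adj ((gexp (t • A) : P) : G) (Y : EG), Ad_mem_neg (hG₀ t) Y.2⟩
    have hf : Continuous f :=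
      ((contDiff_adj_gexp_smul hP.isClosedLieSubgroup A (Y : EG)).continuous).subtype_mk _
    have hf0 : f 0 = Y := by
      refine Subtype.ext ?_
      change adj ((gexp ((0 : ℝ) • A) : P) : G) (Y : EG) = Y
      rw [coe_gexp_zero_smul, adj_one]
    obtain ⟨δ, hδ, hfδ⟩ : ∃ δ > 0, ∀ t ∈ Ioo (-δ) δ, f t ∈ Ψ.source := by
      have h1 := hf.continuousAt.eventually (Ψ.open_source.mem_nhds (by rwa [hf0] : f 0 ∈ Ψ.source))
      obtain ⟨δ, hδ, h2⟩ := Metric.eventually_nhds_iff.1 h1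
      refine ⟨δ, hδ, fun t ht ↦ h2 ?_⟩
      rw [Real.dist_eq, sub_zero]
      exact abs_lt.2 ht
    have hball : ∀ t ∈ Ioo (-δ) δ, adj ((gexp (t • A) : P) : G) (Y : EG) ∈ ball (0 : EG) ρ :=
      fun t ht ↦ (hΨ _ (hfδ t ht)).1
    have hconst : ∀ t ∈ Ioo (-δ) δ, flow (E := EB) XB (-t) (σ (projPlus EP P gr
        (flow (E := EB) XB t w))) = rmul (F (Y : EG)) (r q) := by
      intro t ht
      have h1 := hF.flow_rmul hP.isClosedLieSubgroup hπ hXB hA q (a := -δ) (b := δ)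
        ⟨by linarith, hδ⟩ ht hball
      rw [← hwq] at h1
      have h2 : flow (E := EB) XB t w = rmul (F (f t : EG)) ((gexp (t • A) : P) * q) := h1
      rw [h2, hσF _ (hfδ t ht), hgr _ _ (hG₀ t)]
      have h3 : ∀ s : ℝ, adj ((gexp (s • A) : P) : G) (f t : EG)
          = adj ((gexp ((s + t) • A) : P) : G) (Y : EG) := fun s ↦ by
        rw [gexp_add_smul, Subgroup.coe_mul, adj_mul]
      -- Flowing back from time `t`: the interval is shifted by `t`, so the coordinates at time `s`
      -- are those of the original flow line at time `s + t`, still in the ball.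
      have h4 := hF.flow_rmul hP.isClosedLieSubgroup hπ hXB hA (Y := (f t : EG))
        ((gexp (t • A) : P) * r q) (t := -t) (a := -δ - t) (b := δ - t)
        ⟨by linarith [ht.1], by linarith [ht.2]⟩ ⟨by linarith, by linarith⟩ fun s hs ↦ by
          rw [h3]
          exact hball _ ⟨by linarith [hs.1], by linarith [hs.2]⟩
      rw [h4, h3, ← mul_assoc, ← gexp_add_smul, neg_add_cancel, zero_smul, gexp_zero, one_mul,
        Subgroup.coe_one, adj_one]
    refine (hasMFDerivAt_const (I := 𝓘(ℝ, ℝ)) (I' := 𝓘(ℝ, EB)) (rmul (F (Y : EG)) (r q))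
      (0 : ℝ)).congr_of_eventuallyEq ?_
    filter_upwards [Ioo_mem_nhds (by linarith : -δ < 0) hδ] with t ht using hconst t ht
  · intro Y hY
    obtain ⟨h1, h2⟩ := hF.flow_eq (hΨ Y hY).1
    rw [h2]
    refine ⟨h1, (hΨ Y hY).2, fun g hg ↦ ?_⟩
    rw [hσF Y hY, hrid g hg]

end WeylStructures
end ParabolicGeometry
end

/-! ### Holonomy at a singularity and invariant local Weyl structures -/

theorem proposition4p6
    {EG EP EB EM : Type*}
    [NormedAddCommGroup EG] [NormedSpace ℝ EG] [FiniteDimensional ℝ EG]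
    [NormedAddCommGroup EP] [NormedSpace ℝ EP] [FiniteDimensional ℝ EP]
    [NormedAddCommGroup EB] [NormedSpace ℝ EB] [FiniteDimensional ℝ EB]
    [NormedAddCommGroup EM] [NormedSpace ℝ EM] [FiniteDimensional ℝ EM]
    -- the Lie group `G` and its parabolic subgroup `P`
    {G : Type*} [TopologicalSpace G] [T2Space G] [ChartedSpace EG G] [Group G]
    [LieGroup 𝓘(ℝ, EG) ∞ G]
    (P : Subgroup G) [ChartedSpace EP P] [LieGroup 𝓘(ℝ, EP) ∞ P]
    (gr : ParabolicGeometry.Grading (GroupLieAlgebra 𝓘(ℝ, EG) G))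
    (hP : ParabolicGeometry.IsParabolicPair (EP := EP) P gr)
    -- the parabolic geometry `(π : B → M, θ)` of type `(G, P)`
    {B : Type*} [TopologicalSpace B] [T2Space B] [ChartedSpace EB B] [IsManifold 𝓘(ℝ, EB) ∞ B]
    {M : Type*} [TopologicalSpace M] [T2Space M] [ChartedSpace EM M] [IsManifold 𝓘(ℝ, EM) ∞ M]
    [MulAction Pᵐᵒᵖ B] (π : B → M)
    (hπ : ParabolicGeometry.IsPrincipalBundle (EP := EP) (EB := EB) (EM := EM) P π)
    (θ : ∀ u : B, TangentSpace 𝓘(ℝ, EB) u →L[ℝ] GroupLieAlgebra 𝓘(ℝ, EG) G)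
    (hθ : ParabolicGeometry.IsCartanConnection (EP := EP) P θ)
    -- the infinitesimal automorphism: the vector field `X` on `M` with its lift `XB` to `B`
    (XB : ∀ u : B, TangentSpace 𝓘(ℝ, EB) u)
    (hXB : ParabolicGeometry.IsInfinitesimalAutomorphism P θ XB)
    (X : ∀ x : M, TangentSpace 𝓘(ℝ, EM) x)
    (hX : ∀ w : B, mfderiv 𝓘(ℝ, EB) 𝓘(ℝ, EM) π w (XB w) = X (π w))
    -- the singularity `x` and a point `u` over it
    (x : M) (hx : X x = 0) (u : B) (hu : π u = x) :
    (∃! h : ℝ → P, ParabolicGeometry.IsHolonomy P XB u h) ∧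
    ∀ h : ℝ → P, ParabolicGeometry.IsHolonomy P XB u h → ∀ p : P,
      -- the two forms of the condition on the holonomy agree
      θ (ParabolicGeometry.rmul u p) (XB (ParabolicGeometry.rmul u p))
        = ParabolicGeometry.Ad ((p : G)⁻¹) (θ u (XB u)) ∧
      ((∀ t : ℝ, p⁻¹ * h t * p ∈ ParabolicGeometry.G₀ P gr) ↔
        θ (ParabolicGeometry.rmul u p) (XB (ParabolicGeometry.rmul u p)) ∈ gr.comp 0) ∧
      -- the condition implies the existence of an invariant local Weyl structure around `x`
      ((∀ t : ℝ, p⁻¹ * h t * p ∈ ParabolicGeometry.G₀ P gr) →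
        ∃ (U : Set M) (σ : ParabolicGeometry.OrbitSpace EP P B gr → B),
          x ∈ U ∧
          ParabolicGeometry.IsLocalWeylStructure (EB := EB) P gr π U σ ∧
          ParabolicGeometry.LieDerivWeylEqZero P gr π XB U σ ∧
          ParabolicGeometry.IsExponentialWeyl (EM := EM) P gr θ π
            (ParabolicGeometry.rmul u p) U σ) := by
  have hX0 : ParabolicGeometry.tderiv (E := EB) (E' := EM) π u (XB u) = 0 := by
    have h := hX u
    rw [hu, hx] at h
    exact h
  -- `XB u` projects to `X x = 0`, so it is vertical; `A` is the generator of the holonomy with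
  -- respect to `u`, and `Ad(p⁻¹)A` the one with respect to `u.p`.
  obtain ⟨A, hA⟩ := hπ.exists_fund_eq u hX0
  refine ⟨ParabolicGeometry.existsUnique_isHolonomy hπ hXB hA.symm, fun h hh p ↦ ?_⟩
  have hAp := hXB.eq_fund_rmul hπ hA.symm p
  refine ⟨hθ.apply_rmul hXB u p, ?_, fun hG₀ ↦ ?_⟩
  · rw [ParabolicGeometry.conj_holonomy_mem_G₀_iff hP hπ hXB hA.symm hh p]
    have h1 := hθ.apply_fund (ParabolicGeometry.adj p⁻¹ A) (ParabolicGeometry.rmul u p)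
    rw [← hAp] at h1
    exact Iff.of_eq (congrArg (· ∈ gr.comp 0) h1.symm)
  · have hG₀' : ∀ t : ℝ, (ParabolicGeometry.gexp (t • ParabolicGeometry.adj p⁻¹ A) : P)
        ∈ ParabolicGeometry.G₀ P gr := by
      intro t
      have h1 := hG₀ t
      rwa [hh.eq_gexp hπ hXB hA.symm, ParabolicGeometry.inv_mul_gexp_mul, map_smul] at h1
    have h2 := ParabolicGeometry.exists_isLocalWeylStructure hP hπ hθ hXB
      (ParabolicGeometry.rmul u p) hAp hG₀'
    rwa [hπ.proj_rmul, hu] at h2
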